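/- Let $N\ge 1$, let $\nu\neq 0$ and $h>0$ be real, and let $c_0\in\mathbb C$ satisfy $c_0^2=-\mathrm i h\nu$. Let $\mathbb k$ be $\mathbb R$ or $\mathbb C$, and let the phase space be the set of $(x,p)\in\mathbb k^N\times\mathbb k^N$ with pairwise distinct $x_j$, with the canonical bracket $\{x_i,p_j\}=\delta_{ij}$ on $\mathbb C$-valued functions. Put $$L_{jk}=\delta_{jk}p_j+(1-\delta_{jk})\frac{\mathrm i\nu}{x_j-x_k},\qquad X=\mathrm{diag}(x_1,\dots,x_N),\qquad F_k=\operatorname{tr}L^k,$$ $$\widetilde J_k=\operatorname{tr}\big[X(1-hc_0^{-1}L)L^{k-1}\big],\qquad \widetilde K_{m,n}=\widetilde J_mF_n-F_m\widetilde J_n ,$$ and $\alpha=-\sqrt h/c_0$, so that $\alpha\sqrt h=-hc_0^{-1}$. (The index $0$ is allowed; $\widetilde J_0$ involves $L^{-1}$, with the convention $L^{-1}:=0$ where $L$ is singular, and it cancels from the formulas below.) Let $\widetilde{\mathcal A}^{(N)}$ be the algebra of functions generated over $\mathbb C$ by $\widetilde{\mathcal S}^{(N)}=\{F_k\}_{1\le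 k\le N}\cup\{\widetilde K_{m,n}\}_{1\le n<m\le N}$. Then: 1. $\alpha=\pm(1+\mathrm i)/\sqrt{2\nu}$, with the sign fixed by the choice of $c_0$. Every element of $\widetilde{\mathcal A}^{(N)}$ is an analytic function on phase space and is an integral of motion of the Nijhoff--Pang correspondence $(x,p)\mapsto(\bar x,\bar p)$ given, where all $\bar x_j-x_k+c_0\ne0$, by $$p_k=\tfrac{c_0}{h}\Big[1-c_0\sum_{j}\tfrac1{\bar x_j-x_k+c_0}+c_0\sum_{j\ne k}\tfrac1{x_j-x_k}\Big],\qquad \bar p_k=\tfrac{c_0}{h}\Big[1-c_0\sum_{j}\tfrac1{\bar x_k-x_j+c_0}+c_0\sum_{j\ne k}\tfrac1{\bar x_k-\bar x_j}\Big].$$ 2. $\widetilde{\mathcal A}^{(N)}$ is closed under the Poisson bracket, and for all $i,j,m,n\ge1$ one has $\{F_m,F_n\}=0$, $$\{F_i,\widetilde K_{m,n}\}=i(F_mF_{i+n-2}-F_nF_{i+m-2})+i\alpha\sqrt h\,(F_mF_{i+n-1}-F_nF_{i+m-1}),$$ $$\{\widetilde K_{i,j},\widetilde K_{m,n}\}=\Theta_2+\alpha\sqrt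 h\,\Theta_1,$$ where $$\begin{aligned}\Theta_d={}&F_i(m\widetilde K_{n,j+m-d}+n\widetilde K_{j+n-d,m})+F_j(m\widetilde K_{i+m-d,n}+n\widetilde K_{m,i+n-d})\\&+F_m(i\widetilde K_{i+n-d,j}+j\widetilde K_{i,j+n-d})+F_n(i\widetilde K_{j,i+m-d}+j\widetilde K_{j+m-d,i}).\end{aligned}$$ 3. With the complete exponential Bell polynomials $B_k(y_1,\dots,y_k)=k!\sum_{1j_1+\dots+kj_k=k}\prod_{i=1}^k\frac{y_i^{j_i}}{(i!)^{j_i}j_i!}$ and $b_k=\frac1{k!}B_k(-0!F_1,-1!F_2,\dots,-(k-1)!F_k)$, the functions whose indices leave the range $1,\dots,N$ are determined by the closure relations $$F_{N+s}=-\sum_{k=1}^N b_kF_{N+s-k},\qquad \widetilde K_{N+s,\ell}=-\sum_{k=1}^N b_k\widetilde K_{N+s-k,\ell}\qquad(s,\ell\ge1),$$ $$F_j\widetilde K_{0,i}-F_i\widetilde K_{0,j}=N\widetilde K_{j,i}\qquad(i,j\ge 1).$$ 4. The ideal of $\widetilde{\mathcal A}^{(N)}$ generated by $F_1,\dots,F_N$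 is a Poisson ideal: it is stable under brackets with all of $\widetilde{\mathcal A}^{(N)}$. Moreover, the bracket of any generator with a polynomial in $F_1,\dots,F_N$ is a polynomial in $F_1,\dots,F_N$. 5. Define the degree of a function in a generating set as the least total degree of a complex polynomial expressing it in the generators, and the degree of the algebra as the largest degree of a bracket of two generators. For $N\ge2$, $\deg\widetilde{\mathcal A}^{(N)}=2N$. If $\mathcal A^{(N)}$ denotes the symmetry algebra of the continuous Calogero--Moser model, generated by $\{F_k\}_{1\le k\le N}\cup\{K_{m,n}\}_{1\le n<m\le N}$ with $K_{m,n}=J_mF_n-J_nF_m$, $J_k=\operatorname{tr}(XL^{k-1})$, then $\deg\widetilde{\mathcal A}^{(N)}=\deg\mathcal A^{(N)}+1$ for $N>2$ and $\deg\widetilde{\mathcal A}^{(2)}=\deg\mathcal A^{(2)}+2$. -/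

import Mathlib

noncomputable section

namespace CalogeroMoser

open Matrix

/-! ### Phase space, observables and the canonical Poisson bracket -/

/-- The set of pairs `(x, p)` of positions and momenta of `N` particles over `𝕜` (`ℝ` or `ℂ`),
with pairwise distinct positions. -/
def phaseSet (𝕜 : Type*) (N : ℕ) : Set ((Fin N → 𝕜) × (Fin N → 𝕜)) :=
  {z | Function.Injective z.1}

/-- The phase space. -/
abbrev PhaseSpace (𝕜 : Type*) (N : ℕ) : Type _ := ↥(phaseSet 𝕜 N)

/-- Complex-valued functions on phase space, with pointwise algebra operations. -/
abbrev Observable (𝕜 : Type*) (N : ℕ) : Type _ := PhaseSpace 𝕜 N → ℂ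

variable {𝕜 : Type*} [RCLike 𝕜] [NormedAlgebra 𝕜 ℂ] {N : ℕ}

/-- Extension of an observable by zero to the whole vector space. As phase space is open, the
derivatives at points of phase space do not depend on the extension. -/
def ext (f : Observable 𝕜 N) : (Fin N → 𝕜) × (Fin N → 𝕜) → ℂ :=
  Function.extend Subtype.val f 0

/-- Regular observables: analytic over `𝕜` at every point of phase space. -/
def IsAnalytic (f : Observable 𝕜 N) : Prop :=
  AnalyticOnNhd 𝕜 (ext f) (phaseSet 𝕜 N)

/-- `∂f/∂x_i`. -/
def dPos (i : Fin N) (f : Observable 𝕜 N) : Observable 𝕜 N :=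
  fun z => fderiv 𝕜 (ext f) z.1 (Pi.single i 1, 0)

/-- `∂f/∂p_i`. -/
def dMom (i : Fin N) (f : Observable 𝕜 N) : Observable 𝕜 N :=
  fun z => fderiv 𝕜 (ext f) z.1 (0, Pi.single i 1)

/-- The canonical Poisson bracket, with `{x_i, p_j} = δ_{ij}`. -/
def poissonBracket (f g : Observable 𝕜 N) : Observable 𝕜 N :=
  ∑ i : Fin N, (dPos i f * dMom i g - dMom i f * dPos i g)

/-! ### Lax matrix and the functions `F_k`, `J_k`, `K_{m,n}`, `K̃_{m,n}` -/

/-- Position `x_j` as a complex number. -/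
def pos (z : PhaseSpace 𝕜 N) (j : Fin N) : ℂ := algebraMap 𝕜 ℂ (z.1.1 j)

/-- Momentum `p_j` as a complex number. -/
def mom (z : PhaseSpace 𝕜 N) (j : Fin N) : ℂ := algebraMap 𝕜 ℂ (z.1.2 j)

/-- The Lax matrix `L_{jk} = δ_{jk} p_j + (1 - δ_{jk}) iν / (x_j - x_k)`. -/
def laxL (ν : ℝ) (z : PhaseSpace 𝕜 N) : Matrix (Fin N) (Fin N) ℂ :=
  Matrix.of fun j k => if j = k then mom z j else Complex.I * (ν : ℂ) / (pos z j - pos z k)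

/-- `X = diag(x_1, …, x_N)`. -/
def posX (z : PhaseSpace 𝕜 N) : Matrix (Fin N) (Fin N) ℂ := Matrix.diagonal (pos z)

/-- `F_k = tr L^k`, for `k ≥ 0`. -/
def F (ν : ℝ) (k : ℕ) : Observable 𝕜 N := fun z => (laxL ν z ^ k).trace

/-- `J_k = tr (X L^{k-1})`, for `k ≥ 0`. -/
def J (ν : ℝ) (k : ℕ) : Observable 𝕜 N :=
  fun z => (posX z * laxL ν z ^ ((k : ℤ) - 1)).trace

/-- The continuous-time integrals `K_{m,n} = J_m F_n - J_n F_m`. -/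
def K (ν : ℝ) (m n : ℕ) : Observable 𝕜 N := J ν m * F ν n - J ν n * F ν m

/-- `tr [X (1 - h c₀⁻¹ L) L^{k-1}]`. -/
def Jt (ν h : ℝ) (c₀ : ℂ) (k : ℕ) : Observable 𝕜 N :=
  fun z => (posX z * (1 - ((h : ℂ) * c₀⁻¹) • laxL ν z) * laxL ν z ^ ((k : ℤ) - 1)).trace

/-- The discrete-time integrals
`K̃_{m,n} = tr[X(1 - h c₀⁻¹ L)L^{m-1}] tr(L^n) - tr(L^m) tr[X(1 - h c₀⁻¹ L)L^{n-1}]`. -/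
def Kt (ν h : ℝ) (c₀ : ℂ) (m n : ℕ) : Observable 𝕜 N :=
  Jt ν h c₀ m * F ν n - F ν m * Jt ν h c₀ n

/-- The coefficient `α`, for which `α √h = - h c₀⁻¹`. -/
def alpha (h : ℝ) (c₀ : ℂ) : ℂ := -((Real.sqrt h : ℂ) / c₀)

/-! ### The Nijhoff--Pang correspondence -/

/-- `(x̄, p̄) = z'` is an image of `(x, p) = z` under the Nijhoff--Pang correspondence. -/
def NPStep (h : ℝ) (c₀ : ℂ) (z z' : PhaseSpace 𝕜 N) : Prop :=
  (∀ j k, pos z' j - pos z k + c₀ ≠ 0) ∧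
  (∀ k, mom z k = c₀ / (h : ℂ) *
    (1 - c₀ * ∑ j, 1 / (pos z' j - pos z k + c₀)
       + c₀ * ∑ j ∈ Finset.univ.erase k, 1 / (pos z j - pos z k))) ∧
  (∀ k, mom z' k = c₀ / (h : ℂ) *
    (1 - c₀ * ∑ j, 1 / (pos z' k - pos z j + c₀)
       + c₀ * ∑ j ∈ Finset.univ.erase k, 1 / (pos z' k - pos z' j)))

/-! ### Complete exponential Bell polynomials -/

/-- `B_k(y_1, …, y_k) = k! ∑_{1 j_1 + ⋯ + k j_k = k} ∏_i y_i^{j_i} / ((i!)^{j_i} j_i!)`.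
The index `i : Fin k` stands for `i + 1`. -/
def completeBell (k : ℕ) (y : ℕ → ℂ) : ℂ :=
  (k.factorial : ℂ) *
    ∑ j : Fin k → Fin (k + 1) with ∑ i : Fin k, ((i : ℕ) + 1) * (j i : ℕ) = k,
      ∏ i : Fin k, y ((i : ℕ) + 1) ^ (j i : ℕ) /
        ((((i : ℕ) + 1).factorial : ℂ) ^ (j i : ℕ) * ((j i : ℕ).factorial : ℂ))

/-- The observable `(1/k!) B_k(-0! F_1, -1! F_2, …, -(k-1)! F_k)`. -/
def bellF (ν : ℝ) (k : ℕ) : Observable 𝕜 N :=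
  fun z => 1 / (k.factorial : ℂ) *
    completeBell k (fun i => -(((i - 1).factorial : ℕ) : ℂ) * F ν i z)

/-! ### Symmetry algebras and their degree -/

/-- Index set of the generators: `Sum.inl k` for `F_{k+1}`, and `Sum.inr (m, n)` with `n < m` for
the second-type generator with indices `m + 1, n + 1`. -/
abbrev GenIndex (N : ℕ) : Type := Fin N ⊕ {mn : Fin N × Fin N // mn.2 < mn.1}

/-- The generators `F_k`, `1 ≤ k ≤ N`, and `K_{m,n}`, `1 ≤ n < m ≤ N`, of the continuous model. -/
def gen (ν : ℝ) : GenIndex N → Observable 𝕜 N :=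
  Sum.elim (fun k => F ν (k + 1)) (fun mn => K ν (mn.1.1 + 1) (mn.1.2 + 1))

/-- The generators `F_k`, `1 ≤ k ≤ N`, and `K̃_{m,n}`, `1 ≤ n < m ≤ N`, of the discrete model. -/
def genDiscrete (ν h : ℝ) (c₀ : ℂ) : GenIndex N → Observable 𝕜 N :=
  Sum.elim (fun k => F ν (k + 1)) (fun mn => Kt ν h c₀ (mn.1.1 + 1) (mn.1.2 + 1))

/-- The symmetry algebra of the discrete model: the algebra of polynomials in its generators. -/
def symAlgebra (𝕜 : Type*) [RCLike 𝕜] [NormedAlgebra 𝕜 ℂ] (N : ℕ) (ν h : ℝ) (c₀ : ℂ) :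
    Subalgebra ℂ (Observable 𝕜 N) :=
  Algebra.adjoin ℂ (Set.range (genDiscrete ν h c₀))

/-- The ideal of the symmetry algebra generated by `F_1, …, F_N`. -/
def idealF (𝕜 : Type*) [RCLike 𝕜] [NormedAlgebra 𝕜 ℂ] (N : ℕ) (ν h : ℝ) (c₀ : ℂ) :
    Ideal (symAlgebra 𝕜 N ν h c₀) :=
  Ideal.span {a | ∃ k : Fin N, (a : Observable 𝕜 N) = F ν (k + 1)}

/-- The degree of an observable in a family of generators `g`: the least total degree of a
polynomial that expresses it in the generators (`⊤` if there is none). -/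
def degreeIn {ι : Type*} (g : ι → Observable 𝕜 N) (f : Observable 𝕜 N) : ℕ∞ :=
  ⨅ (P : MvPolynomial ι ℂ) (_ : MvPolynomial.aeval g P = f), (P.totalDegree : ℕ∞)

/-- The degree of the polynomial Poisson algebra with generators `g`: the largest degree, in the
generators, of a Poisson bracket of two generators. -/
def algebraDegree {ι : Type*} (g : ι → Observable 𝕜 N) : ℕ∞ :=
  ⨆ (a : ι) (b : ι), degreeIn g (poissonBracket (g a) (g b))

end CalogeroMoser

end

open CalogeroMoser

/-!
Everything rests on the Lax matrix `L`. Put `J_k(a) = tr [X (1 + a L) L^{k-1}]` and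
`K_{m,n}(a) = J_m(a) F_n - F_m J_n(a)`; the value `a = 0` is the continuous model and
`a = -h/c₀ = α √h` the discrete one, so that both are treated at once.

*Brackets.* Up to conjugation by an evolving matrix, the Hamiltonian flows of the functions `tr L^k`
and `tr (X L^k)` are those on arbitrary pairs of matrices `(X, L)`, restricted to pairs with
`[X, L] = iν (E - 1)`, where all entries of `E` are `1` (`lax_equations`, `hamDer_lax`). Conjugation
does not change traces, so the brackets are those of free motion: `poissonBracket_F_F`,
`poissonBracket_moment_F`, `poissonBracket_moment_moment`. The brackets of the `K_{m,n}(a)` follow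
by the Leibniz rule. As `{F_i, K_{m,n}(a)}` is a combination of products `F_m F_q` and `F_n F_q`,
the `F_k` generate a Poisson ideal.

*Integrals of motion.* For an image of the Nijhoff–Pang correspondence, let `M` be the matrix with
entries `1 / (x̄_j - x_k + c₀)`. It is a Cauchy matrix, hence invertible, and the equations of the
correspondence say that `L̄ M = M L` (`discrete_lax`). So the `F_k` are conserved. Moreover
`X̄ M - M X = E - c₀ M`, and the column sums of `1 + a L` are `c₀` times those of `M`; as the sum of
all entries of `L^k` is its trace (`sum_lax_pow`), this gives `J̄_k = J_k + h F_k` for `a = -h/c₀`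
(`Ja_step`); the `K̃_{m,n}` are therefore conserved.

*Closure relations.* By Newton's identities, `b_k` is the coefficient of `t^{N-k}` in the
characteristic polynomial of `L`; the closure relations for `F_{N+s}` and `K̃_{N+s,l}` are the
Cayley–Hamilton theorem multiplied by a power of `L`, and by `X (1 + a L)` times such a power, under
the trace. They reduce every bracket of two generators to a polynomial in the generators, of degree
at most `2N`, or `2N - 1` when `a = 0` (`degLE_bracket_genA`).

*Lower bound for the degree.* The functions `F_k`, `J_k(a)` with `1 ≤ k ≤ N` are algebraically
independent (`independent`): when the particles are moved far apart, `L` becomes diagonal, and the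
statement becomes the independence of the corresponding sums over free particles. A polynomial in
the generators that represents a polynomial `Q` in the `F_k` has total degree at least that of `Q`,
as one sees by setting the `K_{m,n}` to zero (`drop_Ka`). The bracket `{F_N, K_{N,1}}` is a
polynomial in the `F_k`, and its degree is read off at `F_1 = t`, `F_2 = … = F_N = 0`
(`aeval_spike_topBracketPoly`).
-/

noncomputable section

namespace CalogeroMoser

open Matrix

/-! ### Newton's identities -/

section Newton

variable {R S : Type*} [CommRing R] [Algebra ℂ R] [CommRing S] [Algebra ℂ S]

/-- The coefficients `b_k` attached to a sequence `f` of power sums by Newton's identities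
`k b_k = -∑_{i < k} f_{k-i} b_i`, `b_0 = 1`; the value `f_0` is not used. If `f_k` is the sum of the
`k`-th powers of `r_1, r_2, …`, then `b_k` is `(-1)^k` times the `k`-th elementary symmetric
function of the `r_i`. -/
def newtonCoeff (f : ℕ → R) : ℕ → R
  | 0 => 1
  | k + 1 => -(((k : ℂ) + 1)⁻¹ • ∑ i : Fin (k + 1), f (k + 1 - i) * newtonCoeff f i)
decreasing_by exact i.2

theorem newtonCoeff_zero (f : ℕ → R) : newtonCoeff f 0 = 1 := by
  rw [newtonCoeff]

theorem newtonCoeff_rec (f : ℕ → R) (k : ℕ) :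
    (k : ℂ) • newtonCoeff f k = -∑ i ∈ Finset.range k, f (k - i) * newtonCoeff f i := by
  cases k with
  | zero => simp
  | succ k =>
    have h : (k : ℂ) + 1 ≠ 0 := Nat.cast_add_one_ne_zero k
    rw [newtonCoeff, smul_neg, smul_smul, Nat.cast_add_one, mul_inv_cancel₀ h, one_smul,
      Finset.sum_range]

theorem newtonCoeff_unique (f b : ℕ → R) (n : ℕ) (h0 : b 0 = 1)
    (h : ∀ k ≤ n, (k : ℂ) • b k = -∑ i ∈ Finset.range k, f (k - i) * b i) :
    ∀ k ≤ n, b k = newtonCoeff f k := by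
  intro k
  induction k using Nat.strong_induction_on with
  | _ k ih =>
    intro hk
    rcases Nat.eq_zero_or_pos k with rfl | hpos
    · rw [h0, newtonCoeff_zero]
    · have hk0 : (k : ℂ) ≠ 0 := Nat.cast_ne_zero.2 hpos.ne'
      have : (k : ℂ) • b k = (k : ℂ) • newtonCoeff f k := by
        rw [h k hk, newtonCoeff_rec]
        congr 1
        refine Finset.sum_congr rfl fun i hi => ?_
        have hi' := Finset.mem_range.1 hi
        rw [ih i hi' (by omega)]
      have h2 := congrArg (fun y => (k : ℂ)⁻¹ • y) this
      simpa only [smul_smul, inv_mul_cancel₀ hk0, one_smul] using h2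

theorem newtonCoeff_congr {f g : ℕ → R} {n : ℕ} (h : ∀ k, 1 ≤ k → k ≤ n → f k = g k) :
    ∀ k ≤ n, newtonCoeff f k = newtonCoeff g k := by
  refine newtonCoeff_unique g _ n (newtonCoeff_zero f) fun k hk => ?_
  rw [newtonCoeff_rec]
  congr 1
  refine Finset.sum_congr rfl fun i hi => ?_
  have hi' := Finset.mem_range.1 hi
  rw [h _ (by omega) (by omega)]

theorem map_newtonCoeff (φ : R →ₐ[ℂ] S) (f : ℕ → R) (k : ℕ) :
    φ (newtonCoeff f k) = newtonCoeff (fun i => φ (f i)) k := by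
  refine newtonCoeff_unique (fun i => φ (f i)) (fun k => φ (newtonCoeff f k)) k ?_ ?_ k le_rfl
  · simp [newtonCoeff_zero]
  · intro k _
    rw [← map_smul, newtonCoeff_rec]
    simp

/-- Newton's identities also determine the power sums from the coefficients. -/
theorem eq_of_newtonCoeff_eq {f g : ℕ → R} {n : ℕ}
    (h : ∀ k ≤ n, newtonCoeff f k = newtonCoeff g k) :
    ∀ k, 1 ≤ k → k ≤ n → f k = g k := by
  intro k
  induction k using Nat.strong_induction_on with
  | _ k ih =>
    intro hk1 hkn
    have h1 := newtonCoeff_rec f k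
    rw [h k hkn, newtonCoeff_rec, neg_inj] at h1
    obtain ⟨k, rfl⟩ : ∃ l, k = l + 1 := ⟨k - 1, by omega⟩
    rw [Finset.sum_range_succ', Finset.sum_range_succ'] at h1
    have h2 : ∑ i ∈ Finset.range k, g (k + 1 - (i + 1)) * newtonCoeff g (i + 1) =
        ∑ i ∈ Finset.range k, f (k + 1 - (i + 1)) * newtonCoeff f (i + 1) := by
      refine Finset.sum_congr rfl fun i hi => ?_
      have hi' := Finset.mem_range.1 hi
      rw [ih (k + 1 - (i + 1)) (by omega) (by omega) (by omega), h (i + 1) (by omega)]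
    rw [h2] at h1
    simpa [newtonCoeff_zero] using (add_left_cancel h1).symm

/-- Extension of `f_0, …, f_n` to an infinite sequence by the linear recurrence
`f_{n+s} = -∑_{k=1}^n b_k f_{n+s-k}`, which power sums of `n` quantities satisfy. -/
def newtonExtend (n : ℕ) (f : ℕ → R) (k : ℕ) : R :=
  if k ≤ n then f k
  else -∑ i : Fin n, newtonCoeff f (i + 1) * newtonExtend n f (k - (i + 1))
termination_by k
decreasing_by omega

theorem newtonExtend_of_le {n : ℕ} (f : ℕ → R) {k : ℕ} (h : k ≤ n) : newtonExtend n f k = f k := by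
  rw [newtonExtend, if_pos h]

theorem newtonExtend_of_lt {n : ℕ} (f : ℕ → R) {k : ℕ} (h : n < k) :
    newtonExtend n f k =
      -∑ i ∈ Finset.Icc 1 n, newtonCoeff f i * newtonExtend n f (k - i) := by
  rw [newtonExtend, if_neg (by omega), ← Finset.sum_range (f := fun i => newtonCoeff f (i + 1) *
    newtonExtend n f (k - (i + 1))), Finset.range_eq_Ico,
    Finset.sum_Ico_add' (fun i => newtonCoeff f i * newtonExtend n f (k - i)) 0 n 1]
  rfl

theorem newtonExtend_unique {n : ℕ} (f g : ℕ → R) (h0 : ∀ k ≤ n, g k = f k)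
    (h : ∀ k, n < k → g k = -∑ i ∈ Finset.Icc 1 n, newtonCoeff f i * g (k - i)) (k : ℕ) :
    g k = newtonExtend n f k := by
  induction k using Nat.strong_induction_on with
  | _ k ih =>
    rcases le_or_gt k n with hk | hk
    · rw [h0 k hk, newtonExtend_of_le f hk]
    · rw [h k hk, newtonExtend_of_lt f hk]
      congr 1
      refine Finset.sum_congr rfl fun i hi => ?_
      have := Finset.mem_Icc.1 hi
      rw [ih (k - i) (by omega)]

theorem map_newtonExtend (φ : R →ₐ[ℂ] S) (n : ℕ) (f : ℕ → R) (k : ℕ) :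
    φ (newtonExtend n f k) = newtonExtend n (fun i => φ (f i)) k := by
  refine newtonExtend_unique (fun i => φ (f i)) (fun k => φ (newtonExtend n f k))
    (fun k hk => by simp only [newtonExtend_of_le f hk]) (fun k hk => ?_) k
  simp only [newtonExtend_of_lt f hk, map_neg, map_sum, map_mul, map_newtonCoeff]

end Newton

/-! ### Bell polynomials -/

section Bell

/-- Exponent vectors `j` with `∑ (i + 1) j_i = k`. -/
def partitionVectors (m k : ℕ) : Finset (Fin m → ℕ) :=
  {j ∈ Fintype.piFinset fun _ : Fin m => Finset.range (k + 1) |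
    ∑ i : Fin m, ((i : ℕ) + 1) * j i = k}

theorem mem_partitionVectors {m k : ℕ} {j : Fin m → ℕ} :
    j ∈ partitionVectors m k ↔ ∑ i : Fin m, ((i : ℕ) + 1) * j i = k := by
  simp only [partitionVectors, Finset.mem_filter, Fintype.mem_piFinset, Finset.mem_range,
    and_iff_right_iff_imp]
  rintro rfl i
  have h := Finset.single_le_sum (f := fun i : Fin m => ((i : ℕ) + 1) * j i)
    (fun _ _ => Nat.zero_le _) (Finset.mem_univ i)
  have h2 : j i ≤ ((i : ℕ) + 1) * j i := Nat.le_mul_of_pos_left _ (Nat.succ_pos _)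
  omega

/-- The coefficient of `t^k` in `exp (∑_{i ≤ m} z_i t^i)`. -/
def expCoeff (z : ℕ → ℂ) (m k : ℕ) : ℂ :=
  ∑ j ∈ partitionVectors m k, ∏ i : Fin m, z ((i : ℕ) + 1) ^ j i / ((j i).factorial : ℂ)

/-- Weighting the terms of `expCoeff` by the exponent `j_i` amounts to taking out one factor `z_i`:
substitute `j ↦ j - e_i`. -/
theorem sum_mul_expCoeff_term (z : ℕ → ℂ) (m k : ℕ) (i : Fin m) :
    ∑ j ∈ partitionVectors m k,
      (j i : ℂ) * ∏ l : Fin m, z ((l : ℕ) + 1) ^ j l / ((j l).factorial : ℂ) =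
    if (i : ℕ) + 1 ≤ k then z ((i : ℕ) + 1) * expCoeff z m (k - (i + 1)) else 0 := by
  have key : ∀ j : Fin m → ℕ, ∑ l : Fin m, ((l : ℕ) + 1) * (j + Pi.single i 1 : Fin m → ℕ) l =
      ∑ l : Fin m, ((l : ℕ) + 1) * j l + (i + 1) := by
    intro j
    simp only [Pi.add_apply, mul_add, Finset.sum_add_distrib]
    congr 1
    rw [Finset.sum_eq_single i] <;> simp +contextual
  have sub : ∀ j : Fin m → ℕ, j i ≠ 0 → (j - Pi.single i 1) + Pi.single i 1 = j := by
    intro j hj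
    ext l
    rcases eq_or_ne l i with rfl | h
    · simp; omega
    · simp [h]
  rw [← Finset.sum_filter_add_sum_filter_not _ (fun j => j i ≠ 0)]
  rw [Finset.sum_eq_zero (s := {j ∈ partitionVectors m k | ¬ j i ≠ 0}) (by
    intro j hj
    have := (Finset.mem_filter.1 hj).2
    simp only [ne_eq, not_not] at this
    simp [this]), add_zero]
  split_ifs with hk
  · rw [expCoeff, Finset.mul_sum]
    refine Finset.sum_nbij' (fun j => j - Pi.single i 1) (fun j => j + Pi.single i 1) ?_ ?_ ?_ ?_ ?_
    · intro j hj
      have hj' := Finset.mem_filter.1 hj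
      rw [mem_partitionVectors] at hj' ⊢
      have := key (j - Pi.single i 1)
      rw [sub j hj'.2, hj'.1] at this
      omega
    · intro j hj
      rw [mem_partitionVectors] at hj
      rw [Finset.mem_filter, mem_partitionVectors, key, hj]
      refine ⟨by omega, by simp⟩
    · intro j hj
      exact sub j (Finset.mem_filter.1 hj).2
    · intro j hj
      ext l; simp
    · intro j hj
      have hj' := (Finset.mem_filter.1 hj).2
      have hi : (j - Pi.single i 1 : Fin m → ℕ) i = j i - 1 := by simp
      have hl : ∀ l, l ≠ i → (j - Pi.single i 1 : Fin m → ℕ) l = j l := fun l h => by simp [h]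
      generalize (j - Pi.single i 1 : Fin m → ℕ) = j' at hi hl
      rw [← Finset.mul_prod_erase _ _ (Finset.mem_univ i),
        ← Finset.mul_prod_erase (Finset.univ) (fun l : Fin m =>
          z ((l : ℕ) + 1) ^ j' l / ((j' l).factorial : ℂ))
          (Finset.mem_univ i), ← mul_assoc, ← mul_assoc]
      congr 1
      · obtain ⟨q, hq⟩ := Nat.exists_eq_succ_of_ne_zero hj'
        have h1 : (q : ℂ) + 1 ≠ 0 := Nat.cast_add_one_ne_zero q
        have h2 : (q.factorial : ℂ) ≠ 0 := Nat.cast_ne_zero.2 q.factorial_ne_zero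
        simp only [hi, hq, Nat.succ_eq_add_one, Nat.add_sub_cancel,
          Nat.factorial_succ, Nat.cast_mul, Nat.cast_add, Nat.cast_one]
        field_simp
        ring
      · refine Finset.prod_congr rfl fun l h => ?_
        rw [hl l (Finset.ne_of_mem_erase h)]
  · refine Finset.sum_eq_zero fun j hj => ?_
    exfalso
    have hj' := Finset.mem_filter.1 hj
    rw [mem_partitionVectors] at hj'
    have h := Finset.single_le_sum (f := fun i : Fin m => ((i : ℕ) + 1) * j i)
      (fun _ _ => Nat.zero_le _) (Finset.mem_univ i)
    have h2 : (i : ℕ) + 1 ≤ ((i : ℕ) + 1) * j i :=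
      Nat.le_mul_of_pos_right _ (Nat.pos_of_ne_zero hj'.2)
    omega

/-- The logarithmic derivative of `exp (∑ z_i t^i)`, coefficient by coefficient. -/
theorem expCoeff_rec (z : ℕ → ℂ) (m k : ℕ) (hk : k ≤ m) :
    (k : ℂ) * expCoeff z m k =
      ∑ i ∈ Finset.range k, ((i : ℂ) + 1) * z (i + 1) * expCoeff z m (k - (i + 1)) := by
  have h1 : (k : ℂ) * expCoeff z m k = ∑ i : Fin m, ((i : ℂ) + 1) *
      ∑ j ∈ partitionVectors m k,
        (j i : ℂ) * ∏ l : Fin m, z ((l : ℕ) + 1) ^ j l / ((j l).factorial : ℂ) := by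
    simp only [Finset.mul_sum]
    rw [Finset.sum_comm, expCoeff, Finset.mul_sum]
    refine Finset.sum_congr rfl fun j hj => ?_
    rw [mem_partitionVectors] at hj
    simp only [← mul_assoc]
    rw [← Finset.sum_mul, ← hj]
    push_cast
    rfl
  rw [h1]
  simp only [sum_mul_expCoeff_term]
  rw [Finset.sum_fin_eq_sum_range, ← Finset.sum_subset (Finset.range_mono hk)]
  · refine Finset.sum_congr rfl fun i hi => ?_
    have := Finset.mem_range.1 hi
    rw [dif_pos (by omega), if_pos (by simp; omega), mul_assoc]
  · intro i hi hi'
    rw [Finset.mem_range] at hi hi'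
    rw [dif_pos hi, if_neg (by simp; omega), mul_zero]

theorem expCoeff_zero (z : ℕ → ℂ) (m : ℕ) : expCoeff z m 0 = 1 := by
  have : partitionVectors m 0 = {0} := by
    ext j
    rw [mem_partitionVectors, Finset.mem_singleton]
    simp [funext_iff]
  simp [expCoeff, this]

theorem completeBell_eq (f : ℕ → ℂ) (k : ℕ) :
    1 / (k.factorial : ℂ) * completeBell k (fun i => -(((i - 1).factorial : ℕ) : ℂ) * f i) =
      expCoeff (fun i => -(f i / i)) k k := by
  have hk : (k.factorial : ℂ) ≠ 0 := Nat.cast_ne_zero.2 k.factorial_ne_zero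
  rw [completeBell, ← mul_assoc, one_div, inv_mul_cancel₀ hk, one_mul, expCoeff]
  refine Finset.sum_nbij (fun j i => (j i : ℕ)) ?_ ?_ ?_ ?_
  · intro j hj
    rw [mem_partitionVectors]
    exact (Finset.mem_filter.1 hj).2
  · intro j _ j' _ h
    ext i
    exact congrFun h i
  · intro j hj
    have hj' : j ∈ partitionVectors k k := hj
    rw [partitionVectors, Finset.mem_filter, Fintype.mem_piFinset] at hj'
    refine ⟨fun i => ⟨j i, Finset.mem_range.1 (hj'.1 i)⟩, ?_, rfl⟩
    simpa using hj'.2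
  · intro j _
    refine Finset.prod_congr rfl fun i _ => ?_
    have h1 : (((i : ℕ) + 1 : ℕ) : ℂ) ≠ 0 := Nat.cast_ne_zero.2 (Nat.succ_ne_zero _)
    have h2 : (((i : ℕ)).factorial : ℂ) ≠ 0 := Nat.cast_ne_zero.2 (Nat.factorial_ne_zero _)
    rw [← div_div, ← div_pow]
    congr 2
    rw [Nat.add_sub_cancel, Nat.factorial_succ, Nat.cast_mul]
    field_simp

/-- The Bell polynomials of the closure relations are the coefficients of Newton's identities: both
are the coefficients of `exp (-∑ f_i t^i / i)`. -/
theorem completeBell_eq_newtonCoeff (f : ℕ → ℂ) (k : ℕ) :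
    1 / (k.factorial : ℂ) * completeBell k (fun i => -(((i - 1).factorial : ℕ) : ℂ) * f i) =
      newtonCoeff f k := by
  rw [completeBell_eq]
  refine newtonCoeff_unique f (expCoeff (fun i => -(f i / i)) k) k (expCoeff_zero _ _)
    (fun l hl => ?_) k le_rfl
  rw [smul_eq_mul, expCoeff_rec _ _ _ hl, ← Finset.sum_range_reflect, ← Finset.sum_neg_distrib]
  refine Finset.sum_congr rfl fun i hi => ?_
  have hi' := Finset.mem_range.1 hi
  have h1 : l - 1 - i + 1 = l - i := by omega
  have h2 : ((l - 1 - i : ℕ) : ℂ) + 1 = ((l - i : ℕ) : ℂ) := by rw [← h1]; push_cast; ring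
  have h3 : ((l - i : ℕ) : ℂ) ≠ 0 := Nat.cast_ne_zero.2 (by omega)
  rw [h2, h1, show l - (l - i) = i by omega]
  field_simp

end Bell

/-! ### Power sums of eigenvalues -/

section Eigenvalues

open Polynomial in
/-- The determinant of `q(A)` in terms of the eigenvalues. Applied to `q = C y - X ^ k`, it gives
the characteristic polynomial of `A ^ k`, hence the trace of `A ^ k`. -/
theorem det_aeval_eq_prod {N : ℕ} (A : Matrix (Fin N) (Fin N) ℂ) (r : Fin N → ℂ)
    (hr : A.charpoly = ∏ i, (X - C (r i))) (q : ℂ[X]) :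
    (aeval A q).det = ∏ i, q.eval (r i) := by
  have hlin : ∀ a : ℂ, (aeval A (X - C a)).det = ∏ i, (X - C a).eval (r i) := by
    intro a
    have h1 := congrArg (eval a) hr
    rw [eval_charpoly, eval_prod] at h1
    have h2 : aeval A (X - C a) = -(scalar (Fin N) a - A) := by
      simp [Algebra.algebraMap_eq_smul_one, ← smul_one_eq_diagonal]
    rw [h2, det_neg, h1, Fintype.card_fin, ← Fin.prod_const, ← Finset.prod_mul_distrib]
    refine Finset.prod_congr rfl fun i _ => ?_
    simp
  have hs := (IsAlgClosed.splits q).eq_prod_roots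
  rw [hs, map_mul, det_mul]
  have h3 : ∀ s : Multiset ℂ, (aeval A (s.map fun a => X - C a).prod).det =
      ∏ i, (s.map fun a => X - C a).prod.eval (r i) := by
    intro s
    induction s using Multiset.induction_on with
    | empty => simp
    | cons a s ih =>
      rw [Multiset.map_cons, Multiset.prod_cons, map_mul, det_mul, ih, hlin,
        ← Finset.prod_mul_distrib]
      refine Finset.prod_congr rfl fun i _ => ?_
      rw [eval_mul]
  rw [h3]
  simp only [eval_mul, Finset.prod_mul_distrib, eval_C]
  congr 1
  rw [aeval_C, Algebra.algebraMap_eq_smul_one, det_smul]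
  simp

theorem exists_fin_map_eq {N : ℕ} (s : Multiset ℂ) (hs : s.card = N) :
    ∃ r : Fin N → ℂ, s = Finset.univ.val.map r := by
  obtain ⟨l, rfl⟩ : ∃ l : List ℂ, (l : Multiset ℂ) = s := ⟨s.toList, s.coe_toList⟩
  rw [Multiset.coe_card] at hs
  subst hs
  refine ⟨fun i => l.get i, ?_⟩
  have : ((Finset.univ : Finset (Fin l.length)).val.map fun i => l.get i) =
      ((List.finRange l.length).map l.get : List ℂ) := rfl
  rw [this, List.map_get_finRange]

open Polynomial in
theorem exists_eigenvalues {N : ℕ} (A : Matrix (Fin N) (Fin N) ℂ) :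
    ∃ r : Fin N → ℂ, A.charpoly = ∏ i, (X - C (r i)) ∧
      ∀ k : ℕ, (A ^ k).trace = ∑ i, r i ^ k := by
  have hs := IsAlgClosed.splits A.charpoly
  have hcard : A.charpoly.roots.card = N := by
    rw [splits_iff_card_roots.1 hs, charpoly_natDegree_eq_dim, Fintype.card_fin]
  obtain ⟨r, hr⟩ := exists_fin_map_eq _ hcard
  have hprod : A.charpoly = ∏ i, (X - C (r i)) := by
    have := hs.eq_prod_roots
    rw [(charpoly_monic A).leadingCoeff, C_1, one_mul, hr, Multiset.map_map] at this
    exact this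
  refine ⟨r, hprod, fun k => ?_⟩
  have hpow : (A ^ k).charpoly = ∏ i, (X - C (r i ^ k)) := by
    refine Polynomial.funext fun y => ?_
    have := det_aeval_eq_prod A r hprod (C y - X ^ k)
    rw [eval_charpoly, eval_prod]
    simpa [Algebra.algebraMap_eq_smul_one, ← smul_one_eq_diagonal] using this
  rw [trace_eq_sum_roots_charpoly, hpow]
  have : ∏ i, (X - C (r i ^ k)) =
      ((Finset.univ.val.map fun i => r i ^ k).map fun a => X - C a).prod := by
    rw [Multiset.map_map]; rfl
  rw [this, roots_multiset_prod_X_sub_C]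
  rfl

theorem newtonCoeff_powerSum {N : ℕ} (r : Fin N → ℂ) (k : ℕ) :
    newtonCoeff (fun k => ∑ i, r i ^ k) k = (-1) ^ k * (Finset.univ.val.map r).esymm k := by
  symm
  refine newtonCoeff_unique (fun k => ∑ i, r i ^ k)
    (fun k => (-1) ^ k * (Finset.univ.val.map r).esymm k) k ?_ (fun l _ => ?_) k le_rfl
  · simp [Multiset.esymm]
  · have h := congrArg (MvPolynomial.aeval r) (MvPolynomial.mul_esymm_eq_sum (Fin N) ℂ l)
    simp only [map_mul, map_natCast, map_pow, map_neg, map_one, map_sum, MvPolynomial.psum,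
      MvPolynomial.aeval_X, MvPolynomial.aeval_esymm_eq_multiset_esymm] at h
    rw [smul_eq_mul, mul_left_comm, h, ← mul_assoc, ← pow_add,
      Odd.neg_one_pow ⟨l, by ring⟩, neg_one_mul, neg_inj, Finset.sum_filter,
      Finset.Nat.sum_antidiagonal_eq_sum_range_succ_mk, Finset.sum_range_succ]
    simp only [lt_irrefl, if_false, add_zero]
    refine Finset.sum_congr rfl fun i hi => ?_
    rw [if_pos (Finset.mem_range.1 hi)]
    ring

open Polynomial in
/-- A monic polynomial with given roots, written with the coefficients attached to the power sums
of the roots. -/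
theorem prod_X_sub_C_eq_newtonCoeff {N : ℕ} (r : Fin N → ℂ) :
    ∏ i, (X - C (r i)) = ∑ k ∈ Finset.range (N + 1),
      C (newtonCoeff (fun k => ∑ i, r i ^ k) k) * X ^ (N - k) := by
  have h := Multiset.prod_X_sub_X_eq_sum_esymm (Finset.univ.val.map r)
  rw [Multiset.map_map, Multiset.card_map, Finset.card_val, Finset.card_univ, Fintype.card_fin] at h
  refine h.trans (Finset.sum_congr rfl fun k _ => ?_)
  rw [newtonCoeff_powerSum]
  simp [mul_assoc]

/-- The Cayley–Hamilton theorem, with the coefficients of the characteristic polynomial expressed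
through the traces of powers. -/
theorem pow_add_eq_newtonCoeff {N : ℕ} (A : Matrix (Fin N) (Fin N) ℂ) (s : ℕ) :
    A ^ (N + s) =
      -∑ k ∈ Finset.Icc 1 N, newtonCoeff (fun k => (A ^ k).trace) k • A ^ (N + s - k) := by
  obtain ⟨r, hr, htr⟩ := exists_eigenvalues A
  have h := aeval_self_charpoly A
  rw [hr, prod_X_sub_C_eq_newtonCoeff, map_sum] at h
  simp only [htr]
  have h2 := congrArg (fun B => B * A ^ s) h
  simp only [zero_mul, Finset.sum_mul] at h2
  rw [Finset.range_eq_Ico, Finset.sum_eq_sum_Ico_succ_bot (Nat.succ_pos N)] at h2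
  rw [eq_neg_iff_add_eq_zero]
  convert h2 using 2
  · simp [newtonCoeff_zero, pow_add]
  · refine Finset.sum_congr rfl fun k hk => ?_
    have := Finset.mem_Icc.1 hk
    rw [map_mul, map_pow, Polynomial.aeval_C, Polynomial.aeval_X, Algebra.algebraMap_eq_smul_one,
      smul_mul_assoc, one_mul, smul_mul_assoc, ← pow_add, Nat.sub_add_comm this.2]

open Polynomial in
/-- Every `N`-tuple of complex numbers consists of the first `N` power sums of `N` numbers. -/
theorem exists_powerSum_eq (N : ℕ) (f : ℕ → ℂ) :
    ∃ r : Fin N → ℂ, ∀ k, 1 ≤ k → k ≤ N → ∑ i, r i ^ k = f k := by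
  set q : ℂ[X] := X ^ N + ∑ k ∈ Finset.range N, C (newtonCoeff f (N - k)) * X ^ k with hq
  have hdeg : (∑ k ∈ Finset.range N, C (newtonCoeff f (N - k)) * X ^ k).degree <
      (N : WithBot ℕ) := by
    refine (degree_sum_le _ _).trans_lt
      ((Finset.sup_lt_iff (WithBot.bot_lt_coe N)).2 fun k hk => ?_)
    exact (degree_C_mul_X_pow_le _ _).trans_lt (Nat.cast_lt.2 (Finset.mem_range.1 hk))
  have hmon : q.Monic := monic_X_pow_add hdeg
  have hnat : q.natDegree = N := by
    rw [hq, add_comm]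
    exact (natDegree_add_eq_right_of_degree_lt (by rwa [degree_X_pow])).trans (natDegree_X_pow N)
  have hs := IsAlgClosed.splits q
  obtain ⟨r, hr⟩ := exists_fin_map_eq q.roots ((splits_iff_card_roots.1 hs).trans hnat)
  have hprod : q = ∏ i, (X - C (r i)) := by
    have := hs.eq_prod_roots
    rw [hmon.leadingCoeff, C_1, one_mul, hr, Multiset.map_map] at this
    exact this
  refine ⟨r, fun k hk1 hk => ?_⟩
  refine eq_of_newtonCoeff_eq (f := fun k => ∑ i, r i ^ k) (g := f) (n := N) (fun l hl => ?_)
    k hk1 hk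
  have h1 := congrArg (fun p => coeff p (N - l)) hprod
  rw [prod_X_sub_C_eq_newtonCoeff] at h1
  simp only [hq, coeff_add, coeff_X_pow, finsetSum_coeff, coeff_C_mul, mul_ite, mul_one,
    mul_zero] at h1
  have h2 : ∑ x ∈ Finset.range (N + 1),
      (if N - l = N - x then newtonCoeff (fun k => ∑ i, r i ^ k) x else 0) =
      newtonCoeff (fun k => ∑ i, r i ^ k) l := by
    rw [Finset.sum_eq_single l]
    · simp
    · intro x hx hxl
      have := Finset.mem_range.1 hx
      rw [if_neg (by omega)]
    · intro h; exact absurd (Finset.mem_range.2 (by omega)) h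
  rw [h2] at h1
  rw [← h1, Finset.sum_ite_eq]
  rcases Nat.eq_zero_or_pos l with rfl | hl0
  · simp [newtonCoeff_zero]
  · rw [if_neg (by omega), if_pos (Finset.mem_range.2 (by omega)), show N - (N - l) = l by omega,
      zero_add]

theorem powerSum_eq_newtonExtend {N : ℕ} (r : Fin N → ℂ) (f : ℕ → ℂ)
    (hf : ∀ k ≤ N, ∑ i, r i ^ k = f k) (k : ℕ) : ∑ i, r i ^ k = newtonExtend N f k := by
  refine newtonExtend_unique f (fun k => ∑ i, r i ^ k) hf (fun k hk => ?_) k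
  have hb : ∀ i ≤ N, newtonCoeff (fun k => ∑ i, r i ^ k) i = newtonCoeff f i :=
    newtonCoeff_congr fun k _ hk => hf k hk
  have h : ∀ j, r j ^ k = -∑ i ∈ Finset.Icc 1 N, newtonCoeff f i * r j ^ (k - i) := by
    intro j
    have h1 := congrArg (Polynomial.eval (r j)) (prod_X_sub_C_eq_newtonCoeff r)
    rw [Polynomial.eval_prod, Finset.prod_eq_zero (Finset.mem_univ j) (by simp),
      Polynomial.eval_finsetSum] at h1
    have h2 := congrArg (fun y => y * r j ^ (k - N)) h1
    simp only [zero_mul, Finset.sum_mul] at h2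
    rw [Finset.range_eq_Ico, Finset.sum_eq_sum_Ico_succ_bot (Nat.succ_pos N)] at h2
    rw [eq_neg_iff_add_eq_zero]
    refine Eq.trans ?_ h2.symm
    congr 1
    · rw [newtonCoeff_zero]; simp [← pow_add, Nat.add_sub_cancel' hk.le]
    · refine Finset.sum_congr rfl fun i hi => ?_
      have := Finset.mem_Icc.1 hi
      rw [← hb i this.2]
      simp only [Polynomial.eval_mul, Polynomial.eval_C, Polynomial.eval_pow, Polynomial.eval_X]
      rw [mul_assoc, ← pow_add]
      congr 2
      omega
  simp only [Finset.mul_sum]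
  rw [Finset.sum_comm, ← Finset.sum_neg_distrib]
  exact Finset.sum_congr rfl fun j _ => h j

end Eigenvalues

/-! ### The sequence with only the first power sum nonzero -/

section Spike

variable {R : Type*} [CommRing R] [Algebra ℂ R]

/-- When `f_2 = ⋯ = f_n = 0`, the coefficients are those of the exponential series. -/
theorem newtonCoeff_spike (f : ℕ → R) (n : ℕ) (hf : ∀ k, 2 ≤ k → k ≤ n → f k = 0) :
    ∀ k ≤ n, newtonCoeff f k = ((k.factorial : ℂ))⁻¹ • (-f 1) ^ k := by
  intro k hk
  symm
  refine newtonCoeff_unique f (fun k => ((k.factorial : ℂ))⁻¹ • (-f 1) ^ k) n (by simp) ?_ k hk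
  intro k hk
  cases k with
  | zero => simp
  | succ k =>
    rw [Finset.sum_range_succ, Finset.sum_eq_zero]
    · have h1 : (k : ℂ) + 1 ≠ 0 := Nat.cast_add_one_ne_zero k
      rw [smul_smul, Nat.factorial_succ, Nat.cast_mul, mul_inv, ← mul_assoc,
        Nat.cast_add_one, mul_inv_cancel₀ h1, one_mul, Nat.add_sub_cancel_left, zero_add, pow_succ,
        mul_smul_comm]
      simp [mul_comm]
    · intro i hi
      have := Finset.mem_range.1 hi
      rw [hf _ (by omega) (by omega), zero_mul]

/-- When `f_2 = ⋯ = f_n = 0`, the power sums `f_{n+1+j}` with `j < n` are nonzero multiples of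
`f_1^{n+1+j}`. -/
theorem newtonExtend_spike (f : ℕ → R) (n : ℕ) (hn : 1 ≤ n)
    (hf : ∀ k, 2 ≤ k → k ≤ n → f k = 0) :
    ∀ j < n, newtonExtend n f (n + 1 + j) =
      -(((n.factorial : ℂ)⁻¹ * (j.factorial : ℂ)⁻¹ * (-1) ^ n) • f 1 ^ (n + 1 + j)) := by
  intro j
  induction j using Nat.strong_induction_on with
  | _ j ih =>
    intro hj
    have hb := newtonCoeff_spike f n hf
    rw [newtonExtend_of_lt f (by omega)]
    rcases Nat.eq_zero_or_pos j with rfl | hj0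
    · rw [Finset.sum_eq_single n]
      · rw [hb n le_rfl, newtonExtend_of_le f (by omega), show n + 1 + 0 - n = 1 by omega,
          smul_mul_assoc, neg_pow, ← smul_one_mul ((_ : ℂ)) (f 1 ^ _)]
        have : ((-1 : R)) ^ n = ((-1 : ℂ) ^ n) • (1 : R) := by
          rw [← Algebra.algebraMap_eq_smul_one]; simp
        rw [this, smul_mul_assoc, smul_mul_assoc, smul_mul_assoc, smul_smul]
        simp [pow_succ]
      · intro i hi hne
        have := Finset.mem_Icc.1 hi
        rw [newtonExtend_of_le f (by omega), hf _ (by omega) (by omega), mul_zero]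
      · intro h; exact absurd (Finset.mem_Icc.2 ⟨hn, le_rfl⟩) h
    · rw [← Finset.sum_subset (Finset.Icc_subset_Icc_right hj.le)]
      · -- the alternating sum of inverse factorials is the binomial expansion of `(1 - 1)^j`
        have hbin : ∑ i ∈ Finset.Icc 1 j,
            ((i.factorial : ℂ)⁻¹ * (-1) ^ i) * ((j - i).factorial : ℂ)⁻¹ =
            -(j.factorial : ℂ)⁻¹ := by
          have h1 := add_pow (-1 : ℂ) 1 j
          rw [neg_add_cancel, zero_pow hj0.ne', Finset.range_eq_Ico,
            Finset.sum_eq_sum_Ico_succ_bot (Nat.succ_pos j)] at h1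
          have hjf : (j.factorial : ℂ) ≠ 0 := Nat.cast_ne_zero.2 j.factorial_ne_zero
          have h2 : ∑ i ∈ Finset.Icc 1 j,
              ((i.factorial : ℂ)⁻¹ * (-1) ^ i) * ((j - i).factorial : ℂ)⁻¹ =
              (j.factorial : ℂ)⁻¹ * ∑ k ∈ Finset.Ico (0 + 1) (j + 1),
                (-1 : ℂ) ^ k * 1 ^ (j - k) * (j.choose k : ℂ) := by
            rw [Finset.mul_sum]
            refine Finset.sum_congr rfl fun i hi => ?_
            have := Finset.mem_Icc.1 hi
            rw [Nat.cast_choose ℂ this.2]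
            field_simp
            simp
          rw [h2]
          have h3 : ∑ k ∈ Finset.Ico (0 + 1) (j + 1),
                (-1 : ℂ) ^ k * 1 ^ (j - k) * (j.choose k : ℂ) = -1 := by
            simp only [pow_zero, one_pow, Nat.choose_zero_right, Nat.cast_one, mul_one] at h1 ⊢
            linear_combination -h1
          rw [h3, mul_neg_one]
        have hterm : ∀ i ∈ Finset.Icc 1 j, newtonCoeff f i * newtonExtend n f (n + 1 + j - i) =
            (((i.factorial : ℂ)⁻¹ * (-1) ^ i) * ((j - i).factorial : ℂ)⁻¹) •
              (-(((n.factorial : ℂ)⁻¹ * (-1) ^ n) • f 1 ^ (n + 1 + j))) := by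
          intro i hi
          have := Finset.mem_Icc.1 hi
          rw [hb i (by omega), show n + 1 + j - i = n + 1 + (j - i) by omega,
            ih (j - i) (by omega) (by omega), neg_pow]
          have h1 : ((-1 : R)) ^ i = ((-1 : ℂ) ^ i) • (1 : R) := by
            rw [← Algebra.algebraMap_eq_smul_one]; simp
          rw [h1, show n + 1 + j = i + (n + 1 + (j - i)) by omega, pow_add (f 1) i]
          simp only [smul_mul_assoc, one_mul, mul_neg, mul_smul_comm, smul_neg, smul_smul]
          congr 2
          ring
        rw [Finset.sum_congr rfl hterm, ← Finset.sum_smul, hbin]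
        simp only [smul_neg, neg_neg, smul_smul]
        rw [neg_mul, neg_smul]
        congr 2
        ring
      · intro i hi hi'
        have h1 := Finset.mem_Icc.1 hi
        have h2 : ¬ i ≤ j := fun h => hi' (Finset.mem_Icc.2 ⟨h1.1, h⟩)
        rw [newtonExtend_of_le f (by omega), hf _ (by omega) (by omega), mul_zero]

end Spike

/-! ### Lax equations for derivations of a commutative algebra -/

section Derivations

set_option linter.unusedSectionVars false

variable {A : Type*} [CommRing A] [Algebra ℂ A] {n : Type*} [Fintype n] [DecidableEq n]

theorem map_derivation_mul (D : Derivation ℂ A A) (Y W : Matrix n n A) :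
    (Y * W).map D = Y.map D * W + Y * W.map D := by
  ext j k
  simp only [Matrix.map_apply, Matrix.mul_apply, Matrix.add_apply, map_sum, Derivation.leibniz,
    smul_eq_mul, ← Finset.sum_add_distrib]
  refine Finset.sum_congr rfl fun i _ => ?_
  ring

theorem derivation_trace (D : Derivation ℂ A A) (Y : Matrix n n A) :
    D Y.trace = (Y.map D).trace := by
  simp [Matrix.trace]

theorem map_derivation_one (D : Derivation ℂ A A) : (1 : Matrix n n A).map D = 0 := by
  ext j k
  simp only [Matrix.map_apply, Matrix.one_apply, Matrix.zero_apply]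
  split_ifs <;> simp

/-- The matrix `∑_{i < k} L^{k-1-i} Y L^i`: the gradient of `tr (Y L^k)` with respect to `L`. -/
def momentDeriv (L Y : Matrix n n A) (k : ℕ) : Matrix n n A :=
  ∑ i ∈ Finset.range k, L ^ (k - 1 - i) * Y * L ^ i

theorem momentDeriv_succ (L Y : Matrix n n A) (k : ℕ) :
    momentDeriv L Y (k + 1) = L * momentDeriv L Y k + Y * L ^ k := by
  rw [momentDeriv, Finset.sum_range_succ, momentDeriv, Finset.mul_sum]
  congr 1
  · refine Finset.sum_congr rfl fun i hi => ?_
    have := Finset.mem_range.1 hi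
    rw [← mul_assoc, ← mul_assoc, ← pow_succ', show k - 1 - i + 1 = k + 1 - 1 - i by omega]
  · simp

theorem momentDeriv_commutator (L Y : Matrix n n A) (k : ℕ) :
    momentDeriv L Y k * L - L * momentDeriv L Y k = Y * L ^ k - L ^ k * Y := by
  induction k with
  | zero => simp [momentDeriv]
  | succ k ih =>
    have h : momentDeriv L Y k * L = L * momentDeriv L Y k + (Y * L ^ k - L ^ k * Y) := by
      rw [← ih]; abel
    have h2 : L ^ (k + 1) * Y = L * L ^ k * Y := by rw [pow_succ']
    rw [momentDeriv_succ, add_mul, mul_assoc, h, h2, pow_succ L k]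
    noncomm_ring

theorem trace_momentDeriv_mul_pow (L Y : Matrix n n A) (k m : ℕ) :
    (momentDeriv L Y k * L ^ m).trace = (k : A) * (Y * L ^ (m + k - 1)).trace := by
  rw [momentDeriv, Finset.sum_mul, Matrix.trace_sum, ← nsmul_eq_mul, ← Finset.card_range k,
    ← Finset.sum_const]
  refine Finset.sum_congr (by simp) fun i hi => ?_
  have := Finset.mem_range.1 hi
  rw [Matrix.trace_mul_comm, ← mul_assoc, ← mul_assoc, ← pow_add, mul_assoc,
    Matrix.trace_mul_comm, mul_assoc, ← pow_add, Finset.card_range]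
  congr 3
  omega

theorem trace_mul_map_pow (D : Derivation ℂ A A) (L : Matrix n n A) (k : ℕ) :
    ∀ Y : Matrix n n A, (Y * (L ^ k).map D).trace = (momentDeriv L Y k * L.map D).trace := by
  induction k with
  | zero => intro Y; simp [momentDeriv, map_derivation_one]
  | succ k ih =>
    intro Y
    rw [pow_succ, map_derivation_mul, mul_add, Matrix.trace_add, ← mul_assoc, ← mul_assoc,
      Matrix.trace_mul_comm, ← mul_assoc, ih, momentDeriv_succ, add_mul, Matrix.trace_add]
    congr 2
    rw [momentDeriv, momentDeriv, Finset.mul_sum]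
    congr 1
    refine Finset.sum_congr rfl fun i hi => ?_
    rw [← mul_assoc, ← mul_assoc, ← mul_assoc, (Commute.pow_self L _).eq]

/-- The Lax matrix with diagonal `p` and off-diagonal entries `c u_{jk}`, where `u_{jk}` stands for
`1 / (x_j - x_k)`, so that it makes sense over a commutative ring. -/
def laxOf (p : n → A) (c : A) (u : n → n → A) : Matrix n n A :=
  Matrix.of fun j k => if j = k then p j else c * u j k

/-- The matrix with entries `c u_{jk}^2` off the diagonal, for which
`∂L/∂x_i` is the commutator of `laxDeriv` with the `i`-th diagonal unit. -/
def laxDeriv (c : A) (u : n → n → A) : Matrix n n A :=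
  Matrix.of fun j k => if j = k then 0 else c * u j k ^ 2

/-- The second matrix of the Lax pair belonging to the evolution `dX = B`: off the diagonal it
solves `[X, M] = -B`, and its row sums vanish. -/
def laxPartner (u : n → n → A) (B : Matrix n n A) : Matrix n n A :=
  Matrix.of fun j k => if j = k then ∑ l ∈ Finset.univ.erase j, B j l * u j l else -(B j k * u j k)

variable {x p : n → A} {c : A} {u : n → n → A}

section

variable (hu : ∀ j k, j ≠ k → u j k * (x j - x k) = 1)
include hu

theorem u_antisymm {j k : n} (h : j ≠ k) : u k j = -u j k := by
  have h1 := hu j k h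
  have h2 := hu k j h.symm
  linear_combination (-u k j) * h1 + (-u j k) * h2

theorem derivation_u (D : Derivation ℂ A A) {j k : n} (h : j ≠ k) :
    D (u j k) = -(u j k ^ 2 * (D (x j) - D (x k))) := by
  have h1 := hu j k h
  have h2 := congrArg D h1
  rw [Derivation.leibniz, Derivation.map_one_eq_zero, map_sub, smul_eq_mul, smul_eq_mul] at h2
  linear_combination (-D (u j k)) * h1 + u j k * h2

theorem commutator_pos_lax : diagonal x * laxOf p c u - laxOf p c u * diagonal x =
    c • (Matrix.of (fun _ _ => (1 : A)) - 1 : Matrix n n A) := by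
  ext j k
  simp only [Matrix.sub_apply, Matrix.diagonal_mul, Matrix.mul_diagonal, laxOf, Matrix.of_apply,
    Matrix.smul_apply, Matrix.one_apply, smul_eq_mul]
  split_ifs with h
  · subst h; ring
  · linear_combination c * hu j k h

/-- The sum of all entries of `L^k` is its trace: pair `[X, L] = c (E - 1)`, where all entries of
`E` are `1`, with `L^k` under the trace. -/
theorem sum_lax_pow (hc : IsUnit c) (k : ℕ) :
    ∑ i, ∑ j, (laxOf p c u ^ k) i j = (laxOf p c u ^ k).trace := by
  have h := congrArg (fun Y => (Y * laxOf p c u ^ k).trace)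
    (commutator_pos_lax (p := p) (c := c) hu)
  simp only [sub_mul, Matrix.trace_sub, Matrix.smul_mul, Matrix.trace_smul, one_mul] at h
  have h1 : (diagonal x * laxOf p c u * laxOf p c u ^ k).trace =
      (laxOf p c u * diagonal x * laxOf p c u ^ k).trace := by
    rw [mul_assoc, ← pow_succ', mul_assoc, Matrix.trace_mul_comm (laxOf p c u), mul_assoc,
      ← pow_succ]
  rw [h1, sub_self, smul_eq_mul, eq_comm, hc.mul_right_eq_zero, sub_eq_zero] at h
  rw [← h]
  simp only [Matrix.trace, Matrix.diag_apply, Matrix.mul_apply, Matrix.of_apply, one_mul]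
  exact Finset.sum_comm

/-- The Lax equations, by Hamiltonian reduction. The vector field `(dX, dL) = (B, -C)` is tangent to
the set of pairs of matrices with fixed commutator (`hBC`); conjugation by `M` brings it back to
diagonal `X`. It suffices to know the motion of the diagonal entries of `X` and `L`: the commutation
relation of `X` and `L` determines the rest. -/
theorem lax_equations (D : Derivation ℂ A A) (hc : D c = 0) (B C : Matrix n n A)
    (hBC : B * laxOf p c u - laxOf p c u * B = diagonal x * C - C * diagonal x)
    (hx : ∀ i, D (x i) = B i i)
    (hp : ∀ i, D (p i) = -((C + B * laxDeriv c u - laxDeriv c u * B) i i)) :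
    (laxOf p c u).map D = -C + (laxOf p c u * laxPartner u B - laxPartner u B * laxOf p c u) ∧
      (diagonal x).map D = B + (diagonal x * laxPartner u B - laxPartner u B * diagonal x) := by
  set M := laxPartner u B with hM
  have hX : (diagonal x).map D = B + (diagonal x * M - M * diagonal x) := by
    ext j k
    simp only [Matrix.map_apply, Matrix.add_apply, Matrix.sub_apply, Matrix.diagonal_mul,
      Matrix.mul_diagonal, hM, laxPartner, Matrix.of_apply, Matrix.diagonal_apply]
    split_ifs with h
    · subst h; rw [hx]; ring
    · rw [map_zero]; linear_combination B j k * hu j k h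
  refine ⟨?_, hX⟩
  set L := laxOf p c u with hL
  set X := diagonal x with hXd
  set G := L.map D + C - (L * M - M * L) with hG
  have hXL : X * L - L * X = c • (Matrix.of (fun _ _ => (1 : A)) - 1 : Matrix n n A) :=
    commutator_pos_lax hu
  have hD : X * L.map D - L.map D * X = -(X.map D * L - L * X.map D) := by
    have h1 : (X * L - L * X).map D = 0 := by
      rw [hXL]
      ext j k
      simp only [Matrix.map_apply, Matrix.smul_apply, Matrix.sub_apply, Matrix.of_apply,
        Matrix.one_apply, smul_eq_mul, Matrix.zero_apply]
      split_ifs <;> simp [hc]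
    rw [Matrix.map_sub D (fun a b => map_sub D a b), map_derivation_mul, map_derivation_mul] at h1
    rw [eq_neg_iff_add_eq_zero, ← h1]
    abel
  have hME : M * Matrix.of (fun _ _ => (1 : A)) = 0 := by
    ext j k
    simp only [Matrix.mul_apply, Matrix.of_apply, mul_one, Matrix.zero_apply]
    rw [← Finset.add_sum_erase _ _ (Finset.mem_univ j), hM]
    simp only [laxPartner, Matrix.of_apply, if_true]
    rw [← Finset.sum_add_distrib]
    refine Finset.sum_eq_zero fun l hl => ?_
    rw [if_neg (Finset.ne_of_mem_erase hl).symm]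
    ring
  have hXG : X * G - G * X = -(c • (Matrix.of (fun _ _ => (1 : A)) * M)) := by
    have h1 : X * G - G * X = (X * L.map D - L.map D * X) + (X * C - C * X)
        - (X * (L * M - M * L) - (L * M - M * L) * X) := by
      rw [hG]; noncomm_ring
    have h2 : X * G - G * X = -((X * L - L * X) * M - M * (X * L - L * X)) := by
      rw [h1, hD, ← hBC, hX]; noncomm_ring
    rw [h2, hXL, Matrix.smul_mul, Matrix.mul_smul, sub_mul, mul_sub, hME, one_mul, mul_one,
      ← smul_sub]
    congr 2
    abel
  have hcol : ∀ k, c * ∑ l, M l k = 0 := by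
    intro k
    have h := congrFun (congrFun hXG k) k
    simp only [Matrix.sub_apply, hXd, Matrix.diagonal_mul, Matrix.mul_diagonal, Matrix.neg_apply,
      Matrix.smul_apply, smul_eq_mul] at h
    simp only [Matrix.mul_apply, Matrix.of_apply, one_mul] at h
    linear_combination h
  have hG0 : G = 0 := by
    ext j k
    rw [Matrix.zero_apply]
    rcases eq_or_ne j k with rfl | h
    · have h1 : G j j = D (p j) + C j j - (∑ k, (L j k * M k j - M j k * L k j)) := by
        rw [hG]
        simp [Matrix.mul_apply, hL, laxOf]
      have h3 : (C + B * laxDeriv c u - laxDeriv c u * B) j j =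
          C j j + ∑ k, (B j k * laxDeriv c u k j - laxDeriv c u j k * B k j) := by
        simp only [Matrix.sub_apply, Matrix.add_apply, Matrix.mul_apply, Finset.sum_sub_distrib]
        ring
      rw [h1, hp, h3]
      have h2 : ∑ k, (B j k * laxDeriv c u k j - laxDeriv c u j k * B k j) +
          ∑ k, (L j k * M k j - M j k * L k j) = 0 := by
        rw [← Finset.sum_add_distrib]
        refine Finset.sum_eq_zero fun k _ => ?_
        rcases eq_or_ne j k with rfl | h
        · simp only [laxDeriv, Matrix.of_apply, if_true]; ring
        · simp only [laxDeriv, hL, hM, laxOf, laxPartner, Matrix.of_apply, if_neg h, if_neg h.symm,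
            u_antisymm hu h]
          ring
      linear_combination -h2
    · have h1 := congrFun (congrFun hXG j) k
      simp only [Matrix.sub_apply, hXd, Matrix.diagonal_mul, Matrix.mul_diagonal, Matrix.neg_apply,
        Matrix.smul_apply, smul_eq_mul] at h1
      simp only [Matrix.mul_apply, Matrix.of_apply, one_mul, hcol] at h1
      linear_combination (-G j k) * hu j k h + u j k * h1
  rw [hG, sub_eq_zero, ← eq_sub_iff_add_eq] at hG0
  rw [hG0]
  abel

end

theorem map_pow_of_lax (D : Derivation ℂ A A) (L M C : Matrix n n A) (hLC : Commute L C)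
    (hL : L.map D = -C + (L * M - M * L)) (k : ℕ) :
    (L ^ k).map D = -((k : A) • (L ^ (k - 1) * C)) + (L ^ k * M - M * L ^ k) := by
  induction k with
  | zero => simp [map_derivation_one]
  | succ k ih =>
    rw [pow_succ, map_derivation_mul, ih, hL, Nat.add_sub_cancel]
    have h1 : (k : A) • (L ^ (k - 1) * C) * L = (k : A) • (L ^ k * C) := by
      cases k with
      | zero => simp
      | succ k =>
        rw [smul_mul_assoc, mul_assoc, ← hLC.eq, ← mul_assoc, Nat.add_sub_cancel, pow_succ]
    have h2 : ((k + 1 : ℕ) : A) • (L ^ k * C) = (k : A) • (L ^ k * C) + L ^ k * C := by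
      rw [Nat.cast_add_one, add_smul, one_smul]
    rw [h2, add_mul, neg_mul, h1]
    noncomm_ring

theorem trace_commutator (Y M : Matrix n n A) : (Y * M - M * Y).trace = 0 := by
  rw [Matrix.trace_sub, Matrix.trace_mul_comm, sub_self]

theorem derivation_trace_pow_of_lax (D : Derivation ℂ A A) (L M C : Matrix n n A)
    (hLC : Commute L C) (hL : L.map D = -C + (L * M - M * L)) (k : ℕ) :
    D (L ^ k).trace = -((k : A) * (L ^ (k - 1) * C).trace) := by
  rw [derivation_trace, map_pow_of_lax D L M C hLC hL, Matrix.trace_add, trace_commutator,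
    add_zero, Matrix.trace_neg, Matrix.trace_smul, smul_eq_mul]

theorem derivation_trace_moment_of_lax (D : Derivation ℂ A A) (X L M B C : Matrix n n A)
    (hLC : Commute L C) (hL : L.map D = -C + (L * M - M * L))
    (hX : X.map D = B + (X * M - M * X)) (k : ℕ) :
    D (X * L ^ k).trace = (B * L ^ k).trace - (k : A) * (X * L ^ (k - 1) * C).trace := by
  rw [derivation_trace, map_derivation_mul, hX, map_pow_of_lax D L M C hLC hL]
  have : (B + (X * M - M * X)) * L ^ k +
      X * (-((k : A) • (L ^ (k - 1) * C)) + (L ^ k * M - M * L ^ k)) =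
      B * L ^ k - (k : A) • (X * L ^ (k - 1) * C) + (X * L ^ k * M - M * (X * L ^ k)) := by
    rw [mul_add, mul_neg, mul_smul_comm]
    noncomm_ring
  rw [this, Matrix.trace_add, trace_commutator, add_zero, Matrix.trace_sub, Matrix.trace_smul,
    smul_eq_mul]

/-! ### Poisson brackets of trace functions -/

/-- The Hamiltonian derivation `{·, g}` for partial derivatives `dx i`, `dp i`. -/
def hamDer (dx dp : n → Derivation ℂ A A) (g : A) : Derivation ℂ A A :=
  ∑ i, (dp i g • dx i - dx i g • dp i)

theorem hamDer_apply (dx dp : n → Derivation ℂ A A) (f g : A) :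
    hamDer dx dp g f = ∑ i, (dx i f * dp i g - dp i f * dx i g) := by
  have h : ∀ s : Finset n, (∑ i ∈ s, (dp i g • dx i - dx i g • dp i)) f =
      ∑ i ∈ s, (dx i f * dp i g - dp i f * dx i g) := by
    intro s
    induction s using Finset.induction_on with
    | empty => simp
    | insert a s ha ih =>
      rw [Finset.sum_insert ha, Finset.sum_insert ha, Derivation.add_apply, ih]
      simp [mul_comm]
  exact h _

/-- Partial derivatives with respect to canonical coordinates. -/
structure IsCanonical (dx dp : n → Derivation ℂ A A) (x p : n → A) : Prop where
  dx_x : ∀ i j, dx i (x j) = if i = j then 1 else 0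
  dx_p : ∀ i j, dx i (p j) = 0
  dp_x : ∀ i j, dp i (x j) = 0
  dp_p : ∀ i j, dp i (p j) = if i = j then 1 else 0

theorem trace_mul_single (Y : Matrix n n A) (i : n) :
    (Y * Matrix.single i i (1 : A)).trace = Y i i := by
  rw [Matrix.trace_mul_comm, Matrix.trace_single_mul, one_smul]

variable {dx dp : n → Derivation ℂ A A}

section Brackets

variable (h : IsCanonical dx dp x p) (hu : ∀ j k, j ≠ k → u j k * (x j - x k) = 1)
  (hc : ∀ D : Derivation ℂ A A, D c = 0)

include h hu hc

theorem hamDer_pos (g : A) (i : n) : hamDer dx dp g (x i) = dp i g := by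
  rw [hamDer_apply]
  simp [h.dx_x, h.dp_x]

theorem hamDer_mom (g : A) (i : n) : hamDer dx dp g (p i) = -dx i g := by
  rw [hamDer_apply]
  simp [h.dx_p, h.dp_p]

theorem map_dp_lax (i : n) : (laxOf p c u).map (dp i) = Matrix.single i i 1 := by
  ext j k
  simp only [Matrix.map_apply, laxOf, Matrix.of_apply, Matrix.single_apply]
  split_ifs with h1 h2 h2
  · rw [h.dp_p, if_pos h2.1]
  · rw [h.dp_p, if_neg (fun h3 => h2 ⟨h3, h3.trans h1⟩)]
  · exact absurd (h2.1.symm.trans h2.2) h1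
  · rw [Derivation.leibniz, hc, derivation_u hu _ h1, h.dp_x, h.dp_x]
    simp

theorem map_dx_lax (i : n) : (laxOf p c u).map (dx i) =
    laxDeriv c u * Matrix.single i i 1 - Matrix.single i i 1 * laxDeriv c u := by
  ext j k
  rw [Matrix.sub_apply, Matrix.map_apply]
  have h1 : (laxDeriv c u * Matrix.single i i 1 : Matrix n n A) j k =
      if i = k then laxDeriv c u j k else 0 := by
    rw [Matrix.mul_apply, Finset.sum_eq_single i]
    · simp only [Matrix.single_apply]
      split_ifs <;> simp_all
    · intro b _ hb; simp [hb.symm]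
    · simp
  have h2 : (Matrix.single i i 1 * laxDeriv c u : Matrix n n A) j k =
      if i = j then laxDeriv c u j k else 0 := by
    rw [Matrix.mul_apply, Finset.sum_eq_single i]
    · simp only [Matrix.single_apply]
      split_ifs <;> simp_all
    · intro b _ hb; simp [hb.symm]
    · simp
  rw [h1, h2]
  simp only [laxOf, laxDeriv, Matrix.of_apply]
  rcases eq_or_ne j k with rfl | hjk
  · simp [h.dx_p]
  · simp only [if_neg hjk]
    rw [Derivation.leibniz, hc, derivation_u hu _ hjk, h.dx_x, h.dx_x]
    split_ifs <;> simp

/-- The Hamiltonian flow of a function `g` of `X` and `L` with gradient `C` with respect to `X` and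
`B` with respect to `L` satisfies the Lax equations. The hypothesis `hBC` on the gradient holds for
functions that are invariant under conjugation. -/
theorem hamDer_lax (g : A) (B C : Matrix n n A)
    (hBC : B * laxOf p c u - laxOf p c u * B = diagonal x * C - C * diagonal x)
    (hg : ∀ D : Derivation ℂ A A,
      D g = (C * (diagonal x).map D).trace + (B * (laxOf p c u).map D).trace) :
    (laxOf p c u).map (hamDer dx dp g) =
        -C + (laxOf p c u * laxPartner u B - laxPartner u B * laxOf p c u) ∧
      (diagonal x).map (hamDer dx dp g) =
        B + (diagonal x * laxPartner u B - laxPartner u B * diagonal x) := by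
  refine lax_equations hu _ (hc _) B C hBC (fun i => ?_) (fun i => ?_)
  · rw [hamDer_pos h hu hc, hg, map_dp_lax h hu hc, trace_mul_single]
    have : (diagonal x).map (dp i) = 0 := by
      ext j k
      simp only [Matrix.map_apply, Matrix.diagonal_apply, Matrix.zero_apply]
      split_ifs <;> simp [h.dp_x]
    rw [this]
    simp
  · rw [hamDer_mom h hu hc, hg, map_dx_lax h hu hc]
    have : (diagonal x).map (dx i) = Matrix.single i i 1 := by
      ext j k
      simp only [Matrix.map_apply, Matrix.diagonal_apply, Matrix.single_apply]
      split_ifs with h1 h2 h2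
      · rw [h.dx_x, if_pos h2.1]
      · rw [h.dx_x, if_neg (fun h3 => h2 ⟨h3, h3.trans h1⟩)]
      · exact absurd (h2.1.symm.trans h2.2) h1
      · simp
    rw [this, trace_mul_single, mul_sub, Matrix.trace_sub, ← mul_assoc, trace_mul_single,
      ← mul_assoc B, Matrix.trace_mul_comm (B * _), ← mul_assoc, trace_mul_single,
      Matrix.sub_apply, Matrix.add_apply]
    ring

theorem hamDer_trace_pow_lax (k : ℕ) :
    ∃ M : Matrix n n A, (laxOf p c u).map (hamDer dx dp (laxOf p c u ^ k).trace) =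
        -0 + (laxOf p c u * M - M * laxOf p c u) ∧
      (diagonal x).map (hamDer dx dp (laxOf p c u ^ k).trace) =
        (k : A) • laxOf p c u ^ (k - 1) + (diagonal x * M - M * diagonal x) := by
  refine ⟨_, hamDer_lax h hu hc _ ((k : A) • laxOf p c u ^ (k - 1)) 0 ?_ fun D => ?_⟩
  · rw [smul_mul_assoc, mul_smul_comm, (Commute.pow_self _ _).eq]
    simp
  · rw [derivation_trace, ← one_mul ((laxOf p c u ^ k).map D), trace_mul_map_pow, zero_mul,
      Matrix.trace_zero, zero_add, momentDeriv]
    congr 2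
    rw [Nat.cast_smul_eq_nsmul]
    rw [← Finset.card_range k, ← Finset.sum_const, Finset.card_range]
    symm
    refine Finset.sum_congr rfl fun i hi => ?_
    have := Finset.mem_range.1 hi
    rw [mul_one, ← pow_add]
    congr 1
    omega

theorem hamDer_trace_moment_lax (k : ℕ) :
    ∃ M : Matrix n n A, (laxOf p c u).map (hamDer dx dp (diagonal x * laxOf p c u ^ k).trace) =
        -laxOf p c u ^ k + (laxOf p c u * M - M * laxOf p c u) ∧
      (diagonal x).map (hamDer dx dp (diagonal x * laxOf p c u ^ k).trace) =
        momentDeriv (laxOf p c u) (diagonal x) k + (diagonal x * M - M * diagonal x) := by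
  refine ⟨_, hamDer_lax h hu hc _ (momentDeriv (laxOf p c u) (diagonal x) k) (laxOf p c u ^ k)
    (momentDeriv_commutator _ _ _) fun D => ?_⟩
  rw [derivation_trace, map_derivation_mul, Matrix.trace_add, trace_mul_map_pow,
    Matrix.trace_mul_comm (laxOf p c u ^ k)]

theorem hamDer_trace_trace (m k : ℕ) :
    hamDer dx dp (laxOf p c u ^ k).trace (laxOf p c u ^ m).trace = 0 := by
  obtain ⟨M, hL, -⟩ := hamDer_trace_pow_lax h hu hc k
  rw [derivation_trace_pow_of_lax _ _ M 0 (Commute.zero_right _) hL]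
  simp

theorem hamDer_trace_moment (m k : ℕ) :
    hamDer dx dp (laxOf p c u ^ k).trace (diagonal x * laxOf p c u ^ m).trace =
      (k : A) * (laxOf p c u ^ (m + k - 1)).trace := by
  obtain ⟨M, hL, hX⟩ := hamDer_trace_pow_lax h hu hc k
  rw [derivation_trace_moment_of_lax _ _ _ M _ 0 (Commute.zero_right _) hL hX, smul_mul_assoc,
    Matrix.trace_smul, smul_eq_mul, ← pow_add, mul_zero, Matrix.trace_zero, mul_zero, sub_zero]
  rcases Nat.eq_zero_or_pos k with rfl | hk
  · simp
  · rw [show k - 1 + m = m + k - 1 by omega]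

theorem hamDer_moment_moment (m k : ℕ) :
    hamDer dx dp (diagonal x * laxOf p c u ^ k).trace (diagonal x * laxOf p c u ^ m).trace =
      ((k : A) - m) * (diagonal x * laxOf p c u ^ (m + k - 1)).trace := by
  obtain ⟨M, hL, hX⟩ := hamDer_trace_moment_lax h hu hc k
  rw [derivation_trace_moment_of_lax _ _ _ M _ _ (Commute.self_pow _ _) hL hX,
    trace_momentDeriv_mul_pow, sub_mul]
  congr 1
  rcases Nat.eq_zero_or_pos m with rfl | hk
  · simp
  · rw [mul_assoc, ← pow_add, show m - 1 + k = m + k - 1 by omega]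

end Brackets

end Derivations

/-! ### The Poisson algebra of analytic observables -/

section Analytic

set_option linter.unusedSectionVars false

variable {𝕜 : Type*} [RCLike 𝕜] [NormedAlgebra 𝕜 ℂ] {N : ℕ}

theorem isOpen_phaseSet : IsOpen (phaseSet 𝕜 N) := by
  have : phaseSet 𝕜 N = ⋂ i : Fin N, ⋂ j : Fin N, {z | i ≠ j → z.1 i ≠ z.1 j} := by
    ext z
    simp only [phaseSet, Set.mem_ofPred_eq, Set.mem_iInter]
    exact ⟨fun h i j hij => h.ne hij, fun h i j hij => by_contra fun hne => h i j hne hij⟩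
  rw [this]
  refine isOpen_iInter_of_finite fun i => isOpen_iInter_of_finite fun j => ?_
  by_cases hij : i = j
  · simp [hij]
  · simp only [ne_eq, hij, not_false_eq_true, forall_const]
    exact isOpen_ne_fun (by fun_prop) (by fun_prop)

theorem ext_apply (f : Observable 𝕜 N) (z : PhaseSpace 𝕜 N) : ext f z.1 = f z :=
  Subtype.val_injective.extend_apply _ _ _

theorem ext_eqOn {f : Observable 𝕜 N} {g : (Fin N → 𝕜) × (Fin N → 𝕜) → ℂ}
    (h : ∀ z : PhaseSpace 𝕜 N, f z = g z.1) : Set.EqOn g (ext f) (phaseSet 𝕜 N) :=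
  fun w hw => ((ext_apply f ⟨w, hw⟩).trans (h ⟨w, hw⟩)).symm

theorem isAnalytic_of_eq {f : Observable 𝕜 N} {g : (Fin N → 𝕜) × (Fin N → 𝕜) → ℂ}
    (hg : AnalyticOnNhd 𝕜 g (phaseSet 𝕜 N)) (h : ∀ z : PhaseSpace 𝕜 N, f z = g z.1) :
    IsAnalytic f :=
  hg.congr isOpen_phaseSet (ext_eqOn h)

theorem fderiv_ext_eq {f : Observable 𝕜 N} {g : (Fin N → 𝕜) × (Fin N → 𝕜) → ℂ}
    (h : ∀ z : PhaseSpace 𝕜 N, f z = g z.1) (z : PhaseSpace 𝕜 N) :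
    fderiv 𝕜 (ext f) z.1 = fderiv 𝕜 g z.1 :=
  Filter.EventuallyEq.fderiv_eq
    (Filter.eventuallyEq_of_mem (isOpen_phaseSet.mem_nhds z.2) (ext_eqOn h).symm)

theorem IsAnalytic.add {f g : Observable 𝕜 N} (hf : IsAnalytic f) (hg : IsAnalytic g) :
    IsAnalytic (f + g) :=
  isAnalytic_of_eq (AnalyticOnNhd.add hf hg) fun z => by simp [ext_apply]

theorem IsAnalytic.mul {f g : Observable 𝕜 N} (hf : IsAnalytic f) (hg : IsAnalytic g) :
    IsAnalytic (f * g) :=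
  isAnalytic_of_eq (AnalyticOnNhd.mul hf hg) fun z => by simp [ext_apply]

theorem isAnalytic_const (c : ℂ) : IsAnalytic (fun _ => c : Observable 𝕜 N) :=
  isAnalytic_of_eq (analyticOnNhd_const (v := c)) fun _ => rfl

variable (𝕜 N) in
/-- The algebra of analytic observables. -/
def analyticObservables : Subalgebra ℂ (Observable 𝕜 N) where
  carrier := {f | IsAnalytic f}
  mul_mem' := IsAnalytic.mul
  add_mem' := IsAnalytic.add
  algebraMap_mem' := isAnalytic_const

variable (𝕜 N) in
/-- The type of analytic observables. It is a definition rather than a coercion of the subalgebra,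
so that instance search stays away from the function space. -/
def AnalyticObservable : Type _ := ↥(analyticObservables 𝕜 N)

instance : CommRing (AnalyticObservable 𝕜 N) := inferInstanceAs (CommRing (analyticObservables 𝕜 N))

instance : Algebra ℂ (AnalyticObservable 𝕜 N) :=
  inferInstanceAs (Algebra ℂ (analyticObservables 𝕜 N))

/-- The observable underlying an analytic observable. -/
def toObs : AnalyticObservable 𝕜 N →ₐ[ℂ] Observable 𝕜 N := (analyticObservables 𝕜 N).val

/-- An analytic observable from an observable and a proof that it is analytic. -/
def AnalyticObservable.mk (f : Observable 𝕜 N) (hf : IsAnalytic f) : AnalyticObservable 𝕜 N :=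
  ⟨f, hf⟩

theorem toObs_mk (f : Observable 𝕜 N) (hf : IsAnalytic f) :
    toObs (AnalyticObservable.mk f hf) = f := rfl

theorem toObs_injective : Function.Injective (toObs : AnalyticObservable 𝕜 N → Observable 𝕜 N) :=
  Subtype.val_injective

theorem isAnalytic_toObs (f : AnalyticObservable 𝕜 N) : IsAnalytic (toObs f) := f.2

theorem IsAnalytic.differentiableAt {f : Observable 𝕜 N} (hf : IsAnalytic f)
    (z : PhaseSpace 𝕜 N) : DifferentiableAt 𝕜 (ext f) z.1 :=
  (hf z.1 z.2).differentiableAt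

/-- The derivative of an observable in a fixed direction. -/
def dirDeriv (v : (Fin N → 𝕜) × (Fin N → 𝕜)) (f : Observable 𝕜 N) : Observable 𝕜 N :=
  fun z => fderiv 𝕜 (ext f) z.1 v

variable (v : (Fin N → 𝕜) × (Fin N → 𝕜))

theorem IsAnalytic.dirDeriv {f : Observable 𝕜 N} (hf : IsAnalytic f) :
    IsAnalytic (dirDeriv v f) :=
  isAnalytic_of_eq (g := fun w => fderiv 𝕜 (ext f) w v)
    ((ContinuousLinearMap.apply 𝕜 ℂ v).comp_analyticOnNhd (AnalyticOnNhd.fderiv hf)) fun _ => rfl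

theorem dirDeriv_add {f g : Observable 𝕜 N} (hf : IsAnalytic f) (hg : IsAnalytic g) :
    dirDeriv v (f + g) = dirDeriv v f + dirDeriv v g := by
  funext z
  have h := fderiv_ext_eq (f := f + g) (g := ext f + ext g) (fun z => by simp [ext_apply]) z
  rw [dirDeriv, h, fderiv_add (hf.differentiableAt z) (hg.differentiableAt z)]
  rfl

theorem dirDeriv_mul {f g : Observable 𝕜 N} (hf : IsAnalytic f) (hg : IsAnalytic g) :
    dirDeriv v (f * g) = f * dirDeriv v g + g * dirDeriv v f := by
  funext z
  have h := fderiv_ext_eq (f := f * g) (g := ext f * ext g) (fun z => by simp [ext_apply]) z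
  rw [dirDeriv, h, fderiv_mul (hf.differentiableAt z) (hg.differentiableAt z)]
  simp [ext_apply, dirDeriv]

theorem dirDeriv_const (c : ℂ) : dirDeriv v (fun _ => c : Observable 𝕜 N) = 0 := by
  funext z
  rw [dirDeriv, fderiv_ext_eq (g := fun _ => c) (fun _ => rfl) z]
  simp

theorem dirDeriv_smul (c : ℂ) {f : Observable 𝕜 N} (hf : IsAnalytic f) :
    dirDeriv v (c • f) = c • dirDeriv v f := by
  have : c • f = (fun _ => c : Observable 𝕜 N) * f := rfl
  rw [this, dirDeriv_mul v (isAnalytic_const c) hf, dirDeriv_const, mul_zero, add_zero]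
  rfl

/-- Differentiation in a fixed direction, as a derivation of the algebra of analytic observables. -/
def dirDerivation : Derivation ℂ (AnalyticObservable 𝕜 N) (AnalyticObservable 𝕜 N) :=
  Derivation.mk'
    { toFun := fun f => .mk (dirDeriv v (toObs f)) (IsAnalytic.dirDeriv v (isAnalytic_toObs f))
      map_add' := fun f g =>
        toObs_injective (dirDeriv_add v (isAnalytic_toObs f) (isAnalytic_toObs g))
      map_smul' := fun c f => toObs_injective (dirDeriv_smul v c (isAnalytic_toObs f)) }
    fun f g => toObs_injective (dirDeriv_mul v (isAnalytic_toObs f) (isAnalytic_toObs g))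

variable (𝕜) in
/-- `∂/∂x_i` as a derivation. -/
def posDerivation (i : Fin N) :
    Derivation ℂ (AnalyticObservable 𝕜 N) (AnalyticObservable 𝕜 N) :=
  dirDerivation (Pi.single i 1, 0)

variable (𝕜) in
/-- `∂/∂p_i` as a derivation. -/
def momDerivation (i : Fin N) :
    Derivation ℂ (AnalyticObservable 𝕜 N) (AnalyticObservable 𝕜 N) :=
  dirDerivation (0, Pi.single i 1)

/-- The derivation `{·, g}`. -/
def bracketDerivation (g : AnalyticObservable 𝕜 N) :
    Derivation ℂ (AnalyticObservable 𝕜 N) (AnalyticObservable 𝕜 N) :=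
  hamDer (posDerivation 𝕜) (momDerivation 𝕜) g

theorem poissonBracket_toObs (f g : AnalyticObservable 𝕜 N) :
    poissonBracket (toObs f) (toObs g) = toObs (bracketDerivation g f) := by
  rw [bracketDerivation, hamDer_apply, map_sum]
  refine Finset.sum_congr rfl fun i _ => ?_
  rw [map_sub, map_mul, map_mul]
  rfl

theorem poissonBracket_antisymm (f g : Observable 𝕜 N) :
    poissonBracket f g = -poissonBracket g f := by
  rw [poissonBracket, poissonBracket, ← Finset.sum_neg_distrib]
  refine Finset.sum_congr rfl fun i _ => ?_
  ring

theorem poissonBracket_mul_left {f g k : Observable 𝕜 N} (hf : IsAnalytic f)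
    (hg : IsAnalytic g) (hk : IsAnalytic k) :
    poissonBracket (f * g) k = f * poissonBracket g k + g * poissonBracket f k := by
  have h := poissonBracket_toObs (.mk f hf * .mk g hg) (.mk k hk)
  rw [Derivation.leibniz, smul_eq_mul, smul_eq_mul, map_add, map_mul, map_mul, map_mul,
    ← poissonBracket_toObs, ← poissonBracket_toObs] at h
  simpa only [toObs_mk] using h

theorem poissonBracket_add_left {f g k : Observable 𝕜 N} (hf : IsAnalytic f)
    (hg : IsAnalytic g) (hk : IsAnalytic k) :
    poissonBracket (f + g) k = poissonBracket f k + poissonBracket g k := by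
  have h := poissonBracket_toObs (.mk f hf + .mk g hg) (.mk k hk)
  rw [map_add, map_add, map_add, ← poissonBracket_toObs, ← poissonBracket_toObs] at h
  simpa only [toObs_mk] using h

theorem poissonBracket_smul_left (c : ℂ) {f k : Observable 𝕜 N} (hf : IsAnalytic f)
    (hk : IsAnalytic k) :
    poissonBracket (c • f) k = c • poissonBracket f k := by
  have h := poissonBracket_toObs (c • .mk f hf) (.mk k hk)
  rw [Derivation.map_smul, map_smul, map_smul, ← poissonBracket_toObs] at h
  simpa only [toObs_mk] using h

theorem IsAnalytic.smul (c : ℂ) {f : Observable 𝕜 N} (hf : IsAnalytic f) : IsAnalytic (c • f) :=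
  (analyticObservables 𝕜 N).smul_mem hf c

theorem IsAnalytic.sub {f g : Observable 𝕜 N} (hf : IsAnalytic f) (hg : IsAnalytic g) :
    IsAnalytic (f - g) :=
  (analyticObservables 𝕜 N).sub_mem hf hg

theorem poissonBracket_sub_left {f g k : Observable 𝕜 N} (hf : IsAnalytic f)
    (hg : IsAnalytic g) (hk : IsAnalytic k) :
    poissonBracket (f - g) k = poissonBracket f k - poissonBracket g k := by
  have h : f - g = f + (-1 : ℂ) • g := by simp [sub_eq_add_neg]
  rw [h, poissonBracket_add_left hf (hg.smul _) hk, poissonBracket_smul_left _ hg hk]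
  simp [sub_eq_add_neg]

theorem poissonBracket_const_left (c : ℂ) {k : Observable 𝕜 N} (hk : IsAnalytic k) :
    poissonBracket (algebraMap ℂ (Observable 𝕜 N) c) k = 0 := by
  have h := poissonBracket_toObs (algebraMap ℂ _ c) (.mk k hk)
  rw [Derivation.map_algebraMap, map_zero, AlgHom.commutes] at h
  simpa only [toObs_mk] using h

end Analytic

/-! ### The Lax matrix over the algebra of analytic observables -/

section LaxObservables

variable {𝕜 : Type*} [RCLike 𝕜] [NormedAlgebra 𝕜 ℂ] {N : ℕ}

theorem pos_injective (z : PhaseSpace 𝕜 N) : Function.Injective (pos z) :=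
  (algebraMap 𝕜 ℂ).injective.comp z.2

theorem isAnalytic_linear (l : (Fin N → 𝕜) × (Fin N → 𝕜) →L[𝕜] 𝕜) :
    IsAnalytic (fun z => algebraMap 𝕜 ℂ (l z.1) : Observable 𝕜 N) :=
  isAnalytic_of_eq (g := ((algebraMapCLM 𝕜 ℂ).comp l))
    (ContinuousLinearMap.analyticOnNhd _ _) fun _ => rfl

theorem dirDeriv_linear (v : (Fin N → 𝕜) × (Fin N → 𝕜))
    (l : (Fin N → 𝕜) × (Fin N → 𝕜) →L[𝕜] 𝕜) (z : PhaseSpace 𝕜 N) :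
    dirDeriv v (fun z => algebraMap 𝕜 ℂ (l z.1) : Observable 𝕜 N) z = algebraMap 𝕜 ℂ (l v) := by
  have h := fderiv_ext_eq (f := fun z => algebraMap 𝕜 ℂ (l z.1))
    (g := ((algebraMapCLM 𝕜 ℂ).comp l)) (fun _ => rfl) z
  rw [dirDeriv, h, ContinuousLinearMap.fderiv]
  rfl

variable (𝕜) in
/-- The linear form `x_j`. -/
def posForm (j : Fin N) : (Fin N → 𝕜) × (Fin N → 𝕜) →L[𝕜] 𝕜 :=
  (ContinuousLinearMap.proj j).comp (ContinuousLinearMap.fst 𝕜 (Fin N → 𝕜) (Fin N → 𝕜))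

variable (𝕜) in
/-- The linear form `p_j`. -/
def momForm (j : Fin N) : (Fin N → 𝕜) × (Fin N → 𝕜) →L[𝕜] 𝕜 :=
  (ContinuousLinearMap.proj j).comp (ContinuousLinearMap.snd 𝕜 (Fin N → 𝕜) (Fin N → 𝕜))

variable (𝕜) in
/-- The coordinate function `x_j`. -/
def posObs (j : Fin N) : AnalyticObservable 𝕜 N :=
  .mk (fun z => pos z j) (isAnalytic_linear (posForm 𝕜 j))

variable (𝕜) in
/-- The coordinate function `p_j`. -/
def momObs (j : Fin N) : AnalyticObservable 𝕜 N :=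
  .mk (fun z => mom z j) (isAnalytic_linear (momForm 𝕜 j))

theorem isAnalytic_invDiff (j k : Fin N) :
    IsAnalytic (fun z => (pos z j - pos z k)⁻¹ : Observable 𝕜 N) := by
  by_cases hjk : j = k
  · subst hjk
    simpa using isAnalytic_const (𝕜 := 𝕜) (N := N) 0
  · have h := AnalyticOnNhd.inv (isAnalytic_toObs (posObs 𝕜 j - posObs 𝕜 k)) (fun w hw => by
      have h1 := ext_apply (toObs (posObs 𝕜 j - posObs 𝕜 k)) ⟨w, hw⟩
      rw [h1]
      exact sub_ne_zero.2 ((pos_injective ⟨w, hw⟩).ne hjk))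
    refine isAnalytic_of_eq h fun z => ?_
    rw [Pi.inv_apply, ext_apply]
    rfl

variable (𝕜) in
/-- The function `1 / (x_j - x_k)`, which is `0` for `j = k`. -/
def invDiffObs (j k : Fin N) : AnalyticObservable 𝕜 N :=
  .mk (fun z => (pos z j - pos z k)⁻¹) (isAnalytic_invDiff j k)

theorem isCanonical_coordinates :
    IsCanonical (posDerivation 𝕜 (N := N)) (momDerivation 𝕜) (posObs 𝕜) (momObs 𝕜) where
  dx_x i j := by
    refine toObs_injective (funext fun z => (dirDeriv_linear _ (posForm 𝕜 j) z).trans ?_)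
    by_cases h : i = j
    · subst h; simp [posForm]
    · simp [posForm, h, Ne.symm h]
  dx_p i j := by
    refine toObs_injective (funext fun z => (dirDeriv_linear _ (momForm 𝕜 j) z).trans ?_)
    simp [momForm]
  dp_x i j := by
    refine toObs_injective (funext fun z => (dirDeriv_linear _ (posForm 𝕜 j) z).trans ?_)
    simp [posForm]
  dp_p i j := by
    refine toObs_injective (funext fun z => (dirDeriv_linear _ (momForm 𝕜 j) z).trans ?_)
    by_cases h : i = j
    · subst h; simp [momForm]
    · simp [momForm, h, Ne.symm h]

theorem invDiffObs_mul (j k : Fin N) (h : j ≠ k) :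
    invDiffObs 𝕜 j k * (posObs 𝕜 j - posObs 𝕜 k) = 1 :=
  toObs_injective (funext fun z => inv_mul_cancel₀ (sub_ne_zero.2 ((pos_injective z).ne h)))

variable (𝕜 N) in
/-- The coupling constant `iν` as a constant observable. -/
def couplingObs (ν : ℝ) : AnalyticObservable 𝕜 N := algebraMap ℂ _ (Complex.I * ν)

variable (𝕜 N) in
/-- The Lax matrix with entries in the algebra of analytic observables. -/
def laxObs (ν : ℝ) : Matrix (Fin N) (Fin N) (AnalyticObservable 𝕜 N) :=
  laxOf (momObs 𝕜) (couplingObs 𝕜 N ν) (invDiffObs 𝕜)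

/-- Evaluation of analytic observables at a point. -/
def evalObs (z : PhaseSpace 𝕜 N) : AnalyticObservable 𝕜 N →+* ℂ :=
  (Pi.evalRingHom (fun _ : PhaseSpace 𝕜 N => ℂ) z).comp toObs.toRingHom

theorem map_laxObs (ν : ℝ) (z : PhaseSpace 𝕜 N) :
    (evalObs z).mapMatrix (laxObs 𝕜 N ν) = laxL ν z := by
  ext j k
  simp only [RingHom.mapMatrix_apply, Matrix.map_apply, laxObs, laxOf, Matrix.of_apply, laxL]
  split_ifs with h
  · rfl
  · rfl

theorem map_diagonal_posObs (z : PhaseSpace 𝕜 N) :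
    (evalObs z).mapMatrix (diagonal (posObs 𝕜)) = posX z := by
  rw [RingHom.mapMatrix_apply, Matrix.diagonal_map (map_zero _)]
  rfl

theorem trace_laxObs_pow (ν : ℝ) (k : ℕ) : toObs (laxObs 𝕜 N ν ^ k).trace = F ν k := by
  funext z
  have : evalObs z (laxObs 𝕜 N ν ^ k).trace = ((evalObs z).mapMatrix (laxObs 𝕜 N ν ^ k)).trace :=
    AddMonoidHom.map_trace (evalObs z) _
  rw [map_pow, map_laxObs] at this
  exact this

/-- The function `tr (X L^k)`. -/
def moment (ν : ℝ) (k : ℕ) : Observable 𝕜 N := fun z => (posX z * laxL ν z ^ k).trace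

theorem trace_posObs_mul_laxObs_pow (ν : ℝ) (k : ℕ) :
    toObs (diagonal (posObs 𝕜) * laxObs 𝕜 N ν ^ k).trace = moment ν k := by
  funext z
  have : evalObs z (diagonal (posObs 𝕜) * laxObs 𝕜 N ν ^ k).trace =
      ((evalObs z).mapMatrix (diagonal (posObs 𝕜) * laxObs 𝕜 N ν ^ k)).trace :=
    AddMonoidHom.map_trace (evalObs z) _
  rw [map_mul, map_pow, map_laxObs, map_diagonal_posObs] at this
  exact this

theorem isAnalytic_F (ν : ℝ) (k : ℕ) : IsAnalytic (F ν k : Observable 𝕜 N) := by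
  rw [← trace_laxObs_pow]
  exact isAnalytic_toObs _

theorem isAnalytic_moment (ν : ℝ) (k : ℕ) : IsAnalytic (moment ν k : Observable 𝕜 N) := by
  rw [← trace_posObs_mul_laxObs_pow]
  exact isAnalytic_toObs _

theorem derivation_coupling (ν : ℝ)
    (D : Derivation ℂ (AnalyticObservable 𝕜 N) (AnalyticObservable 𝕜 N)) :
    D (couplingObs 𝕜 N ν) = 0 := D.map_algebraMap _

theorem poissonBracket_F_F (ν : ℝ) (m k : ℕ) :
    poissonBracket (F ν m : Observable 𝕜 N) (F ν k) = 0 := by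
  have h : bracketDerivation (laxObs 𝕜 N ν ^ k).trace (laxObs 𝕜 N ν ^ m).trace = 0 :=
    hamDer_trace_trace isCanonical_coordinates invDiffObs_mul (derivation_coupling ν) m k
  rw [← trace_laxObs_pow, ← trace_laxObs_pow, poissonBracket_toObs, h, map_zero]

theorem poissonBracket_moment_F (ν : ℝ) (m k : ℕ) :
    poissonBracket (moment ν m : Observable 𝕜 N) (F ν k) = (k : ℂ) • F ν (m + k - 1) := by
  have h : bracketDerivation (laxObs 𝕜 N ν ^ k).trace
      (diagonal (posObs 𝕜) * laxObs 𝕜 N ν ^ m).trace =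
      (k : AnalyticObservable 𝕜 N) * (laxObs 𝕜 N ν ^ (m + k - 1)).trace :=
    hamDer_trace_moment isCanonical_coordinates invDiffObs_mul (derivation_coupling ν) m k
  rw [← trace_laxObs_pow, ← trace_laxObs_pow, ← trace_posObs_mul_laxObs_pow,
    poissonBracket_toObs, h, map_mul, map_natCast, Nat.cast_smul_eq_nsmul, nsmul_eq_mul]

theorem poissonBracket_moment_moment (ν : ℝ) (m k : ℕ) :
    poissonBracket (moment ν m : Observable 𝕜 N) (moment ν k) =
      ((k : ℂ) - m) • moment ν (m + k - 1) := by
  have h : bracketDerivation (diagonal (posObs 𝕜) * laxObs 𝕜 N ν ^ k).trace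
      (diagonal (posObs 𝕜) * laxObs 𝕜 N ν ^ m).trace =
      ((k : AnalyticObservable 𝕜 N) - (m : AnalyticObservable 𝕜 N)) *
        (diagonal (posObs 𝕜) * laxObs 𝕜 N ν ^ (m + k - 1)).trace :=
    hamDer_moment_moment isCanonical_coordinates invDiffObs_mul (derivation_coupling ν) m k
  rw [← trace_posObs_mul_laxObs_pow, ← trace_posObs_mul_laxObs_pow,
    ← trace_posObs_mul_laxObs_pow, poissonBracket_toObs, h, map_mul, map_sub, map_natCast,
    map_natCast, sub_smul, Nat.cast_smul_eq_nsmul, Nat.cast_smul_eq_nsmul, nsmul_eq_mul,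
    nsmul_eq_mul, sub_mul]

/-! ### The deformed integrals and their brackets -/

/-- The function `tr [X (1 + a L) L^{k-1}]`, which interpolates between the continuous (`a = 0`)
and the discrete (`a = -h/c₀`) models. -/
def Ja (ν : ℝ) (a : ℂ) (k : ℕ) : Observable 𝕜 N :=
  fun z => (posX z * (1 + a • laxL ν z) * laxL ν z ^ ((k : ℤ) - 1)).trace

/-- The function `Ja_m F_n - F_m Ja_n`: it is `K_{m,n}` for `a = 0` and `K̃_{m,n}` for `a = -h/c₀`.
-/
def Ka (ν : ℝ) (a : ℂ) (m n : ℕ) : Observable 𝕜 N := Ja ν a m * F ν n - F ν m * Ja ν a n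

/-- The family `F_k`, `1 ≤ k ≤ N`, and `Ka_{m,n}`, `1 ≤ n < m ≤ N`: the generators of the continuous
model for `a = 0` and of the discrete one for `a = -h/c₀`. -/
def genA (ν : ℝ) (a : ℂ) : GenIndex N → Observable 𝕜 N :=
  Sum.elim (fun k => F ν (k + 1)) (fun mn => Ka ν a (mn.1.1 + 1) (mn.1.2 + 1))

theorem J_eq_Ja (ν : ℝ) (k : ℕ) : (J ν k : Observable 𝕜 N) = Ja ν 0 k := by
  funext z; simp [J, Ja]

theorem Jt_eq_Ja (ν h : ℝ) (c₀ : ℂ) (k : ℕ) :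
    (Jt ν h c₀ k : Observable 𝕜 N) = Ja ν (-((h : ℂ) * c₀⁻¹)) k := by
  funext z; rw [Jt, Ja, neg_smul, sub_eq_add_neg]

theorem K_eq_Ka (ν : ℝ) (m n : ℕ) : (K ν m n : Observable 𝕜 N) = Ka ν 0 m n := by
  rw [K, Ka, J_eq_Ja, J_eq_Ja, mul_comm (Ja ν 0 n)]

theorem Kt_eq_Ka (ν h : ℝ) (c₀ : ℂ) (m n : ℕ) :
    (Kt ν h c₀ m n : Observable 𝕜 N) = Ka ν (-((h : ℂ) * c₀⁻¹)) m n := by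
  rw [Kt, Ka, Jt_eq_Ja, Jt_eq_Ja]

theorem gen_eq_genA (ν : ℝ) : (gen ν : GenIndex N → Observable 𝕜 N) = genA ν 0 := by
  simp only [gen, genA, K_eq_Ka]

theorem genDiscrete_eq_genA (ν h : ℝ) (c₀ : ℂ) :
    (genDiscrete ν h c₀ : GenIndex N → Observable 𝕜 N) = genA ν (-((h : ℂ) * c₀⁻¹)) := by
  simp only [genDiscrete, genA, Kt_eq_Ka]

variable (ν : ℝ) (a : ℂ)

theorem Ja_succ_apply (k : ℕ) (z : PhaseSpace 𝕜 N) :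
    Ja ν a (k + 1) z = (posX z * (1 + a • laxL ν z) * laxL ν z ^ k).trace := by
  rw [Ja, Nat.cast_succ, add_sub_cancel_right, zpow_natCast]

theorem Ja_succ (k : ℕ) :
    (Ja ν a (k + 1) : Observable 𝕜 N) = moment ν k + a • moment ν (k + 1) := by
  funext z
  rw [Ja_succ_apply, mul_add, mul_one, add_mul, Matrix.trace_add, mul_smul_comm, smul_mul_assoc,
    mul_assoc, ← pow_succ', Matrix.trace_smul]
  rfl

theorem F_zero : (F ν 0 : Observable 𝕜 N) = algebraMap ℂ (Observable 𝕜 N) N := by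
  funext z
  simp [F]

theorem isAnalytic_Ja (k : ℕ) (hk : 1 ≤ k) : IsAnalytic (Ja ν a k : Observable 𝕜 N) := by
  obtain ⟨k, rfl⟩ : ∃ l, k = l + 1 := ⟨k - 1, by omega⟩
  rw [Ja_succ]
  exact (isAnalytic_moment ν k).add ((isAnalytic_moment ν (k + 1)).smul a)

theorem isAnalytic_Ka (m n : ℕ) (hm : 1 ≤ m) (hn : 1 ≤ n) :
    IsAnalytic (Ka ν a m n : Observable 𝕜 N) :=
  ((isAnalytic_Ja ν a m hm).mul (isAnalytic_F ν n)).sub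
    ((isAnalytic_F ν m).mul (isAnalytic_Ja ν a n hn))

theorem poissonBracket_Ja_F (m k : ℕ) (hm : 1 ≤ m) :
    poissonBracket (Ja ν a m : Observable 𝕜 N) (F ν k) =
      (k : ℂ) • (F ν (m + k - 2) + a • F ν (m + k - 1)) := by
  obtain ⟨m, rfl⟩ : ∃ l, m = l + 1 := ⟨m - 1, by omega⟩
  have h0 := isAnalytic_moment (𝕜 := 𝕜) (N := N) ν
  rw [Ja_succ, poissonBracket_add_left (h0 m) ((h0 (m + 1)).smul a) (isAnalytic_F ν k),
    poissonBracket_smul_left a (h0 (m + 1)) (isAnalytic_F ν k), poissonBracket_moment_F,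
    poissonBracket_moment_F, smul_add, smul_comm a, show m + 1 + k - 2 = m + k - 1 by omega]

theorem poissonBracket_Ja_Ja (m k : ℕ) (hm : 1 ≤ m) (hk : 1 ≤ k) :
    poissonBracket (Ja ν a m : Observable 𝕜 N) (Ja ν a k) =
      ((k : ℂ) - m) • (Ja ν a (m + k - 2) + a • Ja ν a (m + k - 1)) := by
  obtain ⟨m, rfl⟩ : ∃ l, m = l + 1 := ⟨m - 1, by omega⟩
  obtain ⟨k, rfl⟩ : ∃ l, k = l + 1 := ⟨k - 1, by omega⟩
  have h0 := isAnalytic_moment (𝕜 := 𝕜) (N := N) ν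
  have hright : ∀ (l : ℕ), poissonBracket (moment ν l : Observable 𝕜 N) (Ja ν a (k + 1)) =
      ((k : ℂ) - l) • moment ν (l + k - 1) +
        a • (((k : ℂ) + 1 - l) • moment ν (l + (k + 1) - 1)) := by
    intro l
    rw [Ja_succ, poissonBracket_antisymm, poissonBracket_add_left (h0 k) ((h0 _).smul a) (h0 l),
      poissonBracket_smul_left a (h0 _) (h0 l), poissonBracket_moment_moment,
      poissonBracket_moment_moment, add_comm l, add_comm l]
    push_cast
    module
  have hJ := isAnalytic_Ja (𝕜 := 𝕜) (N := N) ν a (k + 1) (by omega)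
  rw [Ja_succ ν a m, poissonBracket_add_left (h0 m) ((h0 (m + 1)).smul a) hJ,
    poissonBracket_smul_left a (h0 (m + 1)) hJ, hright, hright,
    show m + 1 + (k + 1) - 1 = m + k + 1 by omega, Ja_succ,
    show m + 1 + (k + 1) - 2 = m + k by omega, show m + (k + 1) - 1 = m + k by omega,
    show m + 1 + k - 1 = m + k by omega]
  by_cases h : m + k = 0
  · obtain ⟨rfl, rfl⟩ : m = 0 ∧ k = 0 := by omega
    simp
  · obtain ⟨l, hl⟩ : ∃ l, m + k = l + 1 := ⟨m + k - 1, by omega⟩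
    rw [hl, Ja_succ, Nat.add_sub_cancel]
    push_cast
    module

theorem poissonBracket_F_Ka (i m n : ℕ) (hm : 1 ≤ m) (hn : 1 ≤ n) :
    poissonBracket (F ν i : Observable 𝕜 N) (Ka ν a m n) =
      (i : ℂ) • (F ν m * F ν (i + n - 2) - F ν n * F ν (i + m - 2))
        + ((i : ℂ) * a) • (F ν m * F ν (i + n - 1) - F ν n * F ν (i + m - 1)) := by
  have hF := isAnalytic_F (𝕜 := 𝕜) (N := N) ν
  have hJ := isAnalytic_Ja (𝕜 := 𝕜) (N := N) ν a
  rw [poissonBracket_antisymm, Ka, poissonBracket_sub_left ((hJ m hm).mul (hF n))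
    ((hF m).mul (hJ n hn)) (hF i), poissonBracket_mul_left (hJ m hm) (hF n) (hF i),
    poissonBracket_mul_left (hF m) (hJ n hn) (hF i), poissonBracket_F_F, poissonBracket_F_F,
    poissonBracket_Ja_F ν a _ _ hm, poissonBracket_Ja_F ν a _ _ hn, add_comm m i, add_comm n i]
  funext z
  simp only [Pi.neg_apply, Pi.sub_apply, Pi.add_apply, Pi.mul_apply, Pi.smul_apply, smul_eq_mul,
    Pi.zero_apply]
  ring

theorem poissonBracket_Ka_Ka (i j m n : ℕ) (hi : 1 ≤ i) (hj : 1 ≤ j) (hm : 1 ≤ m) (hn : 1 ≤ n) :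
    poissonBracket (Ka ν a i j : Observable 𝕜 N) (Ka ν a m n) =
        F ν i * ((m : ℂ) • Ka ν a n (j + m - 2) + (n : ℂ) • Ka ν a (j + n - 2) m)
        + F ν j * ((m : ℂ) • Ka ν a (i + m - 2) n + (n : ℂ) • Ka ν a m (i + n - 2))
        + F ν m * ((i : ℂ) • Ka ν a (i + n - 2) j + (j : ℂ) • Ka ν a i (j + n - 2))
        + F ν n * ((i : ℂ) • Ka ν a j (i + m - 2) + (j : ℂ) • Ka ν a (j + m - 2) i)
        + a •
          (F ν i * ((m : ℂ) • Ka ν a n (j + m - 1) + (n : ℂ) • Ka ν a (j + n - 1) m)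
          + F ν j * ((m : ℂ) • Ka ν a (i + m - 1) n + (n : ℂ) • Ka ν a m (i + n - 1))
          + F ν m * ((i : ℂ) • Ka ν a (i + n - 1) j + (j : ℂ) • Ka ν a i (j + n - 1))
          + F ν n * ((i : ℂ) • Ka ν a j (i + m - 1) + (j : ℂ) • Ka ν a (j + m - 1) i)) := by
  have hF := isAnalytic_F (𝕜 := 𝕜) (N := N) ν
  have hJ := isAnalytic_Ja (𝕜 := 𝕜) (N := N) ν a
  have hK := isAnalytic_Ka (𝕜 := 𝕜) (N := N) ν a m n hm hn
  -- the brackets `{Ja_l, Ka_{m,n}}`, by the Leibniz rule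
  have hJK : ∀ l, 1 ≤ l → poissonBracket (Ja ν a l : Observable 𝕜 N) (Ka ν a m n) =
      Ja ν a m * ((n : ℂ) • (F ν (l + n - 2) + a • F ν (l + n - 1)))
      + F ν n * (((m : ℂ) - l) • (Ja ν a (l + m - 2) + a • Ja ν a (l + m - 1)))
      - F ν m * (((n : ℂ) - l) • (Ja ν a (l + n - 2) + a • Ja ν a (l + n - 1)))
      - Ja ν a n * ((m : ℂ) • (F ν (l + m - 2) + a • F ν (l + m - 1))) := by
    intro l hl
    rw [poissonBracket_antisymm, Ka, poissonBracket_sub_left ((hJ m hm).mul (hF n))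
      ((hF m).mul (hJ n hn)) (hJ l hl), poissonBracket_mul_left (hJ m hm) (hF n) (hJ l hl),
      poissonBracket_mul_left (hF m) (hJ n hn) (hJ l hl),
      poissonBracket_antisymm (F ν n) (Ja ν a l), poissonBracket_antisymm (F ν m) (Ja ν a l),
      poissonBracket_antisymm (Ja ν a m) (Ja ν a l), poissonBracket_antisymm (Ja ν a n) (Ja ν a l),
      poissonBracket_Ja_F ν a _ _ hl, poissonBracket_Ja_F ν a _ _ hl,
      poissonBracket_Ja_Ja ν a _ _ hl hm, poissonBracket_Ja_Ja ν a _ _ hl hn]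
    ring
  rw [Ka.eq_def ν a i j, poissonBracket_sub_left ((hJ i hi).mul (hF j)) ((hF i).mul (hJ j hj)) hK,
    poissonBracket_mul_left (hJ i hi) (hF j) hK, poissonBracket_mul_left (hF i) (hJ j hj) hK,
    hJK i hi, hJK j hj, poissonBracket_F_Ka ν a _ _ _ hm hn, poissonBracket_F_Ka ν a _ _ _ hm hn]
  funext z
  simp only [Ka, Pi.sub_apply, Pi.add_apply, Pi.mul_apply, Pi.smul_apply, smul_eq_mul]
  ring

theorem F_mul_Ka_zero (i j : ℕ) :
    (F ν j * Ka ν a 0 i - F ν i * Ka ν a 0 j : Observable 𝕜 N) = (N : ℂ) • Ka ν a j i := by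
  funext z
  simp only [Ka, F_zero, Pi.sub_apply, Pi.mul_apply, Pi.smul_apply, smul_eq_mul,
    Pi.algebraMap_apply, Algebra.algebraMap_self, RingHom.id_apply]
  ring

theorem Ka_antisymm (m n : ℕ) : (Ka ν a m n : Observable 𝕜 N) = -Ka ν a n m := by
  rw [Ka, Ka]; ring

theorem bellF_eq_newtonCoeff (k : ℕ) (z : PhaseSpace 𝕜 N) :
    bellF ν k z = newtonCoeff (fun i => F ν i z) k :=
  completeBell_eq_newtonCoeff (fun i => F ν i z) k

theorem F_add (s : ℕ) : (F ν (N + s) : Observable 𝕜 N) =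
    -∑ k ∈ Finset.Icc 1 N, bellF ν k * F ν (N + s - k) := by
  funext z
  have h := congrArg Matrix.trace (pow_add_eq_newtonCoeff (laxL ν z) s)
  rw [Matrix.trace_neg, Matrix.trace_sum] at h
  refine h.trans ?_
  rw [Pi.neg_apply, Finset.sum_apply]
  congr 1
  refine Finset.sum_congr rfl fun k _ => ?_
  rw [Pi.mul_apply, bellF_eq_newtonCoeff, Matrix.trace_smul]
  rfl

theorem Ja_add (s : ℕ) (hs : 1 ≤ s) : (Ja ν a (N + s) : Observable 𝕜 N) =
    -∑ k ∈ Finset.Icc 1 N, bellF ν k * Ja ν a (N + s - k) := by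
  obtain ⟨s, rfl⟩ : ∃ l, s = l + 1 := ⟨s - 1, by omega⟩
  funext z
  have h := congrArg (fun Y => (posX z * (1 + a • laxL ν z) * Y).trace)
    (pow_add_eq_newtonCoeff (laxL ν z) s)
  simp only [mul_neg, Matrix.trace_neg, Finset.mul_sum, Matrix.trace_sum] at h
  rw [← add_assoc, Ja_succ_apply, h, Pi.neg_apply, Finset.sum_apply]
  congr 1
  refine Finset.sum_congr rfl fun k hk => ?_
  have := Finset.mem_Icc.1 hk
  rw [Pi.mul_apply, bellF_eq_newtonCoeff, mul_smul_comm, Matrix.trace_smul,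
    show N + s + 1 - k = (N + s - k) + 1 by omega, Ja_succ_apply]
  rfl

theorem Ka_add (s l : ℕ) (hs : 1 ≤ s) : (Ka ν a (N + s) l : Observable 𝕜 N) =
    -∑ k ∈ Finset.Icc 1 N, bellF ν k * Ka ν a (N + s - k) l := by
  rw [Ka, Ja_add ν a s hs, F_add ν s, neg_mul, neg_mul, Finset.sum_mul, Finset.sum_mul,
    ← neg_add', ← sub_eq_add_neg, ← Finset.sum_sub_distrib]
  congr 1
  refine Finset.sum_congr rfl fun k _ => ?_
  rw [Ka]
  ring

end LaxObservables

/-! ### Integrals of motion of the Nijhoff–Pang correspondence -/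

section Correspondence

/-- The matrix with entries `1 / (y_j - x_k)`. -/
def cauchyMatrix {N : ℕ} (y x : Fin N → ℂ) : Matrix (Fin N) (Fin N) ℂ :=
  Matrix.of fun j k => (y j - x k)⁻¹

open Polynomial in
theorem isUnit_det_cauchyMatrix {N : ℕ} {y x : Fin N → ℂ} (hx : Function.Injective x)
    (hy : Function.Injective y) (hxy : ∀ j k, y j - x k ≠ 0) : IsUnit (cauchyMatrix y x).det := by
  rw [isUnit_iff_ne_zero]
  intro hdet
  obtain ⟨v, hv0, hv⟩ := Matrix.exists_mulVec_eq_zero_iff.2 hdet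
  refine hv0 (funext fun k => ?_)
  -- clearing denominators in a kernel vector gives a polynomial of degree `< N` with the `N`
  -- roots `y_j`
  set q : ℂ[X] := ∑ k, C (v k) * ∏ l ∈ Finset.univ.erase k, (X - C (x l)) with hq
  have hroot : ∀ j, q.eval (y j) = 0 := by
    intro j
    have h1 := congrFun hv j
    simp only [Matrix.mulVec, dotProduct, cauchyMatrix, Matrix.of_apply, Pi.zero_apply] at h1
    have h2 : q.eval (y j) = (∏ l, (y j - x l)) * ∑ k, (y j - x k)⁻¹ * v k := by
      rw [hq, eval_finsetSum, Finset.mul_sum]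
      refine Finset.sum_congr rfl fun k _ => ?_
      rw [← Finset.mul_prod_erase _ _ (Finset.mem_univ k), eval_mul, eval_C, eval_prod]
      simp only [eval_sub, eval_X, eval_C]
      have := hxy j k
      field_simp
    rw [h2, h1, mul_zero]
  have hdeg : q.degree < N := by
    refine (degree_sum_le _ _).trans_lt ((Finset.sup_lt_iff (WithBot.bot_lt_coe N)).2 fun k _ => ?_)
    have h1 : (∏ l ∈ Finset.univ.erase k, (X - C (x l))).degree = ((N - 1 : ℕ) : WithBot ℕ) := by
      rw [degree_prod]
      simp [Finset.card_erase_of_mem]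
    refine (degree_mul_le _ _).trans_lt (lt_of_le_of_lt (add_le_add_left degree_C_le _) ?_)
    rw [h1, zero_add]
    exact Nat.cast_lt.2 (Nat.sub_lt k.pos one_pos)
  have hq0 : q = 0 := by
    refine eq_zero_of_degree_lt_of_eval_finset_eq_zero (Finset.univ.image y) ?_ ?_
    · rw [Finset.card_image_of_injective _ hy, Finset.card_univ, Fintype.card_fin]
      exact hdeg
    · intro w hw
      obtain ⟨j, -, rfl⟩ := Finset.mem_image.1 hw
      exact hroot j
  have h3 : q.eval (x k) = v k * ∏ l ∈ Finset.univ.erase k, (x k - x l) := by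
    rw [hq, eval_finsetSum, Finset.sum_eq_single k]
    · simp [eval_prod]
    · intro b _ hb
      rw [eval_mul, eval_prod, Finset.prod_eq_zero (Finset.mem_erase.2 ⟨hb.symm, Finset.mem_univ k⟩)
        (by simp), mul_zero]
    · simp
  rw [hq0, eval_zero] at h3
  have h4 : ∏ l ∈ Finset.univ.erase k, (x k - x l) ≠ 0 :=
    Finset.prod_ne_zero_iff.2 fun l hl => sub_ne_zero.2 (hx.ne (Finset.ne_of_mem_erase hl).symm)
  exact (mul_eq_zero.1 h3.symm).resolve_right h4

variable {𝕜 : Type*} [RCLike 𝕜] [NormedAlgebra 𝕜 ℂ] {N : ℕ}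

theorem laxL_eq_laxOf (ν : ℝ) (z : PhaseSpace 𝕜 N) :
    laxL ν z = laxOf (mom z) (Complex.I * ν) fun j k => (pos z j - pos z k)⁻¹ := rfl

theorem inv_pos_sub (z : PhaseSpace 𝕜 N) (j k : Fin N) (h : j ≠ k) :
    (pos z j - pos z k)⁻¹ * (pos z j - pos z k) = 1 :=
  inv_mul_cancel₀ (sub_ne_zero.2 ((pos_injective z).ne h))

variable {ν h : ℝ} {c₀ : ℂ} {z z' : PhaseSpace 𝕜 N}

/-- The second matrix of the discrete Lax pair, with entries `1 / (x̄_j - x_k + c₀)`. -/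
def stepMatrix (c₀ : ℂ) (z z' : PhaseSpace 𝕜 N) : Matrix (Fin N) (Fin N) ℂ :=
  cauchyMatrix (fun j => pos z' j + c₀) (pos z)

theorem stepMatrix_apply (c₀ : ℂ) (z z' : PhaseSpace 𝕜 N) (j k : Fin N) :
    stepMatrix c₀ z z' j k = 1 / (pos z' j - pos z k + c₀) := by
  rw [stepMatrix, cauchyMatrix, Matrix.of_apply, one_div, add_sub_right_comm]

theorem isUnit_det_stepMatrix (hs : NPStep h c₀ z z') : IsUnit (stepMatrix c₀ z z').det :=
  isUnit_det_cauchyMatrix (pos_injective z)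
    (fun j k hjk => pos_injective z' (add_right_cancel hjk))
    fun j k => by simpa only [add_sub_right_comm] using hs.1 j k

theorem stepMatrix_mul (hs : NPStep h c₀ z z') (j k : Fin N) :
    (pos z' j - pos z k + c₀) * stepMatrix c₀ z z' j k = 1 := by
  rw [stepMatrix_apply, mul_one_div, div_self (hs.1 j k)]

theorem c₀_ne_zero (hν : ν ≠ 0) (hh : h ≠ 0)
    (hc₀ : c₀ ^ 2 = -(Complex.I * (h : ℂ) * (ν : ℂ))) : c₀ ≠ 0 := by
  rintro rfl
  have h1 : Complex.I * (h : ℂ) * (ν : ℂ) ≠ 0 :=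
    mul_ne_zero (mul_ne_zero Complex.I_ne_zero (Complex.ofReal_ne_zero.2 hh))
      (Complex.ofReal_ne_zero.2 hν)
  apply h1
  linear_combination hc₀

theorem coupling_eq (hh : h ≠ 0) (hc₀ : c₀ ^ 2 = -(Complex.I * (h : ℂ) * (ν : ℂ))) :
    Complex.I * (ν : ℂ) = c₀ / h * -c₀ := by
  have : (h : ℂ) ≠ 0 := Complex.ofReal_ne_zero.2 hh
  field_simp
  linear_combination hc₀

/-- The entries of `M L`. The partial fraction expansion of `M_{jl} / (x_l - x_k)` and the equation
of the correspondence for `p_k` give an expression that does not involve the differences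
`x_l - x_k`; the same expression arises for `L̄ M`. -/
theorem stepMatrix_mul_laxL (hh : h ≠ 0) (hc₀ : c₀ ^ 2 = -(Complex.I * (h : ℂ) * (ν : ℂ)))
    (hs : NPStep h c₀ z z') (j k : Fin N) :
    (stepMatrix c₀ z z' * laxL ν z) j k = c₀ / h * stepMatrix c₀ z z' j k *
      (1 - c₀ * (∑ l, stepMatrix c₀ z z' j l - stepMatrix c₀ z z' j k
        + ∑ l, stepMatrix c₀ z z' l k)) := by
  set M := stepMatrix c₀ z z' with hM
  have hsum : ∑ l ∈ Finset.univ.erase k, M j l = ∑ l, M j l - M j k := by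
    rw [← Finset.add_sum_erase _ _ (Finset.mem_univ k)]; ring
  have hterm : ∀ l ∈ Finset.univ.erase k, M j l * laxL ν z l k =
      c₀ / h * -c₀ * (M j k * M j l + M j k * (1 / (pos z l - pos z k))) := by
    intro l hl
    have hlk := Finset.ne_of_mem_erase hl
    have h1 : pos z l - pos z k ≠ 0 := sub_ne_zero.2 ((pos_injective z).ne hlk)
    rw [laxL, Matrix.of_apply, if_neg hlk, coupling_eq hh hc₀]
    have h2 : M j l = M j k + M j k * M j l * (pos z l - pos z k) := by
      linear_combination (-M j l) * stepMatrix_mul hs j k + M j k * stepMatrix_mul hs j l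
    have h3 : M j l / (pos z l - pos z k) = M j k * M j l + M j k * (1 / (pos z l - pos z k)) := by
      rw [div_eq_iff h1, add_mul, mul_assoc (M j k) (1 / _), one_div_mul_cancel h1]
      linear_combination h2
    rw [← h3]
    ring
  rw [Matrix.mul_apply, ← Finset.add_sum_erase _ _ (Finset.mem_univ k), Finset.sum_congr rfl hterm,
    ← Finset.mul_sum, Finset.sum_add_distrib, ← Finset.mul_sum, ← Finset.mul_sum, hsum, laxL,
    Matrix.of_apply, if_pos rfl, hs.2.1 k]
  simp only [← stepMatrix_apply, ← hM]
  ring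

theorem laxL_mul_stepMatrix (hh : h ≠ 0) (hc₀ : c₀ ^ 2 = -(Complex.I * (h : ℂ) * (ν : ℂ)))
    (hs : NPStep h c₀ z z') (j k : Fin N) :
    (laxL ν z' * stepMatrix c₀ z z') j k = c₀ / h * stepMatrix c₀ z z' j k *
      (1 - c₀ * (∑ l, stepMatrix c₀ z z' j l - stepMatrix c₀ z z' j k
        + ∑ l, stepMatrix c₀ z z' l k)) := by
  set M := stepMatrix c₀ z z' with hM
  have hsum : ∑ l ∈ Finset.univ.erase j, M l k = ∑ l, M l k - M j k := by
    rw [← Finset.add_sum_erase _ _ (Finset.mem_univ j)]; ring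
  have hterm : ∀ l ∈ Finset.univ.erase j, laxL ν z' j l * M l k =
      c₀ / h * -c₀ * (M j k * M l k + M j k * (1 / (pos z' j - pos z' l))) := by
    intro l hl
    have hlj := Finset.ne_of_mem_erase hl
    have h1 : pos z' j - pos z' l ≠ 0 := sub_ne_zero.2 ((pos_injective z').ne hlj.symm)
    rw [laxL, Matrix.of_apply, if_neg hlj.symm, coupling_eq hh hc₀]
    have h2 : M l k = M j k + M j k * M l k * (pos z' j - pos z' l) := by
      linear_combination (-M l k) * stepMatrix_mul hs j k + M j k * stepMatrix_mul hs l k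
    have h3 : M l k / (pos z' j - pos z' l) =
        M j k * M l k + M j k * (1 / (pos z' j - pos z' l)) := by
      rw [div_eq_iff h1, add_mul, mul_assoc (M j k) (1 / _), one_div_mul_cancel h1]
      linear_combination h2
    rw [← h3]
    ring
  rw [Matrix.mul_apply, ← Finset.add_sum_erase _ _ (Finset.mem_univ j), Finset.sum_congr rfl hterm,
    ← Finset.mul_sum, Finset.sum_add_distrib, ← Finset.mul_sum, ← Finset.mul_sum, hsum, laxL,
    Matrix.of_apply, if_pos rfl, hs.2.2 j]
  simp only [← stepMatrix_apply, ← hM]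
  ring

/-- The discrete Lax equation `L̄ M = M L`. -/
theorem discrete_lax (hh : h ≠ 0) (hc₀ : c₀ ^ 2 = -(Complex.I * (h : ℂ) * (ν : ℂ)))
    (hs : NPStep h c₀ z z') :
    laxL ν z' * stepMatrix c₀ z z' = stepMatrix c₀ z z' * laxL ν z := by
  ext j k
  rw [laxL_mul_stepMatrix hh hc₀ hs, stepMatrix_mul_laxL hh hc₀ hs]

theorem laxL_pow_step (hh : h ≠ 0) (hc₀ : c₀ ^ 2 = -(Complex.I * (h : ℂ) * (ν : ℂ)))
    (hs : NPStep h c₀ z z') (k : ℕ) :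
    laxL ν z' ^ k * stepMatrix c₀ z z' = stepMatrix c₀ z z' * laxL ν z ^ k := by
  induction k with
  | zero => simp
  | succ k ih =>
    rw [pow_succ, mul_assoc, discrete_lax hh hc₀ hs, ← mul_assoc, ih, mul_assoc, pow_succ]

theorem F_step (hh : h ≠ 0) (hc₀ : c₀ ^ 2 = -(Complex.I * (h : ℂ) * (ν : ℂ)))
    (hs : NPStep h c₀ z z') (k : ℕ) : F ν k z' = F ν k z := by
  have h1 := laxL_pow_step hh hc₀ hs k
  have h2 := isUnit_det_stepMatrix hs
  rw [F, F, ← Matrix.mul_nonsing_inv_cancel_right _ (laxL ν z' ^ k) h2, h1, Matrix.trace_mul_comm,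
    Matrix.nonsing_inv_mul_cancel_left _ _ h2]

/-- Along the correspondence, the functions `J̃_k` move linearly, with velocity `h F_k`. -/
theorem Ja_step (hh : h ≠ 0) (hν : ν ≠ 0) (hc₀ : c₀ ^ 2 = -(Complex.I * (h : ℂ) * (ν : ℂ)))
    (hs : NPStep h c₀ z z') (k : ℕ) (hk : 1 ≤ k) :
    Ja ν (-((h : ℂ) * c₀⁻¹)) k z' = Ja ν (-((h : ℂ) * c₀⁻¹)) k z + h * F ν k z := by
  obtain ⟨k, rfl⟩ : ∃ l, k = l + 1 := ⟨k - 1, by omega⟩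
  have hhC : (h : ℂ) ≠ 0 := Complex.ofReal_ne_zero.2 hh
  have hc0 : c₀ ≠ 0 := c₀_ne_zero hν hh hc₀
  set a : ℂ := -((h : ℂ) * c₀⁻¹) with ha
  set M := stepMatrix c₀ z z' with hM
  have hMu : IsUnit M.det := isUnit_det_stepMatrix hs
  set E : Matrix (Fin N) (Fin N) ℂ := Matrix.of fun _ _ => 1 with hE
  set L := laxL ν z with hL
  set L' := laxL ν z' with hL'
  set T := 1 + a • L with hT
  have hTM : (1 + a • L') * M = M * T := by
    rw [add_mul, hT, mul_add, one_mul, mul_one, smul_mul_assoc, mul_smul_comm,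
      discrete_lax hh hc₀ hs]
  have hXM : posX z' * M = M * posX z - c₀ • M + E := by
    ext j k
    simp only [posX, Matrix.diagonal_mul, Matrix.mul_diagonal, Matrix.add_apply, Matrix.sub_apply,
      Matrix.smul_apply, smul_eq_mul, hE, Matrix.of_apply]
    linear_combination stepMatrix_mul hs j k
  -- column sums: this is the equation of the correspondence for `p_k`
  have hET : E * T = c₀ • (E * M) := by
    ext j k
    have h1 : (E * L) j k = c₀ / h * (1 - c₀ * ∑ l, M l k) := by
      have h2 : ∀ l ∈ Finset.univ.erase k, L l k = c₀ / h * -c₀ * (1 / (pos z l - pos z k)) := by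
        intro l hl
        rw [hL, laxL, Matrix.of_apply, if_neg (Finset.ne_of_mem_erase hl), coupling_eq hh hc₀,
          mul_one_div]
      simp only [hE, Matrix.mul_apply, Matrix.of_apply, one_mul]
      rw [← Finset.add_sum_erase _ _ (Finset.mem_univ k), Finset.sum_congr rfl h2,
        ← Finset.mul_sum, hL, laxL, Matrix.of_apply, if_pos rfl, hs.2.1 k]
      simp only [← stepMatrix_apply, ← hM]
      ring
    have h3 : (E * M) j k = ∑ l, M l k := by
      simp [hE, Matrix.mul_apply]
    rw [hT, mul_add, mul_one, mul_smul_comm, Matrix.add_apply, Matrix.smul_apply,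
      Matrix.smul_apply, h1, h3, ha]
    simp only [hE, Matrix.of_apply, smul_eq_mul]
    field_simp
    ring
  have htrE : (E * L' ^ k).trace = (L' ^ k).trace := by
    rw [hL', laxL_eq_laxOf, ← sum_lax_pow (inv_pos_sub z')
      (isUnit_iff_ne_zero.2 (mul_ne_zero Complex.I_ne_zero (Complex.ofReal_ne_zero.2 hν))) k]
    simp only [hE, Matrix.trace, Matrix.diag_apply, Matrix.mul_apply, Matrix.of_apply, one_mul]
    exact Finset.sum_comm
  have hpow : L' ^ k * M = M * L ^ k := laxL_pow_step hh hc₀ hs k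
  rw [Ja_succ_apply, Ja_succ_apply, ← hL, ← hL', ← hT]
  have hstep : posX z' * (1 + a • L') * L' ^ k =
      (M * posX z - c₀ • M + E) * T * L ^ k * M⁻¹ := by
    rw [← Matrix.mul_nonsing_inv_cancel_right _ (posX z' * (1 + a • L') * L' ^ k) hMu, ← hXM]
    congr 1
    simp only [mul_assoc]
    rw [hpow, ← mul_assoc (1 + a • L'), hTM]
    simp only [mul_assoc]
  have h5 : (M⁻¹ * (E * M * L ^ k)).trace = (L ^ k).trace := by
    rw [Matrix.trace_mul_comm, mul_assoc E, ← hpow, mul_assoc E,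
      Matrix.mul_nonsing_inv_cancel_right _ _ hMu, htrE]
    exact F_step hh hc₀ hs k
  have h6 : (T * L ^ k).trace = (L ^ k).trace + a * (L ^ (k + 1)).trace := by
    rw [hT, add_mul, one_mul, Matrix.trace_add, smul_mul_assoc, ← pow_succ', Matrix.trace_smul,
      smul_eq_mul]
  have h7 : M⁻¹ * ((M * posX z - c₀ • M + E) * T * L ^ k) =
      posX z * T * L ^ k - c₀ • (T * L ^ k) + c₀ • (M⁻¹ * (E * M * L ^ k)) := by
    have h8 : (M * posX z - c₀ • M + E) * T * L ^ k =
        M * (posX z * T * L ^ k) - M * (c₀ • (T * L ^ k)) + c₀ • (E * M * L ^ k) := by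
      rw [add_mul, hET, add_mul, sub_mul, sub_mul]
      simp only [mul_assoc, smul_mul_assoc, mul_smul_comm]
    rw [h8, mul_add, mul_sub, Matrix.nonsing_inv_mul_cancel_left _ _ hMu,
      Matrix.nonsing_inv_mul_cancel_left _ _ hMu, mul_smul_comm]
  rw [hstep, Matrix.trace_mul_comm, h7, Matrix.trace_add, Matrix.trace_sub, Matrix.trace_smul,
    Matrix.trace_smul, h5, h6, F, ← hL, ha]
  simp only [smul_eq_mul]
  field_simp
  ring

theorem Ka_step (hh : h ≠ 0) (hν : ν ≠ 0) (hc₀ : c₀ ^ 2 = -(Complex.I * (h : ℂ) * (ν : ℂ)))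
    (hs : NPStep h c₀ z z') (m n : ℕ) (hm : 1 ≤ m) (hn : 1 ≤ n) :
    Ka ν (-((h : ℂ) * c₀⁻¹)) m n z' = Ka ν (-((h : ℂ) * c₀⁻¹)) m n z := by
  simp only [Ka, Pi.sub_apply, Pi.mul_apply, Ja_step hh hν hc₀ hs m hm, Ja_step hh hν hc₀ hs n hn,
    F_step hh hc₀ hs]
  ring

end Correspondence

/-! ### Algebraic independence of the functions `F_k` and `J_k` -/

section PowerSums

/-- The sequence `N, v_1, …, v_N, 0, 0, …`, whose terms up to index `N` are taken as power sums of
`N` quantities. -/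
def powerSumSeq {R : Type*} [CommRing R] {N : ℕ} (v : Fin N → R) (k : ℕ) : R :=
  if k = 0 then (N : R) else if h : k - 1 < N then v ⟨k - 1, h⟩ else 0

theorem powerSumSeq_succ {R : Type*} [CommRing R] {N : ℕ} (v : Fin N → R) (k : Fin N) :
    powerSumSeq v (k + 1) = v k := by
  rw [powerSumSeq, if_neg (Nat.succ_ne_zero _), dif_pos (by simp)]
  rfl

theorem map_powerSumSeq {R S : Type*} [CommRing R] [CommRing S] (φ : R →+* S) {N : ℕ}
    (v : Fin N → R) (k : ℕ) : φ (powerSumSeq v k) = powerSumSeq (fun i => φ (v i)) k := by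
  rw [powerSumSeq, powerSumSeq]
  split_ifs <;> simp

theorem powerSumSeq_eq {R : Type*} [CommRing R] {N : ℕ} (f : ℕ → R) (h0 : f 0 = N) (k : ℕ)
    (hk : k ≤ N) : f k = powerSumSeq (fun i : Fin N => f (i + 1)) k := by
  rw [powerSumSeq]
  split_ifs with h1 h2
  · rw [h1, h0]
  · simp only [Nat.sub_add_cancel (Nat.pos_of_ne_zero h1)]
  · omega

theorem map_newtonExtend_powerSumSeq {R S : Type*} [CommRing R] [Algebra ℂ R] [CommRing S]
    [Algebra ℂ S] (φ : R →ₐ[ℂ] S) {N : ℕ} (v : Fin N → R) (k : ℕ) :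
    φ (newtonExtend N (powerSumSeq v) k) =
      newtonExtend N (powerSumSeq fun i => φ (v i)) k := by
  rw [map_newtonExtend]
  congr 1
  funext k
  exact map_powerSumSeq φ.toRingHom v k

/-- The `k`-th power sum of `N` quantities as a polynomial in the first `N` power sums. -/
def powerSumPoly (N k : ℕ) : MvPolynomial (Fin N) ℂ :=
  newtonExtend N (powerSumSeq MvPolynomial.X) k

theorem aeval_powerSumPoly {R : Type*} [CommRing R] [Algebra ℂ R] {N : ℕ} (v : Fin N → R)
    (k : ℕ) : MvPolynomial.aeval v (powerSumPoly N k) = newtonExtend N (powerSumSeq v) k := by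
  rw [powerSumPoly, map_newtonExtend_powerSumSeq]
  simp

theorem eval_powerSumPoly {N : ℕ} (r : Fin N → ℂ) (k : ℕ) :
    MvPolynomial.eval (fun k : Fin N => ∑ i, r i ^ ((k : ℕ) + 1)) (powerSumPoly N k) =
      ∑ i, r i ^ k := by
  rw [← MvPolynomial.aeval_eq_eval, aeval_powerSumPoly, ← powerSum_eq_newtonExtend]
  exact powerSumSeq_eq (fun k => ∑ i, r i ^ k) (by simp)

/-- The determinant of the matrix `(F_{m+n} + a F_{m+n+1})_{0 ≤ m, n < N}`, as a polynomial in the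
`F_k`. Where it does not vanish, the eigenvalues are distinct and different from `-1/a`. -/
def hankelPoly (N : ℕ) (a : ℂ) : MvPolynomial (Fin N) ℂ :=
  (Matrix.of fun m n : Fin N => powerSumPoly N (m + n) +
    MvPolynomial.C a * powerSumPoly N (m + n + 1)).det

theorem eval_hankelPoly {N : ℕ} (a : ℂ) (r : Fin N → ℂ) :
    MvPolynomial.eval (fun k : Fin N => ∑ i, r i ^ ((k : ℕ) + 1)) (hankelPoly N a) =
      ((vandermonde r)ᵀ * diagonal (fun i => 1 + a * r i) * vandermonde r).det := by
  rw [hankelPoly, RingHom.map_det]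
  congr 1
  ext m n
  simp only [RingHom.mapMatrix_apply, Matrix.map_apply, Matrix.of_apply, map_add, map_mul,
    eval_powerSumPoly, MvPolynomial.eval_C]
  rw [Matrix.mul_apply, Finset.mul_sum, ← Finset.sum_add_distrib]
  refine Finset.sum_congr rfl fun i _ => ?_
  rw [Matrix.mul_diagonal, Matrix.transpose_apply, vandermonde_apply, vandermonde_apply]
  ring

theorem exists_injective_ne (N : ℕ) (a : ℂ) :
    ∃ r : Fin N → ℂ, Function.Injective r ∧ ∀ i, 1 + a * r i ≠ 0 := by
  obtain ⟨b, hb, hb1⟩ : ∃ b : ℂ, b ≠ 0 ∧ ∀ j : ℕ, 1 + a * (b * ((j : ℂ) + 1)) ≠ 0 := by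
    by_cases ha : a = 0
    · exact ⟨1, one_ne_zero, fun j => by simp [ha]⟩
    · refine ⟨a⁻¹, inv_ne_zero ha, fun j => ?_⟩
      rw [← mul_assoc, mul_inv_cancel₀ ha, one_mul]
      have : (1 + ((j : ℂ) + 1)) = ((j + 2 : ℕ) : ℂ) := by push_cast; ring
      rw [this]
      exact Nat.cast_ne_zero.2 (by omega)
  refine ⟨fun j => b * (((j : ℕ) : ℂ) + 1), fun i j hij => ?_, fun i => hb1 i⟩
  have h2 := add_right_cancel (mul_left_cancel₀ hb hij)
  exact Fin.ext (Nat.cast_injective h2)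

theorem hankelPoly_ne_zero (N : ℕ) (a : ℂ) : hankelPoly N a ≠ 0 := by
  intro h0
  obtain ⟨r, hr, hr1⟩ := exists_injective_ne N a
  have h := eval_hankelPoly a r
  rw [h0, map_zero, det_mul, det_mul, det_transpose, det_diagonal] at h
  have hV : (vandermonde r).det ≠ 0 := det_vandermonde_ne_zero_iff.2 hr
  exact mul_ne_zero (mul_ne_zero hV (Finset.prod_ne_zero_iff.2 fun i _ => hr1 i)) hV h.symm

/-- The functions `∑ p_j^k` and `∑ y_j (1 + a p_j) p_j^{k-1}`, `1 ≤ k ≤ N`, on `ℂ^N × ℂ^N`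
are algebraically independent: where `hankelPoly` does not vanish, they take arbitrary values. -/
theorem free_independent {N : ℕ} (a : ℂ) (T : MvPolynomial (Fin N ⊕ Fin N) ℂ)
    (h : ∀ p y : Fin N → ℂ, MvPolynomial.eval (Sum.elim
      (fun k : Fin N => ∑ i, p i ^ ((k : ℕ) + 1))
      (fun k : Fin N => ∑ i, y i * (1 + a * p i) * p i ^ (k : ℕ))) T = 0) : T = 0 := by
  have hH : MvPolynomial.rename Sum.inl (hankelPoly N a) ≠
      (0 : MvPolynomial (Fin N ⊕ Fin N) ℂ) := by
    rw [Ne, map_eq_zero_iff _ (MvPolynomial.rename_injective _ Sum.inl_injective)]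
    exact hankelPoly_ne_zero N a
  refine (mul_eq_zero.1
    (?_ : T * MvPolynomial.rename Sum.inl (hankelPoly N a) = 0)).resolve_right hH
  refine MvPolynomial.funext fun v => ?_
  obtain ⟨r, hr⟩ := exists_powerSum_eq N (powerSumSeq fun k => v (Sum.inl k))
  have hv : (fun k => v (Sum.inl k)) = fun k : Fin N => ∑ i, r i ^ ((k : ℕ) + 1) := by
    funext k
    rw [hr _ (by omega) (by omega), powerSumSeq_succ]
  rw [map_mul, map_zero, MvPolynomial.eval_rename]
  have hcomp : v ∘ Sum.inl = fun k : Fin N => ∑ i, r i ^ ((k : ℕ) + 1) := hv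
  rw [hcomp, eval_hankelPoly]
  set W := (vandermonde r)ᵀ * diagonal (fun i => 1 + a * r i) with hW
  by_cases hdet : W.det = 0
  · rw [det_mul, hdet, zero_mul, mul_zero]
  · have hWu : IsUnit W.det := isUnit_iff_ne_zero.2 hdet
    have hy := h r (W⁻¹ *ᵥ fun k => v (Sum.inr k))
    have hv2 : v = Sum.elim (fun k : Fin N => ∑ i, r i ^ ((k : ℕ) + 1))
        (fun k : Fin N =>
          ∑ i, (W⁻¹ *ᵥ fun k => v (Sum.inr k)) i * (1 + a * r i) * r i ^ (k : ℕ)) := by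
      funext s
      rcases s with k | k
      · exact congrFun hv k
      · have h1 : W *ᵥ (W⁻¹ *ᵥ fun k => v (Sum.inr k)) = fun k => v (Sum.inr k) := by
          rw [Matrix.mulVec_mulVec, Matrix.mul_nonsing_inv _ hWu, Matrix.one_mulVec]
        have h2 := congrFun h1 k
        rw [← h2, Sum.elim_inr]
        simp only [Matrix.mulVec, dotProduct]
        refine Finset.sum_congr rfl fun i _ => ?_
        rw [hW, Matrix.mul_diagonal, Matrix.transpose_apply, vandermonde_apply]
        ring
    rw [← hv2] at hy
    rw [hy, zero_mul]

/-- The algebraic independence of `free_independent` is detected on points with coordinates in `𝕜`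
and distinct `y_j`, which are Zariski dense. -/
theorem free_independent_of_field {𝕜 : Type*} [RCLike 𝕜] [NormedAlgebra 𝕜 ℂ] {N : ℕ} (a : ℂ)
    (T : MvPolynomial (Fin N ⊕ Fin N) ℂ)
    (h : ∀ p y : Fin N → 𝕜, Function.Injective y → MvPolynomial.eval (Sum.elim
      (fun k : Fin N => ∑ i, algebraMap 𝕜 ℂ (p i) ^ ((k : ℕ) + 1))
      (fun k : Fin N => ∑ i, algebraMap 𝕜 ℂ (y i) * (1 + a * algebraMap 𝕜 ℂ (p i)) *
        algebraMap 𝕜 ℂ (p i) ^ (k : ℕ))) T = 0) : T = 0 := by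
  set G : Fin N ⊕ Fin N → MvPolynomial (Fin N ⊕ Fin N) ℂ := Sum.elim
    (fun k : Fin N => ∑ i, MvPolynomial.X (Sum.inl i) ^ ((k : ℕ) + 1))
    (fun k : Fin N => ∑ i, MvPolynomial.X (Sum.inr i) *
      (1 + MvPolynomial.C a * MvPolynomial.X (Sum.inl i)) *
        MvPolynomial.X (Sum.inl i) ^ (k : ℕ)) with hG
  set V : MvPolynomial (Fin N ⊕ Fin N) ℂ := ∏ i : Fin N, ∏ j ∈ Finset.univ.erase i,
    (MvPolynomial.X (Sum.inr i) - MvPolynomial.X (Sum.inr j)) with hV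
  have heval : ∀ v : Fin N ⊕ Fin N → ℂ, MvPolynomial.eval v (MvPolynomial.bind₁ G T) =
      MvPolynomial.eval (Sum.elim (fun k : Fin N => ∑ i, v (Sum.inl i) ^ ((k : ℕ) + 1))
      (fun k : Fin N => ∑ i, v (Sum.inr i) * (1 + a * v (Sum.inl i)) *
        v (Sum.inl i) ^ (k : ℕ))) T := by
    intro v
    rw [← MvPolynomial.aeval_eq_eval, ← MvPolynomial.aeval_eq_eval, MvPolynomial.aeval_bind₁]
    congr 2
    funext s
    rcases s with k | k <;> simp [hG]
  have hV0 : V ≠ 0 := by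
    refine Finset.prod_ne_zero_iff.2 fun i _ => Finset.prod_ne_zero_iff.2 fun j hj => ?_
    refine sub_ne_zero.2 fun h => Finset.ne_of_mem_erase hj ?_
    exact (Sum.inr_injective (MvPolynomial.X_injective h)).symm
  have hprod : MvPolynomial.bind₁ G T * V = 0 := by
    refine MvPolynomial.funext_set (fun _ => Set.range (algebraMap 𝕜 ℂ))
      (fun _ => Set.infinite_range_of_injective (algebraMap 𝕜 ℂ).injective) fun v hv => ?_
    choose w hw using fun i => hv i (Set.mem_univ i)
    rw [map_mul, map_zero, heval]
    by_cases hinj : Function.Injective fun i => w (Sum.inr i)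
    · have h1 := h (fun i => w (Sum.inl i)) (fun i => w (Sum.inr i)) hinj
      simp only [hw] at h1
      rw [h1, zero_mul]
    · have : ∃ i j, w (Sum.inr i) = w (Sum.inr j) ∧ i ≠ j := by
        simpa [Function.Injective] using hinj
      obtain ⟨i, j, hij, hne⟩ := this
      have h2 : MvPolynomial.eval v V = 0 := by
        rw [hV, map_prod]
        refine Finset.prod_eq_zero (Finset.mem_univ i) ?_
        rw [map_prod]
        refine Finset.prod_eq_zero (Finset.mem_erase.2 ⟨hne.symm, Finset.mem_univ j⟩) ?_
        rw [map_sub, MvPolynomial.eval_X, MvPolynomial.eval_X, ← hw, ← hw, hij, sub_self]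
      rw [h2, mul_zero]
  have hbind : MvPolynomial.bind₁ G T = 0 := (mul_eq_zero.1 hprod).resolve_right hV0
  refine free_independent a T fun p y => ?_
  have := heval (Sum.elim p y)
  rw [hbind, map_zero] at this
  exact this.symm

end PowerSums

section Independence

variable {𝕜 : Type*} [RCLike 𝕜] [NormedAlgebra 𝕜 ℂ] {N : ℕ}

/-- The Lax matrix at momenta `p` and positions `y / ε`. It is polynomial in `ε`, so that it also
makes sense, and is diagonal, at `ε = 0`. -/
def scaledLax (ν : ℝ) (p y : Fin N → 𝕜) (ε : ℂ) : Matrix (Fin N) (Fin N) ℂ :=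
  Matrix.of fun j k => if j = k then algebraMap 𝕜 ℂ (p j)
    else ε * (Complex.I * (ν : ℂ) / (algebraMap 𝕜 ℂ (y j) - algebraMap 𝕜 ℂ (y k)))

theorem continuous_scaledLax (ν : ℝ) (p y : Fin N → 𝕜) : Continuous (scaledLax ν p y) := by
  refine continuous_matrix fun j k => ?_
  simp only [scaledLax, Matrix.of_apply]
  split_ifs
  · exact continuous_const
  · fun_prop

theorem scaledLax_zero (ν : ℝ) (p y : Fin N → 𝕜) :
    scaledLax ν p y 0 = diagonal fun j => algebraMap 𝕜 ℂ (p j) := by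
  ext j k
  simp [scaledLax, Matrix.diagonal_apply]

/-- The point with positions `y / e` and momenta `p`. -/
def scaledPoint (p y : Fin N → 𝕜) (hy : Function.Injective y) (e : 𝕜) (he : e ≠ 0) :
    PhaseSpace 𝕜 N :=
  ⟨(fun j => e⁻¹ * y j, p), fun _ _ h => hy (mul_left_cancel₀ (inv_ne_zero he) h)⟩

theorem laxL_scaledPoint (ν : ℝ) (p y : Fin N → 𝕜) (hy : Function.Injective y) (e : 𝕜)
    (he : e ≠ 0) :
    laxL ν (scaledPoint p y hy e he) = scaledLax ν p y (algebraMap 𝕜 ℂ e) := by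
  have he' : algebraMap 𝕜 ℂ e ≠ 0 := (map_ne_zero _).2 he
  ext j k
  simp only [laxL, scaledLax, Matrix.of_apply]
  split_ifs with h
  · rfl
  · have h1 : algebraMap 𝕜 ℂ (y j) - algebraMap 𝕜 ℂ (y k) ≠ 0 :=
      sub_ne_zero.2 fun h2 => h (hy ((algebraMap 𝕜 ℂ).injective h2))
    have h2 : pos (scaledPoint p y hy e he) j - pos (scaledPoint p y hy e he) k =
        (algebraMap 𝕜 ℂ e)⁻¹ * (algebraMap 𝕜 ℂ (y j) - algebraMap 𝕜 ℂ (y k)) := by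
      simp only [pos, scaledPoint, map_mul, map_inv₀]
      ring
    rw [h2]
    field_simp

theorem posX_scaledPoint (p y : Fin N → 𝕜) (hy : Function.Injective y) (e : 𝕜)
    (he : e ≠ 0) :
    posX (scaledPoint p y hy e he) =
      (algebraMap 𝕜 ℂ e)⁻¹ • diagonal fun j => algebraMap 𝕜 ℂ (y j) := by
  ext j k
  simp only [posX, Matrix.diagonal_apply, Matrix.smul_apply, smul_eq_mul]
  split_ifs
  · simp [pos, scaledPoint]
  · simp

/-- The degree of a monomial in the second group of variables. -/
def degInr (m : Fin N ⊕ Fin N →₀ ℕ) : ℕ := ∑ k : Fin N, m (Sum.inr k)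

/-- The functions `F_1, …, F_N, Ja_1, …, Ja_N` on phase space are algebraically independent: for
large positions they degenerate to the sums over free particles of `free_independent`. -/
theorem independent (ν : ℝ) (a : ℂ) (S : MvPolynomial (Fin N ⊕ Fin N) ℂ)
    (h : ∀ z : PhaseSpace 𝕜 N, MvPolynomial.eval (Sum.elim
      (fun k : Fin N => F ν (k + 1) z) (fun k : Fin N => Ja ν a (k + 1) z)) S = 0) : S = 0 := by
  by_contra hS
  set D := S.support.sup degInr with hD
  -- the part of `S` of top degree in the `J_k`
  set T : MvPolynomial (Fin N ⊕ Fin N) ℂ :=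
    ∑ m ∈ S.support with degInr m = D, MvPolynomial.monomial m (S.coeff m) with hT
  have hTcoeff : ∀ m, T.coeff m = if m ∈ S.support ∧ degInr m = D then S.coeff m else 0 := by
    intro m
    rw [hT, MvPolynomial.coeff_sum]
    simp only [MvPolynomial.coeff_monomial, Finset.sum_ite_eq', Finset.mem_filter]
  obtain ⟨m₀, hm₀, hm₀D⟩ := Finset.exists_mem_eq_sup S.support
    (MvPolynomial.support_nonempty.2 hS) degInr
  refine MvPolynomial.mem_support_iff.1 hm₀ ?_
  have hT0 : T = 0 := by
    refine free_independent_of_field (𝕜 := 𝕜) a T fun p y hy => ?_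
    set Y : Matrix (Fin N) (Fin N) ℂ := diagonal fun j => algebraMap 𝕜 ℂ (y j) with hY
    set f : ℂ → Fin N → ℂ := fun ε k => (scaledLax ν p y ε ^ ((k : ℕ) + 1)).trace with hf
    set g : ℂ → Fin N → ℂ := fun ε k =>
      (Y * (1 + a • scaledLax ν p y ε) * scaledLax ν p y ε ^ (k : ℕ)).trace with hg
    have hLc := continuous_scaledLax ν p y
    have hfc : ∀ k, Continuous fun ε => f ε k := fun k => (hLc.pow _).matrix_trace
    have hgc : ∀ k, Continuous fun ε => g ε k := fun k =>
      ((continuous_const.mul (continuous_const.add (hLc.const_smul a))).mul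
        (hLc.pow _)).matrix_trace
    -- `φ ε` is `ε ^ D` times the value of `S` at positions `y / ε`, and `φ 0` is the value of `T`
    -- at the free particles
    set φ : ℂ → ℂ := fun ε => ∑ m ∈ S.support, S.coeff m * ε ^ (D - degInr m) *
      ((∏ k, f ε k ^ m (Sum.inl k)) * ∏ k, g ε k ^ m (Sum.inr k)) with hφ
    have hφc : Continuous φ := by
      refine continuous_finsetSum _ fun m _ => ?_
      refine (continuous_const.mul (continuous_id.pow _)).mul ?_
      exact (continuous_finsetProd _ fun k _ => (hfc k).pow _).mul
        (continuous_finsetProd _ fun k _ => (hgc k).pow _)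
    have hφ0 : ∀ e : 𝕜, e ≠ 0 → φ (algebraMap 𝕜 ℂ e) = 0 := by
      intro e he
      set ε := algebraMap 𝕜 ℂ e with hε
      have hε0 : ε ≠ 0 := (map_ne_zero _).2 he
      have h1 := h (scaledPoint p y hy e he)
      have hF : ∀ k : Fin N, F ν (k + 1) (scaledPoint p y hy e he) = f ε k := fun k => by
        rw [F, laxL_scaledPoint]
      have hJ : ∀ k : Fin N, Ja ν a (k + 1) (scaledPoint p y hy e he) = ε⁻¹ * g ε k := fun k => by
        rw [Ja_succ_apply, laxL_scaledPoint, posX_scaledPoint, smul_mul_assoc, smul_mul_assoc,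
          Matrix.trace_smul, smul_eq_mul]
      rw [MvPolynomial.eval_eq'] at h1
      simp only [Fintype.prod_sum_type, Sum.elim_inl, Sum.elim_inr, hF, hJ] at h1
      have h2 : φ ε = ε ^ D * ∑ m ∈ S.support, S.coeff m *
          ((∏ k, f ε k ^ m (Sum.inl k)) * ∏ k, (ε⁻¹ * g ε k) ^ m (Sum.inr k)) := by
        rw [Finset.mul_sum]
        refine Finset.sum_congr rfl fun m hm => ?_
        have h3 : degInr m ≤ D := Finset.le_sup hm
        simp only [mul_pow, Finset.prod_mul_distrib, Finset.prod_pow_eq_pow_sum]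
        change _ = ε ^ D * (_ * (_ * (ε⁻¹ ^ degInr m * _)))
        rw [← Nat.sub_add_cancel h3, pow_add, Nat.add_sub_cancel, inv_pow]
        field_simp
      rw [h2, h1, mul_zero]
    have hφz : φ 0 = 0 := by
      have hcomp : Continuous fun e : 𝕜 => φ (algebraMap 𝕜 ℂ e) :=
        hφc.comp (algebraMapCLM 𝕜 ℂ).continuous
      have h1 : (fun e : 𝕜 => φ (algebraMap 𝕜 ℂ e)) = fun _ => 0 :=
        hcomp.ext_on (dense_compl_singleton 0) continuous_const fun e he => hφ0 e he
      simpa using congrFun h1 0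
    have hf0 : ∀ k : Fin N, f 0 k = ∑ i, algebraMap 𝕜 ℂ (p i) ^ ((k : ℕ) + 1) := by
      intro k
      simp [hf, scaledLax_zero, Matrix.diagonal_pow, Matrix.trace_diagonal]
    have hg0 : ∀ k : Fin N, g 0 k = ∑ i, algebraMap 𝕜 ℂ (y i) * (1 + a * algebraMap 𝕜 ℂ (p i)) *
        algebraMap 𝕜 ℂ (p i) ^ (k : ℕ) := by
      intro k
      have h1 : (1 : Matrix (Fin N) (Fin N) ℂ) + a • (diagonal fun j => algebraMap 𝕜 ℂ (p j)) =
          diagonal fun j => 1 + a * algebraMap 𝕜 ℂ (p j) := by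
        rw [← diagonal_one, ← diagonal_smul, diagonal_add]
        rfl
      simp only [hg, scaledLax_zero, hY, h1, Matrix.diagonal_pow, diagonal_mul_diagonal,
        Matrix.trace_diagonal, Pi.pow_apply]
    rw [← hφz, hT, map_sum, Finset.sum_filter]
    refine Finset.sum_congr rfl fun m hm => ?_
    have h3 : degInr m ≤ D := Finset.le_sup hm
    split_ifs with h4
    · rw [MvPolynomial.eval_monomial, h4, Nat.sub_self, pow_zero, mul_one]
      congr 1
      rw [Finsupp.prod_fintype _ _ (fun _ => pow_zero _), Fintype.prod_sum_type]
      simp only [Sum.elim_inl, Sum.elim_inr, hf0, hg0]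
    · rw [zero_pow (by omega), mul_zero, zero_mul]
  have h5 := hTcoeff m₀
  rw [if_pos ⟨hm₀, hm₀D.symm⟩, hT0, MvPolynomial.coeff_zero] at h5
  exact h5.symm

end Independence

/-! ### Degrees of observables in the generators: upper bounds -/

section UpperBounds

set_option linter.unusedSectionVars false

variable {𝕜 : Type*} [RCLike 𝕜] [NormedAlgebra 𝕜 ℂ] {N : ℕ}

/-- The observable `f` is a polynomial of total degree at most `d` in the family `g`. -/
def DegLE {ι : Type*} (g : ι → Observable 𝕜 N) (f : Observable 𝕜 N) (d : ℕ) : Prop :=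
  ∃ P : MvPolynomial ι ℂ, MvPolynomial.aeval g P = f ∧ P.totalDegree ≤ d

namespace DegLE

variable {ι : Type*} {g : ι → Observable 𝕜 N} {f f' : Observable 𝕜 N} {d d' : ℕ}

theorem mono (h : DegLE g f d) (hd : d ≤ d') : DegLE g f d' :=
  h.imp fun _ hP => ⟨hP.1, hP.2.trans hd⟩

theorem gen (i : ι) : DegLE g (g i) 1 :=
  ⟨MvPolynomial.X i, MvPolynomial.aeval_X _ _, (MvPolynomial.totalDegree_X i).le⟩

theorem const (c : ℂ) : DegLE g (algebraMap ℂ _ c) d :=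
  ⟨MvPolynomial.C c, MvPolynomial.aeval_C _ _,
    by rw [MvPolynomial.totalDegree_C]; exact Nat.zero_le _⟩

theorem zero : DegLE g (0 : Observable 𝕜 N) d := by
  simpa using const (g := g) (d := d) 0

theorem add (h : DegLE g f d) (h' : DegLE g f' d) : DegLE g (f + f') d := by
  obtain ⟨P, rfl, hP⟩ := h
  obtain ⟨Q, rfl, hQ⟩ := h'
  exact ⟨P + Q, map_add _ _ _, (MvPolynomial.totalDegree_add _ _).trans (max_le hP hQ)⟩

theorem neg (h : DegLE g f d) : DegLE g (-f) d := by
  obtain ⟨P, rfl, hP⟩ := h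
  exact ⟨-P, map_neg _ _, by rwa [MvPolynomial.totalDegree_neg]⟩

theorem sub (h : DegLE g f d) (h' : DegLE g f' d) : DegLE g (f - f') d := by
  rw [sub_eq_add_neg]
  exact h.add h'.neg

theorem smul (c : ℂ) (h : DegLE g f d) : DegLE g (c • f) d := by
  obtain ⟨P, rfl, hP⟩ := h
  exact ⟨c • P, map_smul _ _ _, (MvPolynomial.totalDegree_smul_le _ _).trans hP⟩

theorem mul (h : DegLE g f d) (h' : DegLE g f' d') : DegLE g (f * f') (d + d') := by
  obtain ⟨P, rfl, hP⟩ := h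
  obtain ⟨Q, rfl, hQ⟩ := h'
  exact ⟨P * Q, map_mul _ _ _, (MvPolynomial.totalDegree_mul _ _).trans (add_le_add hP hQ)⟩

theorem sum {κ : Type*} (s : Finset κ) (φ : κ → Observable 𝕜 N) (h : ∀ i ∈ s, DegLE g (φ i) d) :
    DegLE g (∑ i ∈ s, φ i) d := by
  classical
  induction s using Finset.induction_on with
  | empty => simpa using zero
  | insert a s ha ih =>
    rw [Finset.sum_insert ha]
    exact (h a (Finset.mem_insert_self _ _)).add
      (ih fun i hi => h i (Finset.mem_insert_of_mem hi))

theorem mem_adjoin (h : DegLE g f d) : f ∈ Algebra.adjoin ℂ (Set.range g) := by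
  obtain ⟨P, rfl, -⟩ := h
  rw [Algebra.adjoin_range_eq_range_aeval]
  exact ⟨P, rfl⟩

theorem degreeIn_le (h : DegLE g f d) : degreeIn g f ≤ d := by
  obtain ⟨P, hP, hd⟩ := h
  exact iInf₂_le_of_le P hP (Nat.cast_le.2 hd)

end DegLE

theorem bellF_rec (ν : ℝ) (k : ℕ) : (k : ℂ) • (bellF ν k : Observable 𝕜 N) =
    -∑ i ∈ Finset.range k, F ν (k - i) * bellF ν i := by
  funext z
  have h := newtonCoeff_rec (fun i => F ν i z) k
  simp only [Pi.smul_apply, Pi.neg_apply, Finset.sum_apply, Pi.mul_apply, bellF_eq_newtonCoeff]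
  exact h

variable (ν : ℝ) (a : ℂ)

theorem degLE_F_of_le (k : ℕ) (h1 : 1 ≤ k) (hk : k ≤ N) :
    DegLE (genA ν a : GenIndex N → Observable 𝕜 N) (F ν k) 1 := by
  have := DegLE.gen (g := (genA ν a : GenIndex N → Observable 𝕜 N)) (Sum.inl ⟨k - 1, by omega⟩)
  simpa only [genA, Sum.elim_inl, Nat.sub_add_cancel h1] using this

theorem degLE_bellF (k : ℕ) (hk : k ≤ N) :
    DegLE (genA ν a : GenIndex N → Observable 𝕜 N) (bellF ν k) k := by
  induction k using Nat.strong_induction_on with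
  | _ k ih =>
    rcases Nat.eq_zero_or_pos k with rfl | hpos
    · have : (bellF ν 0 : Observable 𝕜 N) = algebraMap ℂ _ 1 := by
        funext z
        rw [bellF_eq_newtonCoeff, newtonCoeff_zero]
        simp
      rw [this]
      exact DegLE.const 1
    · have hk0 : (k : ℂ) ≠ 0 := Nat.cast_ne_zero.2 hpos.ne'
      have h : (bellF ν k : Observable 𝕜 N) =
          (k : ℂ)⁻¹ • -∑ i ∈ Finset.range k, F ν (k - i) * bellF ν i := by
        rw [← bellF_rec, smul_smul, inv_mul_cancel₀ hk0, one_smul]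
      rw [h]
      refine (DegLE.neg (DegLE.sum _ _ fun i hi => ?_)).smul _
      have hi' := Finset.mem_range.1 hi
      exact ((degLE_F_of_le ν a (k - i) (by omega) (by omega)).mul
        (ih i hi' (by omega))).mono (by omega)

theorem degLE_F (k : ℕ) (h1 : 1 ≤ k) :
    DegLE (genA ν a : GenIndex N → Observable 𝕜 N) (F ν k) k := by
  induction k using Nat.strong_induction_on with
  | _ k ih =>
    rcases le_or_gt k N with hk | hk
    · exact (degLE_F_of_le ν a k h1 hk).mono h1
    · obtain ⟨s, rfl⟩ := Nat.exists_eq_add_of_lt hk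
      rw [add_assoc, F_add ν]
      refine DegLE.neg (DegLE.sum _ _ fun i hi => ?_)
      have hi' := Finset.mem_Icc.1 hi
      exact ((degLE_bellF ν a i hi'.2).mul (ih _ (by omega) (by omega))).mono (by omega)

theorem degLE_Ka_of_le (q l : ℕ) (hq : 1 ≤ q) (hqN : q ≤ N) (hl : 1 ≤ l) (hlN : l ≤ N) :
    DegLE (genA ν a : GenIndex N → Observable 𝕜 N) (Ka ν a q l) 1 := by
  have key : ∀ m n : ℕ, 1 ≤ n → n < m → m ≤ N →
      DegLE (genA ν a : GenIndex N → Observable 𝕜 N) (Ka ν a m n) 1 := by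
    intro m n hn hnm hm
    have := DegLE.gen (g := (genA ν a : GenIndex N → Observable 𝕜 N))
      (Sum.inr ⟨(⟨m - 1, by omega⟩, ⟨n - 1, by omega⟩), by simp only [Fin.mk_lt_mk]; omega⟩)
    simpa only [genA, Sum.elim_inr, Nat.sub_add_cancel hn,
      Nat.sub_add_cancel (hn.trans hnm.le)] using this
  rcases lt_trichotomy l q with h | h | h
  · exact key q l hl h hqN
  · subst h
    have : (Ka ν a l l : Observable 𝕜 N) = 0 := by rw [Ka]; ring
    rw [this]
    exact DegLE.zero
  · rw [Ka_antisymm]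
    exact (key l q hq h hlN).neg

theorem degLE_Ka (q l : ℕ) (hq : 1 ≤ q) (hl : 1 ≤ l) (hlN : l ≤ N) :
    DegLE (genA ν a : GenIndex N → Observable 𝕜 N) (Ka ν a q l) q := by
  induction q using Nat.strong_induction_on with
  | _ q ih =>
    rcases le_or_gt q N with hk | hk
    · exact (degLE_Ka_of_le ν a q l hq hk hl hlN).mono hq
    · obtain ⟨s, rfl⟩ := Nat.exists_eq_add_of_lt hk
      rw [add_assoc, Ka_add ν a _ _ (by omega)]
      refine DegLE.neg (DegLE.sum _ _ fun i hi => ?_)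
      have hi' := Finset.mem_Icc.1 hi
      exact ((degLE_bellF ν a i hi'.2).mul (ih _ (by omega) (by omega))).mono (by omega)

/-- The degree of `{F_i, K_{m,n}}` is at most `2N`, and at most `2N - 1` when `a = 0`, because the
indices in the part without `a` are lower by one. -/
theorem degLE_bracket_F_Ka (i m n d : ℕ) (hi : 1 ≤ i) (hiN : i ≤ N) (hn : 1 ≤ n) (hnm : n < m)
    (hm : m ≤ N) (hd : 2 * N ≤ d + 1) (had : a ≠ 0 → 2 * N ≤ d) :
    DegLE (genA ν a : GenIndex N → Observable 𝕜 N)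
      (poissonBracket (F ν i) (Ka ν a m n)) d := by
  have hF : ∀ k q, 1 ≤ k → k ≤ N → 1 ≤ q →
      DegLE (genA ν a : GenIndex N → Observable 𝕜 N) (F ν k * F ν q) (1 + q) := fun k q h1 h2 h3 =>
    (degLE_F_of_le ν a k h1 h2).mul (degLE_F ν a q h3)
  rw [poissonBracket_F_Ka ν a i m n (by omega) hn]
  refine DegLE.add (DegLE.smul _ (DegLE.sub ?_ ?_)) ?_
  · by_cases h0 : i + n - 2 = 0
    · rw [h0, F_zero]
      exact ((degLE_F_of_le ν a m (by omega) hm).mul (DegLE.const (d := 0) _)).mono (by omega)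
    · exact (hF m _ (by omega) hm (by omega)).mono (by omega)
  · exact (hF n _ (by omega) (by omega) (by omega)).mono (by omega)
  · by_cases ha : a = 0
    · rw [ha, mul_zero, zero_smul]
      exact DegLE.zero
    · have := had ha
      exact DegLE.smul _ (DegLE.sub ((hF m _ (by omega) hm (by omega)).mono (by omega))
        ((hF n _ (by omega) (by omega) (by omega)).mono (by omega)))

/-- The degree of `{K_{i,j}, K_{m,n}}` is at most `2N`, and at most `2N - 1` when `a = 0`. -/
theorem degLE_bracket_Ka_Ka (i j m n d : ℕ) (hj : 1 ≤ j) (hji : j < i) (hi : i ≤ N)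
    (hn : 1 ≤ n) (hnm : n < m) (hm : m ≤ N) (hd : 2 * N ≤ d + 1) (had : a ≠ 0 → 2 * N ≤ d) :
    DegLE (genA ν a : GenIndex N → Observable 𝕜 N)
      (poissonBracket (Ka ν a i j) (Ka ν a m n)) d := by
  have hF1 : ∀ (k q l : ℕ) (c : ℂ), 1 ≤ k → k ≤ N → 1 ≤ q → 1 ≤ l → l ≤ N → q + 1 ≤ d →
      DegLE (genA ν a : GenIndex N → Observable 𝕜 N) (F ν k * c • Ka ν a q l) d :=
    fun k q l c h1 h2 h3 h4 h5 h6 =>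
      ((degLE_F_of_le ν a k h1 h2).mul ((degLE_Ka ν a q l h3 h4 h5).smul c)).mono (by omega)
  -- the degree is bounded by the larger index, which may stand in either position
  have hF2 : ∀ (k q l : ℕ) (c : ℂ), 1 ≤ k → k ≤ N → 1 ≤ q → 1 ≤ l → l ≤ N → q + 1 ≤ d →
      DegLE (genA ν a : GenIndex N → Observable 𝕜 N) (F ν k * c • Ka ν a l q) d :=
    fun k q l c h1 h2 h3 h4 h5 h6 => by
      rw [Ka_antisymm]
      exact ((degLE_F_of_le ν a k h1 h2).mul ((degLE_Ka ν a q l h3 h4 h5).neg.smul c)).mono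
        (by omega)
  -- for `j = n = 1` the terms with the index `0` combine to `N K_{i,m}`
  have h0 : DegLE (genA ν a : GenIndex N → Observable 𝕜 N)
      (F ν i * (n : ℂ) • Ka ν a (j + n - 2) m + F ν m * (j : ℂ) • Ka ν a i (j + n - 2)) d := by
    by_cases hjn : j + n - 2 = 0
    · obtain ⟨rfl, rfl⟩ : j = 1 ∧ n = 1 := by omega
      have : (F ν i * ((1 : ℕ) : ℂ) • Ka ν a (1 + 1 - 2) m +
          F ν m * ((1 : ℕ) : ℂ) • Ka ν a i (1 + 1 - 2) : Observable 𝕜 N) =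
          (N : ℂ) • Ka ν a i m := by
        rw [← F_mul_Ka_zero, Nat.cast_one, one_smul, one_smul, hjn, Ka_antisymm ν a i 0]
        ring
      rw [this]
      exact ((degLE_Ka_of_le ν a i m (by omega) hi (by omega) hm).smul _).mono (by omega)
    · exact (hF1 _ _ _ _ (by omega) (by omega) (by omega) (by omega) (by omega) (by omega)).add
        (hF2 _ _ _ _ (by omega) (by omega) (by omega) (by omega) (by omega) (by omega))
  rw [poissonBracket_Ka_Ka ν a i j m n (by omega) hj (by omega) hn]
  refine DegLE.add ?_ ?_
  · have : ∀ x₁ x₂ x₃ x₄ x₅ x₆ x₇ x₈ y₁ y₂ y₃ y₄ : Observable 𝕜 N,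
        y₁ * (x₁ + x₂) + y₂ * (x₃ + x₄) + y₃ * (x₅ + x₆) + y₄ * (x₇ + x₈) =
        (y₁ * x₂ + y₃ * x₆) + y₁ * x₁ + y₂ * x₃ + y₂ * x₄ + y₃ * x₅ + y₄ * x₇ + y₄ * x₈ := by
      intros; ring
    rw [this]
    refine (((((h0.add ?_).add ?_).add ?_).add ?_).add ?_).add ?_
    · exact hF2 _ _ _ _ (by omega) (by omega) (by omega) (by omega) (by omega) (by omega)
    · exact hF1 _ _ _ _ (by omega) (by omega) (by omega) (by omega) (by omega) (by omega)
    · exact hF2 _ _ _ _ (by omega) (by omega) (by omega) (by omega) (by omega) (by omega)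
    · exact hF1 _ _ _ _ (by omega) (by omega) (by omega) (by omega) (by omega) (by omega)
    · exact hF2 _ _ _ _ (by omega) (by omega) (by omega) (by omega) (by omega) (by omega)
    · exact hF1 _ _ _ _ (by omega) (by omega) (by omega) (by omega) (by omega) (by omega)
  · by_cases ha : a = 0
    · rw [ha, zero_smul]
      exact DegLE.zero
    · have := had ha
      simp only [mul_add]
      refine DegLE.smul _ ((((DegLE.add ?_ ?_).add (DegLE.add ?_ ?_)).add
        (DegLE.add ?_ ?_)).add (DegLE.add ?_ ?_))
      · exact hF2 _ _ _ _ (by omega) (by omega) (by omega) (by omega) (by omega) (by omega)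
      · exact hF1 _ _ _ _ (by omega) (by omega) (by omega) (by omega) (by omega) (by omega)
      · exact hF1 _ _ _ _ (by omega) (by omega) (by omega) (by omega) (by omega) (by omega)
      · exact hF2 _ _ _ _ (by omega) (by omega) (by omega) (by omega) (by omega) (by omega)
      · exact hF1 _ _ _ _ (by omega) (by omega) (by omega) (by omega) (by omega) (by omega)
      · exact hF2 _ _ _ _ (by omega) (by omega) (by omega) (by omega) (by omega) (by omega)
      · exact hF2 _ _ _ _ (by omega) (by omega) (by omega) (by omega) (by omega) (by omega)
      · exact hF1 _ _ _ _ (by omega) (by omega) (by omega) (by omega) (by omega) (by omega)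

theorem degLE_bracket_genA (d : ℕ) (hd : 2 * N ≤ d + 1) (had : a ≠ 0 → 2 * N ≤ d)
    (s t : GenIndex N) : DegLE (genA ν a : GenIndex N → Observable 𝕜 N)
      (poissonBracket (genA ν a s) (genA ν a t)) d := by
  rcases s with i | ⟨⟨i, j⟩, hij⟩ <;> rcases t with m | ⟨⟨m, n⟩, hmn⟩
  · change DegLE _ (poissonBracket (F ν (i + 1)) (F ν (m + 1))) d
    rw [poissonBracket_F_F]
    exact DegLE.zero
  · have h : (n : ℕ) < m := hmn
    exact degLE_bracket_F_Ka ν a (i + 1) (m + 1) (n + 1) d (by omega) (by omega) (by omega)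
      (by omega) (by omega) hd had
  · have h : (j : ℕ) < i := hij
    rw [poissonBracket_antisymm]
    exact (degLE_bracket_F_Ka ν a (m + 1) (i + 1) (j + 1) d (by omega) (by omega) (by omega)
      (by omega) (by omega) hd had).neg
  · have h : (n : ℕ) < m := hmn
    have h' : (j : ℕ) < i := hij
    exact degLE_bracket_Ka_Ka ν a (i + 1) (j + 1) (m + 1) (n + 1) d (by omega) (by omega)
      (by omega) (by omega) (by omega) (by omega) hd had

/-- For two particles and `a = 0`, all brackets of generators are at most quadratic, since no index
exceeds `2`. -/
theorem degLE_bracket_genA_two (hN : N = 2) (s t : GenIndex N) :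
    DegLE (genA ν 0 : GenIndex N → Observable 𝕜 N)
      (poissonBracket (genA ν 0 s) (genA ν 0 t)) 2 := by
  have key : ∀ i m n : Fin N, n < m → DegLE (genA ν 0 : GenIndex N → Observable 𝕜 N)
      (poissonBracket (F ν (i + 1)) (Ka ν 0 (m + 1) (n + 1))) 2 := by
    intro i m n hmn
    have h : (n : ℕ) < m := hmn
    have hm : (m : ℕ) = 1 := by omega
    have hn : (n : ℕ) = 0 := by omega
    rw [poissonBracket_F_Ka ν 0 _ _ _ (by omega) (by omega), mul_zero, zero_smul, add_zero, hm, hn]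
    have hF : ∀ k, 1 ≤ k → k ≤ 2 → DegLE (genA ν 0 : GenIndex N → Observable 𝕜 N) (F ν k) 1 :=
      fun k h1 h2 => degLE_F_of_le ν 0 k h1 (by omega)
    refine DegLE.smul _ (DegLE.sub ?_ ?_)
    · by_cases hi : (i : ℕ) = 0
      · rw [hi, show 0 + 1 + (0 + 1) - 2 = 0 from rfl, F_zero]
        exact ((hF _ (by omega) (by omega)).mul (DegLE.const (d := 0) _)).mono (by omega)
      · exact (hF _ (by omega) (by omega)).mul (hF _ (by omega) (by omega))
    · exact (hF _ (by omega) (by omega)).mul (hF _ (by omega) (by omega))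
  rcases s with i | ⟨⟨i, j⟩, hij⟩ <;> rcases t with m | ⟨⟨m, n⟩, hmn⟩
  · change DegLE _ (poissonBracket (F ν (i + 1)) (F ν (m + 1))) 2
    rw [poissonBracket_F_F]
    exact DegLE.zero
  · exact key i m n hmn
  · rw [poissonBracket_antisymm]
    exact (key m i j hij).neg
  · have h : (n : ℕ) < m := hmn
    have h' : (j : ℕ) < i := hij
    obtain rfl : i = m := by omega
    obtain rfl : j = n := by omega
    have h0 : ∀ f : Observable 𝕜 N, poissonBracket f f = 0 := fun f => by
      rw [poissonBracket]
      refine Finset.sum_eq_zero fun k _ => ?_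
      ring
    rw [h0]
    exact DegLE.zero

end UpperBounds

/-! ### Degrees of observables in the generators: lower bounds -/

section LowerBounds

variable {𝕜 : Type*} [RCLike 𝕜] [NormedAlgebra 𝕜 ℂ] {N : ℕ} (ν : ℝ) (a : ℂ)

theorem F_eq_newtonExtend (k : ℕ) : (F ν k : Observable 𝕜 N) =
    newtonExtend N (powerSumSeq fun i : Fin N => (F ν (i + 1) : Observable 𝕜 N)) k := by
  have h0 : ∀ k ≤ N, (F ν k : Observable 𝕜 N) =
      powerSumSeq (fun i : Fin N => (F ν (i + 1) : Observable 𝕜 N)) k :=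
    powerSumSeq_eq (fun k => (F ν k : Observable 𝕜 N)) (by funext z; simp [F])
  have hb : ∀ i ≤ N, (bellF ν i : Observable 𝕜 N) =
      newtonCoeff (powerSumSeq fun i : Fin N => (F ν (i + 1) : Observable 𝕜 N)) i := by
    intro i hi
    rw [← newtonCoeff_congr (fun k _ hk => h0 k hk) i hi]
    funext z
    rw [bellF_eq_newtonCoeff]
    exact (map_newtonCoeff (Pi.evalAlgHom ℂ (fun _ : PhaseSpace 𝕜 N => ℂ) z)
      (fun k => (F ν k : Observable 𝕜 N)) i).symm
  refine newtonExtend_unique _ (fun k => (F ν k : Observable 𝕜 N)) h0 (fun k hk => ?_) k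
  obtain ⟨s, rfl⟩ := Nat.exists_eq_add_of_lt hk
  rw [add_assoc, F_add ν]
  congr 1
  refine Finset.sum_congr rfl fun i hi => ?_
  rw [hb i (Finset.mem_Icc.1 hi).2]

theorem aeval_F_powerSumPoly (k : ℕ) :
    MvPolynomial.aeval (fun i : Fin N => (F ν (i + 1) : Observable 𝕜 N)) (powerSumPoly N k) =
      F ν k := by
  rw [aeval_powerSumPoly, ← F_eq_newtonExtend]

/-- If a polynomial in the generators equals a polynomial `Q` in the `F_k` as a function, then
dropping the generators `K_{m,n}` from it leaves `Q`: substitute `J_k = 0` in the polynomial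
identity between the algebraically independent `F_k` and `J_k`. -/
theorem drop_Ka (P : MvPolynomial (GenIndex N) ℂ) (Q : MvPolynomial (Fin N) ℂ)
    (h : MvPolynomial.aeval (genA ν a : GenIndex N → Observable 𝕜 N) P =
      MvPolynomial.aeval (fun i : Fin N => (F ν (i + 1) : Observable 𝕜 N)) Q) :
    MvPolynomial.aeval (Sum.elim MvPolynomial.X fun _ => 0 : GenIndex N → MvPolynomial (Fin N) ℂ) P
      = Q := by
  set G : GenIndex N → MvPolynomial (Fin N ⊕ Fin N) ℂ := Sum.elim
    (fun k => MvPolynomial.X (Sum.inl k))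
    (fun mn => MvPolynomial.X (Sum.inr mn.1.1) * MvPolynomial.X (Sum.inl mn.1.2) -
      MvPolynomial.X (Sum.inl mn.1.1) * MvPolynomial.X (Sum.inr mn.1.2)) with hG
  have hS : MvPolynomial.aeval G P - MvPolynomial.rename Sum.inl Q = 0 := by
    refine independent (𝕜 := 𝕜) ν a _ fun z => ?_
    have hz := congrFun h z
    have e1 : ∀ (ι : Type) (φ : ι → Observable 𝕜 N) (R : MvPolynomial ι ℂ),
        (MvPolynomial.aeval φ R) z = MvPolynomial.aeval (fun i => φ i z) R := fun ι φ R =>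
      MvPolynomial.comp_aeval_apply φ (Pi.evalAlgHom ℂ (fun _ : PhaseSpace 𝕜 N => ℂ) z) R
    rw [e1, e1] at hz
    rw [map_sub, sub_eq_zero, MvPolynomial.eval_rename, ← MvPolynomial.aeval_eq_eval,
      ← MvPolynomial.aeval_eq_eval]
    refine Eq.trans ?_ hz
    have e2 := MvPolynomial.comp_aeval_apply G (MvPolynomial.aeval (Sum.elim
      (fun k : Fin N => F ν (k + 1) z) (fun k : Fin N => Ja ν a (k + 1) z))) P
    refine e2.trans ?_
    congr 2
    funext s
    rcases s with k | mn
    · simp [hG, genA]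
    · simp [hG, genA, Ka]
  have h1 := congrArg (MvPolynomial.aeval (Sum.elim MvPolynomial.X fun _ => 0 :
    Fin N ⊕ Fin N → MvPolynomial (Fin N) ℂ)) hS
  rw [map_sub, map_zero, sub_eq_zero, MvPolynomial.aeval_rename] at h1
  have h2 : MvPolynomial.aeval ((Sum.elim MvPolynomial.X fun _ => 0 :
      Fin N ⊕ Fin N → MvPolynomial (Fin N) ℂ) ∘ Sum.inl) Q = Q := by
    rw [Sum.elim_comp_inl]
    exact MvPolynomial.aeval_X_left_apply Q
  rw [h2] at h1
  rw [← h1]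
  have e3 := MvPolynomial.comp_aeval_apply G (MvPolynomial.aeval (Sum.elim MvPolynomial.X
    fun _ => 0 : Fin N ⊕ Fin N → MvPolynomial (Fin N) ℂ)) P
  refine Eq.trans ?_ e3.symm
  congr 2
  funext s
  rcases s with k | mn <;> simp [hG]

/-- The specialisation `F_1 = t`, `F_2 = ⋯ = F_N = 0`. -/
def spike (N : ℕ) (k : Fin N) : Polynomial ℂ := if (k : ℕ) = 0 then Polynomial.X else 0

/-- A lower bound for the degree of a polynomial in the `F_k`: its degree along the curve `spike`,
whose coordinates have degree at most one. -/
theorem natDegree_le_degreeIn (f : Observable 𝕜 N) (Q : MvPolynomial (Fin N) ℂ)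
    (hQ : f = MvPolynomial.aeval (fun i : Fin N => (F ν (i + 1) : Observable 𝕜 N)) Q)
    (d : ℕ) (hd : (MvPolynomial.aeval (spike N) Q).coeff d ≠ 0) :
    (d : ℕ∞) ≤ degreeIn (genA ν a : GenIndex N → Observable 𝕜 N) f := by
  refine le_iInf₂ fun P hP => Nat.cast_le.2 ?_
  have h1 := drop_Ka ν a P Q (hP.trans hQ)
  have h2 := MvPolynomial.comp_aeval_apply (Sum.elim MvPolynomial.X fun _ => 0 :
    GenIndex N → MvPolynomial (Fin N) ℂ) (MvPolynomial.aeval (spike N)) P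
  rw [h1] at h2
  have h3 := MvPolynomial.aeval_natDegree_le P le_rfl (n := 1)
    (fun i => MvPolynomial.aeval (spike N)
      ((Sum.elim MvPolynomial.X fun _ => 0 : GenIndex N → MvPolynomial (Fin N) ℂ) i)) (by
      rintro (k | mn)
      · simp only [Sum.elim_inl, MvPolynomial.aeval_X, spike]
        split_ifs <;> simp
      · simp)
  rw [← h2, mul_one] at h3
  exact (Polynomial.le_natDegree_of_ne_zero hd).trans h3

theorem powerSumSeq_spike_eq_zero (k : ℕ) (hk : 2 ≤ k) : powerSumSeq (spike N) k = 0 := by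
  rw [powerSumSeq, if_neg (by omega)]
  split_ifs
  · rw [spike, if_neg]
    simp only
    omega
  · rfl

theorem powerSumSeq_spike_one (hN : 1 ≤ N) : powerSumSeq (spike N) 1 = Polynomial.X := by
  rw [powerSumSeq, if_neg (by omega), dif_pos (by omega), spike, if_pos rfl]

theorem aeval_spike_powerSumPoly_of_le (k : ℕ) (hk : 2 ≤ k) (hkN : k ≤ N) :
    MvPolynomial.aeval (spike N) (powerSumPoly N k) = 0 := by
  rw [aeval_powerSumPoly, newtonExtend_of_le _ hkN, powerSumSeq_spike_eq_zero k hk]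

theorem aeval_spike_powerSumPoly_one (hN : 1 ≤ N) :
    MvPolynomial.aeval (spike N) (powerSumPoly N 1) = Polynomial.X := by
  rw [aeval_powerSumPoly, newtonExtend_of_le _ hN, powerSumSeq_spike_one hN]

theorem aeval_spike_powerSumPoly (hN : 1 ≤ N) (j : ℕ) (hj : j < N) :
    ∃ c : ℂ, c ≠ 0 ∧ MvPolynomial.aeval (spike N) (powerSumPoly N (N + 1 + j)) =
      Polynomial.C c * Polynomial.X ^ (N + 1 + j) := by
  refine ⟨-((N.factorial : ℂ)⁻¹ * (j.factorial : ℂ)⁻¹ * (-1) ^ N), ?_, ?_⟩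
  · refine neg_ne_zero.2 (mul_ne_zero (mul_ne_zero (inv_ne_zero ?_) (inv_ne_zero ?_)) ?_)
    · exact Nat.cast_ne_zero.2 N.factorial_ne_zero
    · exact Nat.cast_ne_zero.2 j.factorial_ne_zero
    · exact pow_ne_zero _ (by norm_num)
  · rw [aeval_powerSumPoly, newtonExtend_spike _ N hN
      (fun k hk _ => powerSumSeq_spike_eq_zero k hk) j hj, powerSumSeq_spike_one hN,
      Polynomial.smul_eq_C_mul, Polynomial.C_neg, neg_mul]

/-- The bracket `{F_N, K_{N,1}}` as a polynomial in the `F_k`; it attains the degree of the algebra.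
-/
def topBracketPoly (N : ℕ) (a : ℂ) : MvPolynomial (Fin N) ℂ :=
  (N : ℂ) • (powerSumPoly N N * powerSumPoly N (N + 1 - 2)
      - powerSumPoly N 1 * powerSumPoly N (N + N - 2))
    + ((N : ℂ) * a) • (powerSumPoly N N * powerSumPoly N (N + 1 - 1)
      - powerSumPoly N 1 * powerSumPoly N (N + N - 1))

theorem poissonBracket_top (hN : 1 ≤ N) :
    poissonBracket (F ν N : Observable 𝕜 N) (Ka ν a N 1) =
      MvPolynomial.aeval (fun i : Fin N => (F ν (i + 1) : Observable 𝕜 N))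
        (topBracketPoly N a) := by
  rw [poissonBracket_F_Ka ν a N N 1 hN le_rfl, topBracketPoly]
  simp only [map_add, map_smul, map_sub, map_mul, aeval_F_powerSumPoly]

theorem aeval_spike_topBracketPoly (hN : 2 ≤ N) :
    MvPolynomial.aeval (spike N) (topBracketPoly N a) =
      -((N : ℂ) • (Polynomial.X * MvPolynomial.aeval (spike N) (powerSumPoly N (N + N - 2)))
        + ((N : ℂ) * a) •
          (Polynomial.X * MvPolynomial.aeval (spike N) (powerSumPoly N (N + N - 1)))) := by
  rw [topBracketPoly]
  simp only [map_add, map_smul, map_sub, map_mul, aeval_spike_powerSumPoly_of_le N hN le_rfl,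
    aeval_spike_powerSumPoly_one (one_le_two.trans hN), zero_mul, zero_sub, smul_neg]
  abel

theorem coeff_topBracketPoly (hN : 2 ≤ N) (ha : a ≠ 0) :
    (MvPolynomial.aeval (spike N) (topBracketPoly N a)).coeff (2 * N) ≠ 0 := by
  obtain ⟨c, hc, h1⟩ := aeval_spike_powerSumPoly (N := N) (by omega) (N - 2) (by omega)
  rw [show N + 1 + (N - 2) = N + N - 1 by omega] at h1
  have h2 : (Polynomial.X *
      MvPolynomial.aeval (spike N) (powerSumPoly N (N + N - 2))).coeff (2 * N) = 0 := by
    rcases Nat.lt_or_ge N 3 with h3 | h3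
    · rw [aeval_spike_powerSumPoly_of_le _ (by omega) (by omega), mul_zero, Polynomial.coeff_zero]
    · obtain ⟨c', -, h4⟩ := aeval_spike_powerSumPoly (N := N) (by omega) (N - 3) (by omega)
      rw [show N + 1 + (N - 3) = N + N - 2 by omega] at h4
      rw [h4, mul_left_comm, ← pow_succ', Polynomial.coeff_C_mul, Polynomial.coeff_X_pow,
        if_neg (by omega), mul_zero]
  rw [aeval_spike_topBracketPoly a hN, Polynomial.coeff_neg, Polynomial.coeff_add,
    Polynomial.coeff_smul, Polynomial.coeff_smul, h2, h1, mul_left_comm, ← pow_succ',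
    Polynomial.coeff_C_mul, Polynomial.coeff_X_pow, if_pos (by omega), smul_zero, zero_add, mul_one]
  exact neg_ne_zero.2 (mul_ne_zero (mul_ne_zero (Nat.cast_ne_zero.2 (by omega)) ha) hc)

theorem coeff_topBracketPoly_zero (hN : 3 ≤ N) :
    (MvPolynomial.aeval (spike N) (topBracketPoly N 0)).coeff (2 * N - 1) ≠ 0 := by
  obtain ⟨c, hc, h1⟩ := aeval_spike_powerSumPoly (N := N) (by omega) (N - 3) (by omega)
  rw [show N + 1 + (N - 3) = N + N - 2 by omega] at h1
  rw [aeval_spike_topBracketPoly 0 (by omega), mul_zero, zero_smul, add_zero, Polynomial.coeff_neg,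
    Polynomial.coeff_smul, h1, mul_left_comm, ← pow_succ', Polynomial.coeff_C_mul,
    Polynomial.coeff_X_pow, if_pos (by omega), mul_one]
  exact neg_ne_zero.2 (mul_ne_zero (Nat.cast_ne_zero.2 (by omega)) hc)

theorem le_algebraDegree_of_coeff (hN : 2 ≤ N) (d : ℕ)
    (hd : (MvPolynomial.aeval (spike N) (topBracketPoly N a)).coeff d ≠ 0) :
    (d : ℕ∞) ≤ algebraDegree (genA ν a : GenIndex N → Observable 𝕜 N) := by
  have h := natDegree_le_degreeIn ν a _ _ (poissonBracket_top (𝕜 := 𝕜) ν a (by omega)) d hd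
  refine h.trans (le_iSup₂_of_le (Sum.inl ⟨N - 1, by omega⟩) (Sum.inr ⟨(⟨N - 1, by omega⟩,
    ⟨0, by omega⟩), by simp only [Fin.mk_lt_mk]; omega⟩) ?_)
  simp only [genA, Sum.elim_inl, Sum.elim_inr, Nat.sub_add_cancel (one_le_two.trans hN), zero_add]
  exact le_rfl

theorem algebraDegree_genA_le (d : ℕ)
    (h : ∀ s t : GenIndex N, DegLE (genA ν a : GenIndex N → Observable 𝕜 N)
      (poissonBracket (genA ν a s) (genA ν a t)) d) :
    algebraDegree (genA ν a : GenIndex N → Observable 𝕜 N) ≤ d :=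
  iSup₂_le fun s t => (h s t).degreeIn_le

theorem algebraDegree_genA (hN : 2 ≤ N) (ha : a ≠ 0) :
    algebraDegree (genA ν a : GenIndex N → Observable 𝕜 N) = (2 * N : ℕ) :=
  le_antisymm
    (algebraDegree_genA_le ν a _ (degLE_bracket_genA ν a _ (Nat.le_succ _) fun _ => le_rfl))
    (le_algebraDegree_of_coeff ν a hN _ (coeff_topBracketPoly a hN ha))

theorem algebraDegree_genA_zero (hN : 3 ≤ N) :
    algebraDegree (genA ν 0 : GenIndex N → Observable 𝕜 N) = (2 * N - 1 : ℕ) :=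
  le_antisymm
    (algebraDegree_genA_le ν 0 _ (degLE_bracket_genA ν 0 _ (by omega) fun h => absurd rfl h))
    (le_algebraDegree_of_coeff ν 0 (by omega) _ (coeff_topBracketPoly_zero hN))

theorem algebraDegree_genA_zero_two (hN : N = 2) :
    algebraDegree (genA ν 0 : GenIndex N → Observable 𝕜 N) = (2 : ℕ) := by
  refine le_antisymm (algebraDegree_genA_le ν 0 _ (degLE_bracket_genA_two ν hN)) ?_
  -- the quadratic term comes from `{F_1, K_{2,1}} = 2 F_2 - F_1 ^ 2`
  have h1 : poissonBracket (F ν 1 : Observable 𝕜 N) (Ka ν 0 2 1) =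
      MvPolynomial.aeval (fun i : Fin N => (F ν (i + 1) : Observable 𝕜 N))
        (powerSumPoly N 2 * powerSumPoly N 0 - powerSumPoly N 1 * powerSumPoly N 1) := by
    rw [poissonBracket_F_Ka ν 0 1 2 1 one_le_two le_rfl]
    simp only [map_sub, map_mul, aeval_F_powerSumPoly]
    simp
  have h2 := natDegree_le_degreeIn ν 0 _ _ h1 2 (by
    rw [map_sub, map_mul, map_mul, aeval_spike_powerSumPoly_of_le 2 le_rfl hN.ge,
      aeval_spike_powerSumPoly_one (by omega), zero_mul, zero_sub, ← pow_two, Polynomial.coeff_neg,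
      Polynomial.coeff_X_pow, if_pos rfl]
    norm_num)
  refine h2.trans (le_iSup₂_of_le (Sum.inl ⟨0, by omega⟩) (Sum.inr ⟨(⟨1, by omega⟩,
    ⟨0, by omega⟩), by simp⟩) ?_)
  simp only [genA, Sum.elim_inl, Sum.elim_inr, zero_add, Nat.reduceAdd]
  exact le_rfl

end LowerBounds

/-! ### The symmetry algebra and its Poisson ideal -/

section SymmetryAlgebra

set_option linter.unusedSectionVars false

variable {𝕜 : Type*} [RCLike 𝕜] [NormedAlgebra 𝕜 ℂ] {N : ℕ}

/-- The brackets of all elements of an algebra with a fixed observable lie in a given submodule as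
soon as those of the generators do. -/
theorem poissonBracket_mem_of_mem_adjoin {s : Set (Observable 𝕜 N)}
    {B : Subalgebra ℂ (Observable 𝕜 N)} (T : Submodule B (Observable 𝕜 N)) {g : Observable 𝕜 N}
    (hs : ∀ x ∈ s, IsAnalytic x) (hsB : s ⊆ B) (hg : IsAnalytic g)
    (h : ∀ x ∈ s, poissonBracket x g ∈ T) {f : Observable 𝕜 N} (hf : f ∈ Algebra.adjoin ℂ s) :
    poissonBracket f g ∈ T := by
  have key : IsAnalytic f ∧ f ∈ B ∧ poissonBracket f g ∈ T := by
    induction hf using Algebra.adjoin_induction with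
    | mem x hx => exact ⟨hs x hx, hsB hx, h x hx⟩
    | algebraMap r =>
      refine ⟨isAnalytic_const r, B.algebraMap_mem r, ?_⟩
      rw [poissonBracket_const_left r hg]
      exact T.zero_mem
    | add x y _ _ hx hy =>
      refine ⟨hx.1.add hy.1, B.add_mem hx.2.1 hy.2.1, ?_⟩
      rw [poissonBracket_add_left hx.1 hy.1 hg]
      exact T.add_mem hx.2.2 hy.2.2
    | mul x y _ _ hx hy =>
      refine ⟨hx.1.mul hy.1, B.mul_mem hx.2.1 hy.2.1, ?_⟩
      rw [poissonBracket_mul_left hx.1 hy.1 hg]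
      exact T.add_mem (T.smul_mem ⟨x, hx.2.1⟩ hy.2.2) (T.smul_mem ⟨y, hy.2.1⟩ hx.2.2)
  exact key.2.2

/-- The elements of an ideal of an algebra of observables, as a submodule of all observables. -/
def idealRange {B : Subalgebra ℂ (Observable 𝕜 N)} (I : Ideal B) :
    Submodule B (Observable 𝕜 N) :=
  Submodule.map (Algebra.linearMap B (Observable 𝕜 N)) I

theorem mem_idealRange {B : Subalgebra ℂ (Observable 𝕜 N)} {I : Ideal B} {x : Observable 𝕜 N} :
    x ∈ idealRange I ↔ ∃ b ∈ I, (b : Observable 𝕜 N) = x :=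
  Submodule.mem_map

theorem mem_idealRange_top {B : Subalgebra ℂ (Observable 𝕜 N)} {x : Observable 𝕜 N} :
    x ∈ idealRange (⊤ : Ideal B) ↔ x ∈ B := by
  rw [mem_idealRange]
  exact ⟨fun ⟨b, _, hb⟩ => hb ▸ b.2, fun hx => ⟨⟨x, hx⟩, Submodule.mem_top, rfl⟩⟩

variable (ν : ℝ) (a : ℂ)

theorem isAnalytic_genA (s : GenIndex N) : IsAnalytic (genA ν a s : Observable 𝕜 N) := by
  rcases s with k | mn
  · exact isAnalytic_F ν _
  · exact isAnalytic_Ka ν a _ _ (Nat.le_add_left _ _) (Nat.le_add_left _ _)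

theorem isAnalytic_of_mem_adjoin_genA {f : Observable 𝕜 N}
    (hf : f ∈ Algebra.adjoin ℂ (Set.range (genA ν a))) : IsAnalytic f := by
  have h : Algebra.adjoin ℂ (Set.range (genA ν a)) ≤ analyticObservables 𝕜 N := by
    rw [Algebra.adjoin_le_iff]
    rintro _ ⟨s, rfl⟩
    exact isAnalytic_genA ν a s
  exact h hf

theorem F_mem_adjoin_F (k : ℕ) : (F ν k : Observable 𝕜 N) ∈
    Algebra.adjoin ℂ (Set.range fun k : Fin N => (F ν (k + 1) : Observable 𝕜 N)) := by
  rw [Algebra.adjoin_range_eq_range_aeval, ← aeval_F_powerSumPoly]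
  exact ⟨_, rfl⟩

theorem adjoin_F_le : Algebra.adjoin ℂ (Set.range fun k : Fin N => (F ν (k + 1) : Observable 𝕜 N)) ≤
    Algebra.adjoin ℂ (Set.range (genA ν a)) := by
  refine Algebra.adjoin_mono ?_
  rintro _ ⟨k, rfl⟩
  exact ⟨Sum.inl k, rfl⟩

theorem poissonBracket_mem_adjoin_genA {f g : Observable 𝕜 N}
    (hf : f ∈ Algebra.adjoin ℂ (Set.range (genA ν a)))
    (hg : g ∈ Algebra.adjoin ℂ (Set.range (genA ν a))) :
    poissonBracket f g ∈ Algebra.adjoin ℂ (Set.range (genA ν a : GenIndex N → Observable 𝕜 N)) := by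
  have han : ∀ x ∈ Set.range (genA ν a : GenIndex N → Observable 𝕜 N), IsAnalytic x := by
    rintro _ ⟨s, rfl⟩
    exact isAnalytic_genA ν a s
  refine mem_idealRange_top.1 (poissonBracket_mem_of_mem_adjoin (idealRange ⊤) han
    Algebra.subset_adjoin (isAnalytic_of_mem_adjoin_genA ν a hg) ?_ hf)
  rintro _ ⟨s, rfl⟩
  rw [mem_idealRange_top, poissonBracket_antisymm]
  refine neg_mem (mem_idealRange_top.1 (poissonBracket_mem_of_mem_adjoin (idealRange ⊤) han
    Algebra.subset_adjoin (isAnalytic_genA ν a s) ?_ hg))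
  rintro _ ⟨t, rfl⟩
  exact mem_idealRange_top.2
    (degLE_bracket_genA ν a (2 * N) (Nat.le_succ _) (fun _ => le_rfl) t s).mem_adjoin

/-- The brackets of `F_i` with the generators are quadratic in the functions `F_k`, and every term
has a factor `F_k` with `1 ≤ k ≤ N`. -/
theorem poissonBracket_genA_F_mem {B : Subalgebra ℂ (Observable 𝕜 N)}
    (T : Submodule B (Observable 𝕜 N)) (hB : ∀ k, F ν k ∈ B) (hT : ∀ k : Fin N, F ν (k + 1) ∈ T)
    (s : GenIndex N) (i : ℕ) : poissonBracket (genA ν a s) (F ν i) ∈ T := by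
  rcases s with k | ⟨⟨m, n⟩, hmn⟩
  · change poissonBracket (F ν _) (F ν i) ∈ T
    rw [poissonBracket_F_F]
    exact T.zero_mem
  · have hFF : ∀ (k : Fin N) (q : ℕ), (F ν (k + 1) * F ν q : Observable 𝕜 N) ∈ T := fun k q => by
      rw [mul_comm]
      exact T.smul_mem ⟨F ν q, hB q⟩ (hT k)
    have hsmul : ∀ (c : ℂ) (x : Observable 𝕜 N), x ∈ T → c • x ∈ T := fun c x hx => by
      rw [Algebra.smul_def]
      exact T.smul_mem ⟨algebraMap ℂ _ c, B.algebraMap_mem c⟩ hx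
    change poissonBracket (Ka ν a (m + 1) (n + 1)) (F ν i) ∈ T
    rw [poissonBracket_antisymm,
      poissonBracket_F_Ka ν a i _ _ (Nat.le_add_left _ _) (Nat.le_add_left _ _)]
    exact T.neg_mem (T.add_mem (hsmul _ _ (T.sub_mem (hFF m _) (hFF n _)))
      (hsmul _ _ (T.sub_mem (hFF m _) (hFF n _))))

theorem poissonBracket_genA_mem_adjoin_F (s : GenIndex N) {f : Observable 𝕜 N}
    (hf : f ∈ Algebra.adjoin ℂ (Set.range fun k : Fin N => (F ν (k + 1) : Observable 𝕜 N))) :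
    poissonBracket (genA ν a s) f ∈
      Algebra.adjoin ℂ (Set.range fun k : Fin N => (F ν (k + 1) : Observable 𝕜 N)) := by
  rw [poissonBracket_antisymm]
  refine neg_mem (mem_idealRange_top.1 (poissonBracket_mem_of_mem_adjoin (idealRange ⊤) ?_
    Algebra.subset_adjoin (isAnalytic_genA ν a s) ?_ hf))
  · rintro _ ⟨k, rfl⟩
    exact isAnalytic_F ν _
  · rintro _ ⟨k, rfl⟩
    rw [poissonBracket_antisymm]
    exact Submodule.neg_mem _ (poissonBracket_genA_F_mem ν a _ (F_mem_adjoin_F ν)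
      (fun k => mem_idealRange_top.2 (F_mem_adjoin_F ν _)) s _)

/-- The functions `F_1, …, F_N` generate a Poisson ideal. -/
theorem poissonBracket_mem_span_F {B : Subalgebra ℂ (Observable 𝕜 N)}
    (hB : B = Algebra.adjoin ℂ (Set.range (genA ν a))) {f : Observable 𝕜 N} (hf : f ∈ B) {x : B}
    (hx : x ∈ Ideal.span {b : B | ∃ k : Fin N, (b : Observable 𝕜 N) = F ν (k + 1)}) :
    poissonBracket f x ∈
      idealRange (Ideal.span {b : B | ∃ k : Fin N, (b : Observable 𝕜 N) = F ν (k + 1)}) := by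
  set I := Ideal.span {b : B | ∃ k : Fin N, (b : Observable 𝕜 N) = F ν (k + 1)} with hI
  have hFB : ∀ k, F ν k ∈ B := fun k => hB ▸ adjoin_F_le ν a (F_mem_adjoin_F ν k)
  have hFI : ∀ k : Fin N, F ν (k + 1) ∈ idealRange I := fun k =>
    mem_idealRange.2 ⟨⟨_, hFB _⟩, Ideal.subset_span ⟨k, rfl⟩, rfl⟩
  have han : ∀ g ∈ B, IsAnalytic g := fun g hg => isAnalytic_of_mem_adjoin_genA ν a (hB ▸ hg)
  rw [poissonBracket_antisymm]
  refine Submodule.neg_mem _ ?_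
  induction hx using Submodule.span_induction with
  | mem x hx =>
    obtain ⟨k, hk⟩ := hx
    rw [hk, poissonBracket_antisymm]
    refine Submodule.neg_mem _ (poissonBracket_mem_of_mem_adjoin (s := Set.range (genA ν a)) _
      ?_ ?_ (isAnalytic_F ν _) ?_ (hB ▸ hf))
    · rintro _ ⟨s, rfl⟩
      exact isAnalytic_genA ν a s
    · rw [hB]
      exact Algebra.subset_adjoin
    · rintro _ ⟨s, rfl⟩
      exact poissonBracket_genA_F_mem ν a _ hFB hFI s _
  | zero =>
    have h := poissonBracket_const_left 0 (han f hf)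
    rw [map_zero] at h
    rw [ZeroMemClass.coe_zero, h]
    exact Submodule.zero_mem _
  | add x y _ _ hx hy =>
    rw [Subalgebra.coe_add, poissonBracket_add_left (han _ x.2) (han _ y.2) (han f hf)]
    exact Submodule.add_mem _ hx hy
  | smul r x hxI hx =>
    rw [smul_eq_mul, Subalgebra.coe_mul,
      poissonBracket_mul_left (han _ r.2) (han _ x.2) (han f hf), mul_comm (x : Observable 𝕜 N)]
    have hrf : poissonBracket (r : Observable 𝕜 N) f ∈ B := by
      have h := poissonBracket_mem_adjoin_genA ν a (hB.le r.2) (hB.le hf)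
      exact hB.ge h
    exact Submodule.add_mem _ (Submodule.smul_mem _ r hx)
      (Submodule.smul_mem _ (⟨_, hrf⟩ : B) (mem_idealRange.2 ⟨x, hxI, rfl⟩))

theorem step_of_mem_adjoin_genA {ν h : ℝ} {c₀ : ℂ} (hh : h ≠ 0) (hν : ν ≠ 0)
    (hc₀ : c₀ ^ 2 = -(Complex.I * (h : ℂ) * (ν : ℂ))) {f : Observable 𝕜 N}
    (hf : f ∈ Algebra.adjoin ℂ (Set.range (genA ν (-((h : ℂ) * c₀⁻¹)))))
    {z z' : PhaseSpace 𝕜 N} (hs : NPStep h c₀ z z') : f z' = f z := by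
  induction hf using Algebra.adjoin_induction with
  | mem x hx =>
    obtain ⟨k | mn, rfl⟩ := hx
    · exact F_step hh hc₀ hs _
    · exact Ka_step hh hν hc₀ hs _ _ (Nat.le_add_left _ _) (Nat.le_add_left _ _)
  | algebraMap r => rfl
  | add x y _ _ hx hy => rw [Pi.add_apply, Pi.add_apply, hx, hy]
  | mul x y _ _ hx hy => rw [Pi.mul_apply, Pi.mul_apply, hx, hy]

end SymmetryAlgebra

/-! ### The coefficient `α` -/

section Coefficient

variable {ν h : ℝ} {c₀ : ℂ}

theorem ofReal_sqrt_sq (hh : 0 < h) : (Real.sqrt h : ℂ) ^ 2 = h := by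
  rw [← Complex.ofReal_pow, Real.sq_sqrt hh.le]

theorem alpha_mul_sqrt (hh : 0 < h) : alpha h c₀ * (Real.sqrt h : ℂ) = -((h : ℂ) * c₀⁻¹) := by
  rw [alpha, div_eq_mul_inv]
  linear_combination -c₀⁻¹ * ofReal_sqrt_sq hh

theorem alpha_eq_or (hν : ν ≠ 0) (hh : 0 < h)
    (hc₀ : c₀ ^ 2 = -(Complex.I * (h : ℂ) * (ν : ℂ))) :
    alpha h c₀ = (1 + Complex.I) / (2 * (ν : ℂ)) ^ (1 / 2 : ℂ) ∨
      alpha h c₀ = -((1 + Complex.I) / (2 * (ν : ℂ)) ^ (1 / 2 : ℂ)) := by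
  rw [← sq_eq_sq_iff_eq_or_eq_neg]
  have h1 : ((2 * (ν : ℂ)) ^ (1 / 2 : ℂ)) ^ 2 = 2 * (ν : ℂ) := by
    rw [one_div]
    exact Complex.cpow_nat_inv_pow _ two_ne_zero
  have hhC : (h : ℂ) ≠ 0 := Complex.ofReal_ne_zero.2 hh.ne'
  have hνC : (ν : ℂ) ≠ 0 := Complex.ofReal_ne_zero.2 hν
  rw [alpha, neg_sq, div_pow, div_pow, h1, ofReal_sqrt_sq hh, hc₀]
  field_simp
  linear_combination -(2 + Complex.I) * Complex.I_sq

end Coefficient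

end CalogeroMoser

end

theorem mainTheorem4 {𝕜 : Type*} [RCLike 𝕜] [NormedAlgebra 𝕜 ℂ]
    (N : ℕ) (hN : 1 ≤ N) (ν h : ℝ) (hν : ν ≠ 0) (hh : 0 < h)
    (c₀ : ℂ) (hc₀ : c₀ ^ 2 = -(Complex.I * (h : ℂ) * (ν : ℂ))) :
    -- the deformation coefficient is `α = (1 + i)/√(2ν)`, up to the sign fixed by that of `c₀`
    (alpha h c₀ = (1 + Complex.I) / (2 * (ν : ℂ)) ^ (1 / 2 : ℂ) ∨
      alpha h c₀ = -((1 + Complex.I) / (2 * (ν : ℂ)) ^ (1 / 2 : ℂ))) ∧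
    -- the elements of the algebra are analytic integrals of motion of the correspondence
    (∀ f ∈ symAlgebra 𝕜 N ν h c₀,
      IsAnalytic f ∧ ∀ z z' : PhaseSpace 𝕜 N, NPStep h c₀ z z' → f z' = f z) ∧
    -- the algebra is closed under the Poisson bracket
    (∀ f ∈ symAlgebra 𝕜 N ν h c₀, ∀ g ∈ symAlgebra 𝕜 N ν h c₀,
      poissonBracket f g ∈ symAlgebra 𝕜 N ν h c₀) ∧
    -- Poisson commutation relations
    (∀ m n : ℕ, 1 ≤ m → 1 ≤ n →
      poissonBracket (F ν m : Observable 𝕜 N) (F ν n) = 0) ∧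
    (∀ i m n : ℕ, 1 ≤ i → 1 ≤ m → 1 ≤ n →
      poissonBracket (F ν i : Observable 𝕜 N) (Kt ν h c₀ m n) =
        (i : ℂ) • (F ν m * F ν (i + n - 2) - F ν n * F ν (i + m - 2))
        + ((i : ℂ) * (alpha h c₀ * (Real.sqrt h : ℂ))) •
            (F ν m * F ν (i + n - 1) - F ν n * F ν (i + m - 1))) ∧
    (∀ i j m n : ℕ, 1 ≤ i → 1 ≤ j → 1 ≤ m → 1 ≤ n →
      poissonBracket (Kt ν h c₀ i j : Observable 𝕜 N) (Kt ν h c₀ m n) =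
        F ν i * ((m : ℂ) • Kt ν h c₀ n (j + m - 2) + (n : ℂ) • Kt ν h c₀ (j + n - 2) m)
        + F ν j * ((m : ℂ) • Kt ν h c₀ (i + m - 2) n + (n : ℂ) • Kt ν h c₀ m (i + n - 2))
        + F ν m * ((i : ℂ) • Kt ν h c₀ (i + n - 2) j + (j : ℂ) • Kt ν h c₀ i (j + n - 2))
        + F ν n * ((i : ℂ) • Kt ν h c₀ j (i + m - 2) + (j : ℂ) • Kt ν h c₀ (j + m - 2) i)
        + (alpha h c₀ * (Real.sqrt h : ℂ)) •
          (F ν i * ((m : ℂ) • Kt ν h c₀ n (j + m - 1) + (n : ℂ) • Kt ν h c₀ (j + n - 1) m)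
          + F ν j * ((m : ℂ) • Kt ν h c₀ (i + m - 1) n + (n : ℂ) • Kt ν h c₀ m (i + n - 1))
          + F ν m * ((i : ℂ) • Kt ν h c₀ (i + n - 1) j + (j : ℂ) • Kt ν h c₀ i (j + n - 1))
          + F ν n * ((i : ℂ) • Kt ν h c₀ j (i + m - 1)
              + (j : ℂ) • Kt ν h c₀ (j + m - 1) i))) ∧
    -- closure relations
    (∀ s : ℕ, 1 ≤ s →
      (F ν (N + s) : Observable 𝕜 N) =
        -∑ k ∈ Finset.Icc 1 N, bellF ν k * F ν (N + s - k)) ∧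
    (∀ s l : ℕ, 1 ≤ s → 1 ≤ l →
      (Kt ν h c₀ (N + s) l : Observable 𝕜 N) =
        -∑ k ∈ Finset.Icc 1 N, bellF ν k * Kt ν h c₀ (N + s - k) l) ∧
    (∀ i j : ℕ, 1 ≤ i → 1 ≤ j →
      (F ν j * Kt ν h c₀ 0 i - F ν i * Kt ν h c₀ 0 j : Observable 𝕜 N) =
        (N : ℂ) • Kt ν h c₀ j i) ∧
    -- the ideal generated by the `F_i` is stable under brackets with the whole algebra, and the
    -- brackets of generators with polynomials in the `F_i` are again polynomials in the `F_i`
    (∀ f ∈ symAlgebra 𝕜 N ν h c₀, ∀ a ∈ idealF 𝕜 N ν h c₀,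
      ∃ b ∈ idealF 𝕜 N ν h c₀,
        (b : Observable 𝕜 N) = poissonBracket f (a : Observable 𝕜 N)) ∧
    (∀ a : GenIndex N,
      ∀ f ∈ Algebra.adjoin ℂ (Set.range fun k : Fin N => (F ν (k + 1) : Observable 𝕜 N)),
        poissonBracket (genDiscrete ν h c₀ a) f ∈
          Algebra.adjoin ℂ (Set.range fun k : Fin N => (F ν (k + 1) : Observable 𝕜 N))) ∧
    -- degree, and comparison with the continuous model
    (2 ≤ N → algebraDegree (genDiscrete ν h c₀ : GenIndex N → Observable 𝕜 N) = 2 * (N : ℕ∞)) ∧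
    (2 < N → algebraDegree (genDiscrete ν h c₀ : GenIndex N → Observable 𝕜 N) =
      algebraDegree (gen ν : GenIndex N → Observable 𝕜 N) + 1) ∧
    (N = 2 → algebraDegree (genDiscrete ν h c₀ : GenIndex N → Observable 𝕜 N) =
      algebraDegree (gen ν : GenIndex N → Observable 𝕜 N) + 2) := by
  have ha : -((h : ℂ) * c₀⁻¹) ≠ 0 := neg_ne_zero.2
    (mul_ne_zero (Complex.ofReal_ne_zero.2 hh.ne') (inv_ne_zero (c₀_ne_zero hν hh.ne' hc₀)))
  have hA : symAlgebra 𝕜 N ν h c₀ =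
      Algebra.adjoin ℂ (Set.range (genA ν (-((h : ℂ) * c₀⁻¹)))) := by
    rw [symAlgebra, genDiscrete_eq_genA]
  have hdeg (hN2 : 2 ≤ N) :
      algebraDegree (genDiscrete ν h c₀ : GenIndex N → Observable 𝕜 N) = (2 * N : ℕ) := by
    rw [genDiscrete_eq_genA]
    exact algebraDegree_genA ν _ hN2 ha
  refine ⟨alpha_eq_or hν hh hc₀, fun f hf => ?_, fun f hf g hg => ?_,
    fun m n _ _ => poissonBracket_F_F ν m n, fun i m n _ hm hn => ?_,
    fun i j m n hi hj hm hn => ?_, fun s _ => F_add ν s, fun s l hs _ => ?_, fun i j _ _ => ?_,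
    fun f hf x hx => mem_idealRange.1 (poissonBracket_mem_span_F ν _ hA hf hx),
    fun s f hf => ?_, fun hN2 => ?_, fun hN3 => ?_, fun hN2 => ?_⟩
  · rw [hA] at hf
    exact ⟨isAnalytic_of_mem_adjoin_genA ν _ hf,
      fun z z' hs => step_of_mem_adjoin_genA hh.ne' hν hc₀ hf hs⟩
  · rw [hA] at hf hg ⊢
    exact poissonBracket_mem_adjoin_genA ν _ hf hg
  · rw [alpha_mul_sqrt hh, Kt_eq_Ka]
    exact poissonBracket_F_Ka ν _ i m n hm hn
  · simp only [alpha_mul_sqrt hh, Kt_eq_Ka]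
    exact poissonBracket_Ka_Ka ν _ i j m n hi hj hm hn
  · simp only [Kt_eq_Ka]
    exact Ka_add ν _ s l hs
  · simp only [Kt_eq_Ka]
    exact F_mul_Ka_zero ν _ i j
  · rw [genDiscrete_eq_genA]
    exact poissonBracket_genA_mem_adjoin_F ν _ s hf
  · rw [hdeg hN2, Nat.cast_mul, Nat.cast_ofNat]
  · rw [hdeg hN3.le, gen_eq_genA, algebraDegree_genA_zero ν hN3, ← Nat.cast_succ]
    congr 1
    omega
  · rw [hdeg hN2.ge, gen_eq_genA, algebraDegree_genA_zero_two ν hN2, hN2]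
    rfl
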